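/- Graphs are finite and simple. An edge-colored graph is a pair $(G,c)$ where $G=(V,E)$ is a graph and $c:E\to P$ is an arbitrary function to a set $P$ of colors. For $v\in V$, let $\deg^c_G(v)$ be the number of distinct colors assigned by $c$ to the edges at $v$, and let $\delta^c(G)=\min_{v\in V}\deg_G^c(v)$. A directed graph $\vec G=(V,\vec E)$ is associated with $(G,c)$ if for every $v\in V$ the out-edges of $v$ in $\vec G$ are $(v,w_1),\dots,(v,w_d)$, where $d=\deg^c_G(v)$ and $\{v,w_1\},\dots,\{v,w_d\}\in E$ is a system of representatives of the color classes of $c$ on the edges at $v$ (one edge for each color appearing at $v$). For $\lambda\ge 0$, an edge-colored graph $(G,c)$ with $n$ vertices is $\lambda$-extremal if there are a directed graph $\vec G=(V,\vec E)$ associated with $(G,c)$ and a partition $V=V_0\cup V_1\cup V_2$ into three (possibly empty) classes such that, for every $i\in\mathbb Z_3$, the number of edges $(x,y)\in\vec E$ with $x\in V_i$ and $y\in V_{i+1}$ is at least $\left(\tfrac19-\lambda\right)n^2$. A cycle in $G$ is rainbow if its edges have pairwise distinct colors, and properly colored if any two distinct edges of it that share a vertex have distinct colors. **Lemma.** There exists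 an absolute constant $\lambda_0>0$ such that for all $0<\lambda\le\lambda_0$ and all integers $\ell\ge 4$ not divisible by $3$ there exists an integer $n_0=n_0(\lambda_0,\lambda,\ell)\ge 1$ such that, whenever $(G,c)$ is a $\lambda$-extremal edge-colored graph on $n\ge n_0$ vertices, the following hold: 1. If $\ell\ne 5$ and $\delta^c(G)\ge (n+5)/3$, then $(G,c)$ contains a rainbow cycle with $\ell$ edges. 2. If $\delta^c(G)\ge (n+4)/3$, then $(G,c)$ contains a properly colored cycle with $\ell$ edges. -/

import Mathlib

namespace ColoredCycles

universe u v

/-- The number of distinct colors that the edge coloring `c` assigns to the edges at `x`. -/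
noncomputable def colorDegree {V : Type u} {P : Type v} {G : SimpleGraph V}
    (c : G.EdgeLabeling P) (x : V) : ℕ :=
  Set.ncard {p : P | ∃ (y : V) (h : G.Adj x y), c.get x y h = p}

/-- The minimum color degree of an edge-colored graph (used for nonempty vertex sets). -/
noncomputable def minColorDegree {V : Type u} {P : Type v} {G : SimpleGraph V}
    (c : G.EdgeLabeling P) : ℕ :=
  ⨅ x : V, colorDegree c x

/-- The digraph `D` is associated with the edge-colored graph `(G, c)`: for every vertex `x`,
the out-neighbors of `x` in `D` come from edges `{x, y}` of `G` forming a system of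
representatives of the color classes of `c` on the edges at `x` (exactly one per color). -/
def IsAssociated {V : Type u} {P : Type v} {G : SimpleGraph V}
    (D : Digraph V) (c : G.EdgeLabeling P) : Prop :=
  (∀ x y : V, D.Adj x y → G.Adj x y) ∧
    ∀ (x y : V) (h : G.Adj x y),
      ∃! w : V, D.Adj x w ∧ ∃ h' : G.Adj x w, c.get x w h' = c.get x y h

/-- The number of edges of `D` directed from the set `A` to the set `B`. -/
noncomputable def edgesBetween {V : Type u} (D : Digraph V) (A B : Set V) : ℕ :=
  Set.ncard {e : V × V | e.1 ∈ A ∧ e.2 ∈ B ∧ D.Adj e.1 e.2}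

/-- The partition of the vertex set into the three (possibly empty) classes
`part ⁻¹' {i}`, `i ∈ ℤ/3`, is `lam`-extremal for the digraph `D`. -/
def IsExtremalPartition {V : Type u} [Fintype V] (lam : ℝ) (D : Digraph V)
    (part : V → ZMod 3) : Prop :=
  ∀ i : ZMod 3, (1 / 9 - lam) * (Fintype.card V : ℝ) ^ 2 ≤
    (edgesBetween D (part ⁻¹' {i}) (part ⁻¹' {i + 1}) : ℝ)

/-- A digraph is `lam`-extremal if it has a `lam`-extremal partition. -/
def IsExtremalDigraph {V : Type u} [Fintype V] (lam : ℝ) (D : Digraph V) : Prop :=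
  ∃ part : V → ZMod 3, IsExtremalPartition lam D part

/-- An edge-colored graph is `lam`-extremal if some digraph associated with it is. -/
def IsExtremal {V : Type u} [Fintype V] {P : Type v} {G : SimpleGraph V}
    (lam : ℝ) (c : G.EdgeLabeling P) : Prop :=
  ∃ D : Digraph V, IsAssociated D c ∧ IsExtremalDigraph lam D

/-- The subgraph `H` of `G` is a cycle with `l` vertices (used for `l ≥ 3`). -/
def IsCycleOfLength {V : Type u} {G : SimpleGraph V} (H : G.Subgraph) (l : ℕ) : Prop :=
  Nonempty (SimpleGraph.cycleGraph l ≃g H.coe)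

/-- The edges of the subgraph `H` receive pairwise distinct colors. -/
def IsRainbow {V : Type u} {P : Type v} {G : SimpleGraph V}
    (c : G.EdgeLabeling P) (H : G.Subgraph) : Prop :=
  ∀ e f : G.edgeSet, (e : Sym2 V) ∈ H.edgeSet → (f : Sym2 V) ∈ H.edgeSet → c e = c f → e = f

/-- Any two distinct edges of the subgraph `H` that share a vertex receive distinct colors. -/
def IsProperlyColored {V : Type u} {P : Type v} {G : SimpleGraph V}
    (c : G.EdgeLabeling P) (H : G.Subgraph) : Prop :=
  ∀ (x y z : V) (hy : H.Adj x y) (hz : H.Adj x z),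
    c.get x y hy.adj_sub = c.get x z hz.adj_sub → y = z

end ColoredCycles

namespace ColoredCycles

section Trails

variable {V : Type*} {P : Type*} {G : SimpleGraph V} {c : G.EdgeLabeling P}

/-- `{x, y}` is an edge of color `p`. -/
def Col (c : G.EdgeLabeling P) (x y : V) (p : P) : Prop :=
  ∃ h : G.Adj x y, c.get x y h = p

lemma Col.symm {x y : V} {p : P} (h : Col c x y p) : Col c y x p := by
  obtain ⟨h1, h2⟩ := h
  exact ⟨h1.symm, by rw [SimpleGraph.EdgeLabeling.get_comm]; exact h2⟩

lemma Col.ne {x y : V} {p : P} (h : Col c x y p) : x ≠ y := h.1.ne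

lemma Col.unique {x y : V} {p q : P} (h : Col c x y p) (h' : Col c x y q) : p = q := by
  obtain ⟨h1, rfl⟩ := h
  obtain ⟨h2, rfl⟩ := h'
  rfl

/-- `L` lists the (edge color, next vertex) pairs along a trail from `x` to `y`. -/
def IsTrail (c : G.EdgeLabeling P) : V → List (P × V) → V → Prop
  | x, [], y => x = y
  | x, e :: L, y => Col c x e.2 e.1 ∧ IsTrail c e.2 L y

lemma isTrail_append {x z : V} {L M : List (P × V)} :
    IsTrail c x (L ++ M) z ↔ ∃ y, IsTrail c x L y ∧ IsTrail c y M z := by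
  induction L generalizing x with
  | nil => simp [IsTrail]
  | cons e L ih => simp [IsTrail, ih, and_assoc]

/-- There is a closed trail of length `l` with distinct vertices and distinct edge colors. -/
def HasRainbowCycle (c : G.EdgeLabeling P) (l : ℕ) : Prop :=
  ∃ (x : V) (L : List (P × V)), IsTrail c x L x ∧ L.length = l ∧ (L.map Prod.fst).Nodup ∧
    (L.map Prod.snd).Nodup

/-- There is a closed trail of length `l` with distinct vertices whose consecutive edges have
distinct colors. -/
def HasProperCycle (c : G.EdgeLabeling P) (l : ℕ) : Prop :=
  ∃ (x : V) (e : P × V) (L : List (P × V)), IsTrail c x (e :: L) x ∧ (e :: L).length = l ∧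
    ((e :: L).map Prod.fst ++ [e.1]).IsChain (· ≠ ·) ∧ ((e :: L).map Prod.snd).Nodup

lemma HasRainbowCycle.hasProperCycle {l : ℕ} (hl : 2 ≤ l) (h : HasRainbowCycle c l) :
    HasProperCycle c l := by
  obtain ⟨x, L, h1, h2, h3, h4⟩ := h
  match L, h1, h2, h3, h4 with
  | [], _, h2, _, _ => simp at h2; omega
  | e :: L, h1, h2, h3, h4 =>
    refine ⟨x, e, L, h1, h2, ?_, h4⟩
    rw [List.isChain_append]
    refine ⟨h3.isChain, by simp, ?_⟩
    intro p hp q hq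
    simp only [List.head?_cons, Option.mem_def, Option.some.injEq] at hq
    subst hq
    rintro rfl
    cases L with
    | nil => simp at h2; omega
    | cons f L =>
      simp only [List.map_cons, List.getLast?_cons_cons, Option.mem_def] at hp
      have := List.mem_of_getLast? hp
      rw [List.map_cons, List.nodup_cons] at h3
      exact h3.1 this

lemma IsTrail.getElem {x y : V} {L : List (P × V)} (h : IsTrail c x L y) (i : ℕ)
    (hi : i + 1 < L.length) : Col c (L[i]).2 (L[i + 1]).2 (L[i + 1]).1 := by
  induction L generalizing x i with
  | nil => simp at hi
  | cons e L ih =>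
    cases i with
    | zero =>
      cases L with
      | nil => simp at hi
      | cons f L => exact h.2.1
    | succ i => simpa using ih h.2 i (by simpa using hi)

lemma IsTrail.getLast {x y : V} {L : List (P × V)} (h : IsTrail c x L y) (hL : L ≠ []) :
    (L.getLast hL).2 = y := by
  induction L generalizing x with
  | nil => simp at hL
  | cons e L ih =>
    cases L with
    | nil => exact h.2
    | cons f L => simpa using ih h.2 (by simp)

/-- The subgraph formed by a closed walk given by a cyclic sequence of vertices. -/
def cyclicSubgraph {m : ℕ} (g : Fin (m + 3) → V) (hg : ∀ i, G.Adj (g i) (g (i + 1))) :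
    G.Subgraph where
  verts := Set.range g
  Adj a b := ∃ i, (a = g i ∧ b = g (i + 1)) ∨ (b = g i ∧ a = g (i + 1))
  adj_sub := by
    rintro a b ⟨i, ⟨rfl, rfl⟩ | ⟨rfl, rfl⟩⟩
    · exact hg i
    · exact (hg i).symm
  edge_vert := by
    rintro a b ⟨i, ⟨rfl, rfl⟩ | ⟨rfl, rfl⟩⟩ <;> exact ⟨_, rfl⟩
  symm := by
    constructor
    rintro a b ⟨i, h⟩
    exact ⟨i, h.symm⟩

lemma isCycleOfLength_cyclicSubgraph {m : ℕ} (g : Fin (m + 3) → V)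
    (hg : ∀ i, G.Adj (g i) (g (i + 1))) (hinj : Function.Injective g) :
    IsCycleOfLength (cyclicSubgraph g hg) (m + 3) := by
  refine ⟨⟨Equiv.ofInjective g hinj, ?_⟩⟩
  intro a b
  rw [SimpleGraph.cycleGraph_adj]
  change (∃ i, (g a = g i ∧ g b = g (i + 1)) ∨ (g b = g i ∧ g a = g (i + 1))) ↔ _
  constructor
  · rintro ⟨i, ⟨h1, h2⟩ | ⟨h1, h2⟩⟩
    · obtain rfl := hinj h1
      obtain rfl := hinj h2
      right; simp
    · obtain rfl := hinj h1
      obtain rfl := hinj h2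
      left; simp
  · rintro (h | h)
    · exact ⟨b, Or.inr ⟨rfl, by rw [← h]; congr 1; abel⟩⟩
    · exact ⟨a, Or.inl ⟨rfl, by rw [← h]; congr 1; abel⟩⟩

lemma col_of_edge_eq {a b : V} (e : G.edgeSet) (he : (e : Sym2 V) = s(a, b)) {p : P}
    (h : Col c a b p) : c e = p := by
  obtain ⟨h1, rfl⟩ := h
  rw [SimpleGraph.EdgeLabeling.get_eq]
  congr 1
  exact Subtype.ext he

lemma isRainbow_cyclicSubgraph {m : ℕ} (g : Fin (m + 3) → V) (κ : Fin (m + 3) → P)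
    (hg : ∀ i, G.Adj (g i) (g (i + 1))) (hc : ∀ i, Col c (g i) (g (i + 1)) (κ i))
    (hκ : Function.Injective κ) : IsRainbow c (cyclicSubgraph g hg) := by
  have key : ∀ e : G.edgeSet, (e : Sym2 V) ∈ (cyclicSubgraph g hg).edgeSet →
      ∃ i, (e : Sym2 V) = s(g i, g (i + 1)) := by
    rintro ⟨e, he⟩
    induction e using Sym2.ind with
    | _ a b =>
      rintro ⟨i, ⟨rfl, rfl⟩ | ⟨rfl, rfl⟩⟩
      · exact ⟨i, rfl⟩
      · exact ⟨i, Sym2.eq_swap⟩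
  intro e f he hf hef
  obtain ⟨i, hi⟩ := key e he
  obtain ⟨j, hj⟩ := key f hf
  rw [col_of_edge_eq e hi (hc i),
    col_of_edge_eq f hj (hc j)] at hef
  obtain rfl := hκ hef
  exact Subtype.ext (hi.trans hj.symm)

lemma isProperlyColored_cyclicSubgraph {m : ℕ} (g : Fin (m + 3) → V) (κ : Fin (m + 3) → P)
    (hg : ∀ i, G.Adj (g i) (g (i + 1))) (hinj : Function.Injective g)
    (hc : ∀ i, Col c (g i) (g (i + 1)) (κ i)) (hκ : ∀ i, κ i ≠ κ (i + 1)) :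
    IsProperlyColored c (cyclicSubgraph g hg) := by
  intro x y z hy hz hyz
  have e1 : Col c x y (c.get x y hy.adj_sub) := ⟨_, rfl⟩
  have e2 : Col c x z (c.get x y hy.adj_sub) := ⟨hz.adj_sub, hyz.symm⟩
  generalize c.get x y hy.adj_sub = p at e1 e2
  obtain ⟨i, ⟨h1, h2⟩ | ⟨h1, h2⟩⟩ := hy <;> obtain ⟨j, ⟨h3, h4⟩ | ⟨h3, h4⟩⟩ := hz
  · obtain rfl := hinj (h1.symm.trans h3)
    rw [h2, h4]
  · obtain rfl := hinj (h1.symm.trans h4)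
    subst h2 h3 h1
    exact absurd ((hc j).unique e2.symm |>.trans (e1.unique (hc (j + 1)))) (hκ j)
  · obtain rfl := hinj (h2.symm.trans h3)
    subst h4 h1 h2
    exact absurd ((hc i).unique e1.symm |>.trans (e2.unique (hc (i + 1)))) (hκ i)
  · obtain rfl := add_right_cancel (hinj (h2.symm.trans h4))
    rw [h1, h3]

lemma col_of_closed {m : ℕ} {x : V} {L : List (P × V)} (h : IsTrail c x L x)
    (hl : L.length = m + 3) (i : Fin (m + 3)) :
    Col c (L[(i : ℕ)]).2 (L[((i + 1 : Fin (m + 3)) : ℕ)]).2 (L[((i + 1 : Fin (m + 3)) : ℕ)]).1 := by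
  by_cases hi : (i : ℕ) = m + 2
  · have e0 : ((i + 1 : Fin (m + 3)) : ℕ) = 0 := by
      have : i = Fin.last (m + 2) := Fin.ext hi
      simp [this]
    have hne : L ≠ [] := by rintro rfl; simp at hl
    have e1 : L[(i : ℕ)] = L.getLast hne := by
      rw [List.getLast_eq_getElem]; congr 1; omega
    simp only [e0, e1, h.getLast hne]
    cases L with
    | nil => simp at hne
    | cons e L => exact h.1
  · have e0 : ((i + 1 : Fin (m + 3)) : ℕ) = i + 1 := by
      rw [Fin.val_add_one_of_lt]
      rw [Fin.lt_def]; simp; omega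
    simp only [e0]
    exact h.getElem i (by omega)

lemma HasRainbowCycle.exists_subgraph {l : ℕ} (hl : 3 ≤ l) (h : HasRainbowCycle c l) :
    ∃ H : G.Subgraph, IsCycleOfLength H l ∧ IsRainbow c H := by
  obtain ⟨m, rfl⟩ : ∃ m, l = m + 3 := ⟨l - 3, by omega⟩
  obtain ⟨x, L, h1, h2, h3, h4⟩ := h
  have hc := fun i => col_of_closed h1 h2 i
  have hg : ∀ i : Fin (m + 3), G.Adj (L[(i : ℕ)]).2 (L[((i + 1 : Fin (m + 3)) : ℕ)]).2 :=
    fun i => (hc i).1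
  refine ⟨cyclicSubgraph (fun i => (L[(i : ℕ)]).2) hg, isCycleOfLength_cyclicSubgraph _ _ ?_,
    isRainbow_cyclicSubgraph _ _ _ hc ?_⟩
  · intro i j hij
    have := (List.Nodup.getElem_inj_iff h4 (i := i) (j := j) (hi := by simp [h2])
      (hj := by simp [h2])).1 (by simpa using hij)
    exact Fin.ext this
  · intro i j hij
    have := (List.Nodup.getElem_inj_iff h3 (i := (i + 1 : Fin (m + 3))) (j := (j + 1 : Fin (m + 3)))
      (hi := by simp [h2]) (hj := by simp [h2])).1 (by simpa using hij)
    exact add_right_cancel (Fin.ext this)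

lemma HasProperCycle.exists_subgraph {l : ℕ} (hl : 3 ≤ l) (h : HasProperCycle c l) :
    ∃ H : G.Subgraph, IsCycleOfLength H l ∧ IsProperlyColored c H := by
  obtain ⟨m, rfl⟩ : ∃ m, l = m + 3 := ⟨l - 3, by omega⟩
  obtain ⟨x, e, L', h1, h2, h3, h4⟩ := h
  have hL0 : ∀ h0 : 0 < (e :: L').length, (e :: L')[0] = e := fun _ => rfl
  generalize hL : e :: L' = L at *
  have hc := fun i => col_of_closed h1 h2 i
  have hg : ∀ i : Fin (m + 3), G.Adj (L[(i : ℕ)]).2 (L[((i + 1 : Fin (m + 3)) : ℕ)]).2 :=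
    fun i => (hc i).1
  have hinj : Function.Injective (fun i : Fin (m + 3) => (L[(i : ℕ)]).2) := by
    intro i j hij
    have := (List.Nodup.getElem_inj_iff h4 (i := i) (j := j) (hi := by simp [h2])
      (hj := by simp [h2])).1 (by simpa using hij)
    exact Fin.ext this
  have hprop : ∀ i : Fin (m + 3), (L[(i : ℕ)]).1 ≠ (L[((i + 1 : Fin (m + 3)) : ℕ)]).1 := by
    intro i
    have h5 := List.isChain_iff_getElem.1 h3 i (by simp [h2]; omega)
    by_cases hi : (i : ℕ) = m + 2
    · have e0 : ((i + 1 : Fin (m + 3)) : ℕ) = 0 := by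
        have : i = Fin.last (m + 2) := Fin.ext hi
        simp [this]
      rw [List.getElem_append_left (by simp [h2]), List.getElem_append_right (by simp [h2]; omega)]
        at h5
      simp only [e0, hL0]
      simpa using h5
    · have e0 : ((i + 1 : Fin (m + 3)) : ℕ) = i + 1 := by
        rw [Fin.val_add_one_of_lt]
        rw [Fin.lt_def]; simp; omega
      rw [List.getElem_append_left (by simp [h2]), List.getElem_append_left (by simp [h2]; omega)]
        at h5
      simp only [e0]
      simpa using h5
  exact ⟨cyclicSubgraph (fun i => (L[(i : ℕ)]).2) hg, isCycleOfLength_cyclicSubgraph _ _ hinj,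
    isProperlyColored_cyclicSubgraph _ _ _ hinj hc fun i => hprop (i + 1)⟩

end Trails

section Frames

open scoped Classical

variable {V : Type*} [Fintype V] {P : Type*} {G : SimpleGraph V} {c : G.EdgeLabeling P}

variable (c) in
/-- Almost all of the graph looks like a blow-up of a directed triangle with classes `U i`, in
which the arcs directed into `x` have the color `α x`. -/
structure Frame where
  U : ZMod 3 → Finset V
  α : V → P
  disj : ∀ {i j x}, x ∈ U i → x ∈ U j → i = j
  inj : ∀ {i x y}, x ∈ U i → y ∈ U i → α x = α y → x = y
  card_ge : ∀ i, (1 / 3 - 1 / 10000) * (Fintype.card V : ℝ) ≤ ((U i).card : ℝ)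
  miss_out : ∀ {i x}, x ∈ U i →
    (((U (i + 1)).filter fun y => ¬ Col c x y (α y)).card : ℝ) ≤ Fintype.card V / 10000
  miss_in : ∀ {i x}, x ∈ U i →
    (((U (i - 1)).filter fun y => ¬ Col c y x (α x)).card : ℝ) ≤ Fintype.card V / 10000

namespace Frame

variable (A : Frame c)

/-- The vertices `y` of the class `a` for which `z` can be followed by `y` along the frame. -/
noncomputable def out (z : V) (a : ZMod 3) : Finset V :=
  (A.U a).filter fun y => Col c z y (A.α y)

lemma mem_out {z : V} {a : ZMod 3} {y : V} : y ∈ A.out z a ↔ y ∈ A.U a ∧ Col c z y (A.α y) := by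
  simp [out]

lemma card_out_add (z : V) (a : ZMod 3) :
    ((A.out z a).card : ℝ) + ((A.U a).filter fun y => ¬ Col c z y (A.α y)).card
      = (A.U a).card := by
  rw [out]
  exact_mod_cast Finset.card_filter_add_card_filter_not (s := A.U a) fun y => Col c z y (A.α y)

lemma card_color_le (a : ZMod 3) (F : Finset P) :
    ((A.U a).filter fun u => A.α u ∈ F).card ≤ F.card := by
  refine Finset.card_le_card_of_injOn A.α (by intro u; simp) ?_
  intro u hu v hv h
  simp only [Finset.coe_filter, Set.mem_ofPred_eq] at hu hv
  exact A.inj hu.1 hv.1 h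

/-- A large subset of a class has an element outside given small sets. -/
lemma exists_mem_avoid {a : ZMod 3} {X : Finset V} (hX : X ⊆ A.U a) (S : Finset V) (F : Finset P)
    (h : S.card + F.card < X.card) : ∃ u ∈ X, u ∉ S ∧ A.α u ∉ F := by
  by_contra hcon
  push Not at hcon
  have h1 : X ⊆ S ∪ ((A.U a).filter fun u => A.α u ∈ F) := by
    intro u hu
    by_cases hS : u ∈ S
    · simp [hS]
    · simp [hX hu, hcon u hu hS]
  have h2 := Finset.card_le_card h1
  have h3 := Finset.card_union_le S ((A.U a).filter fun u => A.α u ∈ F)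
  have h4 := A.card_color_le a F
  omega

lemma card_inter_in_ge {b : ZMod 3} {x : V} (hx : x ∈ A.U b) {X : Finset V}
    (hX : X ⊆ A.U (b - 1)) :
    (X.card : ℝ) - Fintype.card V / 10000 ≤
      ((X.filter fun u => Col c u x (A.α x)).card : ℝ) := by
  have h1 := Finset.card_filter_add_card_filter_not (s := X) fun u => Col c u x (A.α x)
  have h2 : (X.filter fun u => ¬ Col c u x (A.α x)).card ≤
      ((A.U (b - 1)).filter fun u => ¬ Col c u x (A.α x)).card :=
    Finset.card_le_card (Finset.filter_subset_filter _ hX)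
  have h3 := A.miss_in hx
  have h1' : ((X.filter fun u => Col c u x (A.α x)).card : ℝ) +
      (X.filter fun u => ¬ Col c u x (A.α x)).card = X.card := by exact_mod_cast h1
  have h2' : ((X.filter fun u => ¬ Col c u x (A.α x)).card : ℝ) ≤
      ((A.U (b - 1)).filter fun u => ¬ Col c u x (A.α x)).card := by exact_mod_cast h2
  linarith

lemma card_out_next {i : ZMod 3} {x : V} (hx : x ∈ A.U i) :
    (1 / 3 - 2 / 10000) * (Fintype.card V : ℝ) ≤ (A.out x (i + 1)).card := by
  have h1 := A.card_out_add x (i + 1)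
  have h2 := A.miss_out hx
  have h3 := A.card_ge (i + 1)
  linarith

lemma card_out_next' {i a : ZMod 3} {x : V} (hx : x ∈ A.U i) (ha : a = i + 1) :
    (Fintype.card V : ℝ) / 1000 ≤ (A.out x a).card := by
  subst ha
  have := A.card_out_next hx
  have h0 : (0 : ℝ) ≤ Fintype.card V := by positivity
  linarith

/-- The (color, vertex) pairs along a path that follows the frame. -/
def steps (M : List V) : List (P × V) := M.map fun u => (A.α u, u)

@[simp] lemma steps_fst (M : List V) : (A.steps M).map Prod.fst = M.map A.α := by
  simp [steps]

@[simp] lemma steps_snd (M : List V) : (A.steps M).map Prod.snd = M := by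
  simp [steps, Function.comp_def]

@[simp] lemma steps_length (M : List V) : (A.steps M).length = M.length := by
  simp [steps]

lemma exists_link {b : ZMod 3} {x : V} (hx : x ∈ A.U b) (m : ℕ)
    (hm : 10000 * m ≤ Fintype.card V) (s : ℕ) :
    ∀ (z : V) (a : ZMod 3) (S : Finset V) (F : Finset P),
      (Fintype.card V : ℝ) / 1000 ≤ (A.out z a).card → (s : ZMod 3) + 1 = b - a →
      S.card + F.card + 2 * s < m →
      ∃ M : List V, M.length = s + 1 ∧ IsTrail c z (A.steps M ++ [(A.α x, x)]) x ∧ M.Nodup ∧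
        (M.map A.α).Nodup ∧ ∀ u ∈ M, u ∉ S ∧ A.α u ∉ F := by
  have hm' : 10000 * (m : ℝ) ≤ Fintype.card V := by exact_mod_cast hm
  induction s with
  | zero =>
    intro z a S F hz hs hSF
    have ha : A.out z a ⊆ A.U (b - 1) := by
      intro u hu
      have : a = b - 1 := by
        simp only [Nat.cast_zero, zero_add] at hs
        rw [hs]; ring
      rw [← this]
      exact (A.mem_out.1 hu).1
    have h1 := A.card_inter_in_ge hx ha
    obtain ⟨u, hu, hS, hF⟩ := A.exists_mem_avoid ((Finset.filter_subset _ _).trans ha) S F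
      (X := (A.out z a).filter fun u => Col c u x (A.α x)) (by
        have : ((S.card : ℝ) + F.card) < m := by exact_mod_cast (by omega)
        have : ((S.card : ℝ) + F.card) <
            ((A.out z a).filter fun u => Col c u x (A.α x)).card := by linarith
        exact_mod_cast this)
    rw [Finset.mem_filter, A.mem_out] at hu
    exact ⟨[u], by simp, by simp [steps, IsTrail, hu.1.2, hu.2], by simp, by simp, by
      simp [hS, hF]⟩
  | succ s ih =>
    intro z a S F hz hs hSF
    obtain ⟨u, hu, hS, hF⟩ := A.exists_mem_avoid (X := A.out z a) (a := a)
      (fun u hu => (A.mem_out.1 hu).1) S F (by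
        have : ((S.card : ℝ) + F.card) < m := by exact_mod_cast (by omega)
        have h0 : (0 : ℝ) ≤ m := by positivity
        have : ((S.card : ℝ) + F.card) < (A.out z a).card := by linarith
        exact_mod_cast this)
    rw [A.mem_out] at hu
    obtain ⟨M, h1, h2, h3, h4, h5⟩ := ih u (a + 1) (insert u S) (insert (A.α u) F)
      (A.card_out_next' hu.1 rfl) (by push_cast at hs; linear_combination hs) (by
        have := Finset.card_insert_le u S
        have := Finset.card_insert_le (A.α u) F
        omega)
    refine ⟨u :: M, by simp [h1], ⟨hu.2, h2⟩, ?_, ?_, ?_⟩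
    · refine List.nodup_cons.2 ⟨fun h => ?_, h3⟩
      exact (h5 u h).1 (by simp)
    · rw [List.map_cons]
      refine List.nodup_cons.2 ⟨fun h => ?_, h4⟩
      obtain ⟨w, hw, hwu⟩ := List.mem_map.1 h
      exact (h5 w hw).2 (by simp [hwu])
    · intro w hw
      rcases List.mem_cons.1 hw with rfl | hw
      · exact ⟨hS, hF⟩
      · have := h5 w hw
        simp only [Finset.mem_insert, not_or] at this
        exact ⟨this.1.2, this.2.2⟩

/-- Closing a rainbow path from `x` to `z` along the frame. -/
lemma hasRainbowCycle_of_path {l : ℕ} (hn : 100000 * (l + 10) ≤ Fintype.card V) {b a : ZMod 3}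
    {x z : V} (hx : x ∈ A.U b) (K : List (P × V)) (hK : IsTrail c x K z)
    (hv : (x :: K.map Prod.snd).Nodup) (hc : (A.α x :: K.map Prod.fst).Nodup)
    (hz : (Fintype.card V : ℝ) / 1000 ≤ (A.out z a).card) (hl : K.length + 2 ≤ l)
    (hmod : (l : ZMod 3) = K.length + 1 + (b - a)) : HasRainbowCycle c l := by
  obtain ⟨s, rfl⟩ : ∃ s, l = K.length + 2 + s := ⟨l - (K.length + 2), by omega⟩
  obtain ⟨M, h1, h2, h3, h4, h5⟩ := A.exists_link hx (10 * (K.length + 2 + s + 10)) (by omega) s z a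
    (x :: K.map Prod.snd).toFinset (A.α x :: K.map Prod.fst).toFinset hz
    (by push_cast at hmod; linear_combination hmod) (by
      have e1 := List.toFinset_card_le (x :: K.map Prod.snd)
      have e2 := List.toFinset_card_le (A.α x :: K.map Prod.fst)
      simp only [List.length_cons, List.length_map] at e1 e2
      omega)
  refine ⟨x, K ++ (A.steps M ++ [(A.α x, x)]), isTrail_append.2 ⟨z, hK, h2⟩, by simp [h1]; omega,
    ?_, ?_⟩
  · simp only [List.map_append, steps_fst, List.map_cons, List.map_nil]
    rw [← List.append_assoc, List.nodup_append_comm]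
    simp only [List.cons_append, List.nil_append]
    rw [← List.cons_append]
    refine List.Nodup.append hc h4 ?_
    intro p hp hp'
    obtain ⟨u, hu, rfl⟩ := List.mem_map.1 hp'
    exact (h5 u hu).2 (by simpa using hp)
  · simp only [List.map_append, steps_snd, List.map_cons, List.map_nil]
    rw [← List.append_assoc, List.nodup_append_comm]
    simp only [List.cons_append, List.nil_append]
    rw [← List.cons_append]
    refine List.Nodup.append hv h3 ?_
    intro p hp hp'
    exact (h5 p hp').1 (by simpa using hp)

/-- Closing a properly colored path from `x` to `z` along the frame. -/
lemma hasProperCycle_of_path {l : ℕ} (hn : 100000 * (l + 10) ≤ Fintype.card V) {b a : ZMod 3}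
    {x z : V} (hx : x ∈ A.U b) (e : P × V) (K : List (P × V)) (hK : IsTrail c x (e :: K) z)
    (hv : (x :: (e :: K).map Prod.snd).Nodup)
    (hc : ((e :: K).map Prod.fst).IsChain (· ≠ ·)) (hx' : A.α x ≠ e.1)
    (hz : (Fintype.card V : ℝ) / 1000 ≤ (A.out z a).card) (hl : K.length + 3 ≤ l)
    (hmod : (l : ZMod 3) = K.length + 2 + (b - a)) : HasProperCycle c l := by
  obtain ⟨s, rfl⟩ : ∃ s, l = K.length + 3 + s := ⟨l - (K.length + 3), by omega⟩
  obtain ⟨M, h1, h2, h3, h4, h5⟩ := A.exists_link hx (10 * (K.length + 3 + s + 10)) (by omega) s z a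
    (x :: (e :: K).map Prod.snd).toFinset (A.α x :: (e :: K).map Prod.fst).toFinset hz
    (by push_cast at hmod; linear_combination hmod) (by
      have e1 := List.toFinset_card_le (x :: (e :: K).map Prod.snd)
      have e2 := List.toFinset_card_le (A.α x :: (e :: K).map Prod.fst)
      simp only [List.length_cons, List.length_map] at e1 e2
      omega)
  refine ⟨x, e, K ++ (A.steps M ++ [(A.α x, x)]), ?_, by simp [h1]; omega,
    ?_, ?_⟩
  · rw [← List.cons_append]
    exact isTrail_append.2 ⟨z, hK, h2⟩
  · rw [← List.cons_append]
    simp only [List.map_append, steps_fst]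
    rw [List.append_assoc, List.append_assoc]
    refine List.IsChain.append hc (List.IsChain.append h4.isChain (by simp [hx']) ?_) ?_
    · intro p hp q hq
      obtain ⟨u, hu, rfl⟩ := List.mem_map.1 (List.mem_of_getLast? hp)
      simp only [List.map_cons, List.map_nil, List.cons_append, List.head?_cons, Option.mem_def,
        Option.some.injEq] at hq
      subst hq
      intro h
      exact (h5 u hu).2 (by simp [h])
    · intro p hp q hq
      cases M with
      | nil => simp at h1
      | cons u M =>
        simp only [List.map_cons, List.cons_append, List.head?_cons, Option.mem_def,
          Option.some.injEq] at hq
        subst hq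
        rintro rfl
        have := List.mem_of_getLast? hp
        exact (h5 u (by simp)).2 (List.mem_toFinset.2 (List.mem_cons_of_mem _ this))
  · rw [← List.cons_append]
    simp only [List.map_append, steps_snd]
    rw [← List.append_assoc, List.nodup_append_comm]
    simp only [List.map_cons, List.map_nil, List.cons_append, List.nil_append]
    rw [← List.cons_append, ← List.cons_append]
    refine List.Nodup.append (by simpa using hv) h3 ?_
    intro p hp hp'
    exact (h5 p hp').1 (List.mem_toFinset.2 hp)

end Frame

end Frames

section Counting

open scoped Classical

/-- A pair avoiding two relations that are sparse from the left and from the right. -/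
lemma exists_pair_avoid {V W : Type*} (X : Finset V) (Y : Finset W) (R S : V → W → Prop)
    [∀ x, DecidablePred (R x)] [∀ y, DecidablePred fun x => S x y] {r s : ℝ}
    (hR : ∀ x ∈ X, ((Y.filter fun y => R x y).card : ℝ) ≤ r)
    (hS : ∀ y ∈ Y, ((X.filter fun x => S x y).card : ℝ) ≤ s)
    (h : r * X.card + s * Y.card < X.card * Y.card) :
    ∃ x ∈ X, ∃ y ∈ Y, ¬ R x y ∧ ¬ S x y := by
  by_contra hcon
  push Not at hcon
  have h1 : X ×ˢ Y ⊆ ((X ×ˢ Y).filter fun e => R e.1 e.2) ∪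
      ((X ×ˢ Y).filter fun e => S e.1 e.2) := by
    rintro ⟨x, y⟩ he
    rw [Finset.mem_product] at he
    by_cases hr : R x y
    · simp [he.1, he.2, hr]
    · simp [he.1, he.2, hcon x he.1 y he.2 hr]
  have h2 := (Finset.card_le_card h1).trans (Finset.card_union_le _ _)
  have h3 : (((X ×ˢ Y).filter fun e => R e.1 e.2).card : ℝ) ≤ r * X.card := by
    rw [Finset.card_filter, Finset.sum_product]
    push_cast
    have : ∀ x ∈ X, (∑ y ∈ Y, if R x y then (1 : ℝ) else 0) ≤ r := by
      intro x hx
      have := hR x hx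
      rw [Finset.card_filter] at this
      push_cast at this
      exact this
    calc _ ≤ ∑ x ∈ X, r := Finset.sum_le_sum this
      _ = r * X.card := by rw [Finset.sum_const, nsmul_eq_mul]; ring
  have h4 : (((X ×ˢ Y).filter fun e => S e.1 e.2).card : ℝ) ≤ s * Y.card := by
    rw [Finset.card_filter, Finset.sum_product_right]
    push_cast
    have : ∀ y ∈ Y, (∑ x ∈ X, if S x y then (1 : ℝ) else 0) ≤ s := by
      intro x hx
      have := hS x hx
      rw [Finset.card_filter] at this
      push_cast at this
      exact this
    calc _ ≤ ∑ y ∈ Y, s := Finset.sum_le_sum this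
      _ = s * Y.card := by rw [Finset.sum_const, nsmul_eq_mul]; ring
  rw [Finset.card_product] at h2
  have h5 : ((X.card : ℝ) * Y.card) ≤ ((X ×ˢ Y).filter fun e => R e.1 e.2).card +
    ((X ×ˢ Y).filter fun e => S e.1 e.2).card := by exact_mod_cast h2
  linarith

lemma card_filter_le_add {V : Type*} {Y : Finset V} {Q R S : V → Prop} [DecidablePred Q]
    [DecidablePred R] [DecidablePred S] {r s : ℝ} (h : ∀ y ∈ Y, Q y → R y ∨ S y)
    (hR : ((Y.filter R).card : ℝ) ≤ r) (hS : ((Y.filter S).card : ℝ) ≤ s) :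
    ((Y.filter Q).card : ℝ) ≤ r + s := by
  have h1 : Y.filter Q ⊆ Y.filter R ∪ Y.filter S := by
    intro y hy
    rw [Finset.mem_filter] at hy
    simpa [hy.1] using h y hy.1 hy.2
  have h2 := (Finset.card_le_card h1).trans (Finset.card_union_le _ _)
  have h3 : ((Y.filter Q).card : ℝ) ≤ (Y.filter R).card + (Y.filter S).card := by
    exact_mod_cast h2
  linarith

lemma card_filter_le_one {V : Type*} {Y : Finset V} {Q : V → Prop} [DecidablePred Q]
    (h : ∀ u ∈ Y, ∀ v ∈ Y, Q u → Q v → u = v) : ((Y.filter Q).card : ℝ) ≤ 1 := by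
  have : (Y.filter Q).card ≤ 1 := Finset.card_le_one.2 (by
    intro u hu v hv
    rw [Finset.mem_filter] at hu hv
    exact h u hu.1 v hv.1 hu.2 hv.2)
  exact_mod_cast this

end Counting

section Digraphs

open scoped Classical

variable {V : Type*} {P : Type*} {G : SimpleGraph V} {c : G.EdgeLabeling P}
  {D : Digraph V}

lemma IsAssociated.exists_col (hD : IsAssociated D c) {x y : V} (h : D.Adj x y) :
    ∃ p, Col c x y p := ⟨_, hD.1 x y h, rfl⟩

lemma IsAssociated.eq_of_col (hD : IsAssociated D c) {x y z : V} {p : P} (h : D.Adj x y)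
    (h' : D.Adj x z) (hy : Col c x y p) (hz : Col c x z p) : y = z := by
  obtain ⟨h1, rfl⟩ := hy
  obtain ⟨h2, h3⟩ := hz
  obtain ⟨w, -, hw⟩ := hD.2 x y h1
  rw [hw y ⟨h, h1, rfl⟩, hw z ⟨h', h2, h3⟩]

variable [Fintype V]

/-- The out-neighbors of `x` along edges whose color is not `p`. -/
noncomputable def outNe (c : G.EdgeLabeling P) (D : Digraph V) (x : V) (p : P) : Finset V :=
  Finset.univ.filter fun y => D.Adj x y ∧ ¬ Col c x y p

lemma mem_outNe {x y : V} {p : P} : y ∈ outNe c D x p ↔ D.Adj x y ∧ ¬ Col c x y p := by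
  simp [outNe]

lemma IsAssociated.colorDegree_le (hD : IsAssociated D c) (x : V) :
    colorDegree c x ≤ (Finset.univ.filter fun y => D.Adj x y).card := by
  have key : ∀ p ∈ {p : P | ∃ (y : V) (h : G.Adj x y), c.get x y h = p},
      ∃ w, D.Adj x w ∧ Col c x w p := by
    rintro p ⟨y, h, rfl⟩
    obtain ⟨w, ⟨h1, h2, h3⟩, -⟩ := hD.2 x y h
    exact ⟨w, h1, h2, h3⟩
  have : Nonempty V := ⟨x⟩
  choose! f hf using key
  rw [colorDegree, ← Set.ncard_coe_finset]
  refine Set.ncard_le_ncard_of_injOn f ?_ ?_ (Finset.finite_toSet _)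
  · intro p hp
    simpa using (hf p hp).1
  · intro p hp q hq hpq
    have h1 := (hf p hp).2
    rw [hpq] at h1
    exact h1.unique (hf q hq).2

lemma IsAssociated.colorDegree_le_outNe (hD : IsAssociated D c) (x : V) (p : P) :
    colorDegree c x ≤ (outNe c D x p).card + 1 := by
  refine (hD.colorDegree_le x).trans ?_
  rw [← Finset.card_filter_add_card_filter_not (s := Finset.univ.filter fun y => D.Adj x y)
    fun y => ¬ Col c x y p]
  have h1 : ((Finset.univ.filter fun y => D.Adj x y).filter fun y => ¬ Col c x y p) =
      outNe c D x p := by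
    rw [outNe, Finset.filter_filter]
  rw [h1]
  refine Nat.add_le_add_left (Finset.card_le_one.2 ?_) _
  intro y hy z hz
  simp only [not_not, Finset.mem_filter, Finset.mem_univ, true_and] at hy hz
  exact hD.eq_of_col hy.1 hz.1 hy.2 hz.2

end Digraphs

section OutLarge

open scoped Classical

variable {V : Type*} [Fintype V] {P : Type*} {G : SimpleGraph V} {c : G.EdgeLabeling P}
  {D : Digraph V} (A : Frame c) {l : ℕ}

namespace Frame

lemma card_union_ge :
    (1 - 3 / 10000) * (Fintype.card V : ℝ) ≤ ((A.U 0).card + (A.U 1).card + (A.U 2).card : ℝ) := by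
  have h0 := A.card_ge 0
  have h1 := A.card_ge 1
  have h2 := A.card_ge 2
  linarith

lemma disjoint {i j : ZMod 3} (h : i ≠ j) : Disjoint (A.U i) (A.U j) :=
  Finset.disjoint_left.2 fun _ hx hy => h (A.disj hx hy)

lemma card_rest_le :
    ((Finset.univ.filter fun x => ∀ i, x ∉ A.U i).card : ℝ) ≤
      3 / 10000 * (Fintype.card V : ℝ) := by
  have h1 : (A.U 0 ∪ A.U 1 ∪ A.U 2 ∪ Finset.univ.filter fun x => ∀ i, x ∉ A.U i).card ≤
    Fintype.card V := Finset.card_le_univ _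
  rw [Finset.card_union_of_disjoint, Finset.card_union_of_disjoint, Finset.card_union_of_disjoint]
    at h1
  · have h2 := A.card_union_ge
    have h3 : ((A.U 0).card + (A.U 1).card + (A.U 2).card +
      (Finset.univ.filter fun x => ∀ i, x ∉ A.U i).card : ℝ) ≤ Fintype.card V := by
        exact_mod_cast h1
    linarith
  · exact A.disjoint (by decide)
  · exact Finset.disjoint_union_left.2 ⟨A.disjoint (by decide), A.disjoint (by decide)⟩
  · rw [Finset.disjoint_left]
    intro x hx hx'
    rw [Finset.mem_filter] at hx'
    simp only [Finset.mem_union] at hx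
    rcases hx with (hx | hx) | hx <;> exact hx'.2 _ hx

lemma card_le (a : ZMod 3) :
    ((A.U a).card : ℝ) ≤ (1 / 3 + 2 / 10000) * (Fintype.card V : ℝ) := by
  have h1 : (A.U a ∪ A.U (a + 1) ∪ A.U (a + 2)).card ≤ Fintype.card V := Finset.card_le_univ _
  rw [Finset.card_union_of_disjoint, Finset.card_union_of_disjoint] at h1
  · have h2 := A.card_ge (a + 1)
    have h3 := A.card_ge (a + 2)
    have h3 : ((A.U a).card + (A.U (a + 1)).card + (A.U (a + 2)).card : ℝ) ≤ Fintype.card V := by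
        exact_mod_cast h1
    linarith
  · exact A.disjoint (by clear h1; revert a; decide)
  · exact Finset.disjoint_union_left.2 ⟨A.disjoint (by clear h1; revert a; decide),
      A.disjoint (by clear h1; revert a; decide)⟩

lemma length_mod (h3 : ¬ 3 ∣ l) : (l : ZMod 3) = 1 ∨ (l : ZMod 3) = 2 := by
  have h : (l : ZMod 3) ≠ 0 := by rwa [Ne, ZMod.natCast_eq_zero_iff]
  generalize (l : ZMod 3) = t at h
  revert t; decide

lemma card_off_le (hD : IsAssociated D c) (hn : 100000 * (l + 10) ≤ Fintype.card V) (hl : 4 ≤ l)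
    (h3 : ¬ 3 ∣ l) (hr : ¬ HasRainbowCycle c l) (z : V) (a : ZMod 3) :
    ((A.U a).filter fun y => D.Adj z y ∧ ¬ Col c z y (A.α y)).card ≤ 3 := by
  by_contra hcon
  push Not at hcon
  set Y := (A.U a).filter fun y => D.Adj z y ∧ ¬ Col c z y (A.α y) with hY
  have hYm : ∀ y ∈ Y, y ∈ A.U a ∧ D.Adj z y ∧ ¬ Col c z y (A.α y) := by
    intro y hy
    simpa [hY] using hy
  have hcol : ∀ y ∈ Y, ∃ p, Col c z y p := fun y hy => hD.exists_col (hYm y hy).2.1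
  have : Nonempty P := ⟨A.α z⟩
  choose! p hp using hcol
  have hn' : 100000 * ((l : ℝ) + 10) ≤ Fintype.card V := by exact_mod_cast hn
  have hl' : (4 : ℝ) ≤ l := by exact_mod_cast hl
  have hone : ∀ q, ∀ u ∈ Y, ∀ v ∈ Y, q = A.α u → q = A.α v → u = v := fun q u hu v hv h h' =>
    A.inj (hYm u hu).1 (hYm v hv).1 (h.symm.trans h')
  obtain ⟨y, hy, y', hy', hR, hS⟩ := exists_pair_avoid Y Y (fun y y' => y = y' ∨ p y = A.α y')
    (fun y y' => p y' = A.α y) (r := 1 + 1) (s := 1)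
    (fun y hy => card_filter_le_add (fun _ _ h => h)
      (card_filter_le_one fun u _ v _ h h' => h.symm.trans h') (card_filter_le_one (hone _)))
    (fun y hy => card_filter_le_one (hone _)) (by
      have : (3 : ℝ) < Y.card := by exact_mod_cast hcon
      nlinarith)
  simp only [not_or] at hR
  obtain ⟨hne, hpy'⟩ := hR
  obtain ⟨hya, hDy, hpy⟩ := hYm y hy
  obtain ⟨hya', hDy', hpyy'⟩ := hYm y' hy'
  have cy := hp y hy
  have cy' := hp y' hy'
  have hpp : p y ≠ p y' := fun h => hne (hD.eq_of_col hDy hDy' (h ▸ cy) cy')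
  have h1 : p y ≠ A.α y := fun h => hpy (h ▸ cy)
  have h2 : p y' ≠ A.α y' := fun h => hpyy' (h ▸ cy')
  have hαα : A.α y ≠ A.α y' := fun h => hne (A.inj hya hya' h)
  rcases length_mod h3 with hmod | hmod
  · obtain ⟨u, hu, huS, huF⟩ := A.exists_mem_avoid
      (X := (((A.U (a - 1)).filter fun u => Col c u y (A.α y)).filter
        fun u => Col c u y' (A.α y')))
      (a := a - 1) ((Finset.filter_subset _ _).trans (Finset.filter_subset _ _)) {y, y', z}
      {p y, p y', A.α y, A.α y'} (by
        have e1 := A.card_inter_in_ge hya (subset_refl (A.U (a - 1)))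
        have e2 := A.card_inter_in_ge hya'
          (Finset.filter_subset (fun u => Col c u y (A.α y)) (A.U (a - 1)))
        have e3 := A.card_ge (a - 1)
        have e4 : ({y, y', z} : Finset V).card ≤ 3 := Finset.card_le_three
        have e5 : ({p y, p y', A.α y, A.α y'} : Finset P).card ≤ 4 := Finset.card_le_four
        have e6 : (({y, y', z} : Finset V).card : ℝ) +
          ({p y, p y', A.α y, A.α y'} : Finset P).card ≤ 7 := by exact_mod_cast (by omega)
        have : (({y, y', z} : Finset V).card : ℝ) +
          ({p y, p y', A.α y, A.α y'} : Finset P).card <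
          (((A.U (a - 1)).filter fun u => Col c u y (A.α y)).filter
            fun u => Col c u y' (A.α y')).card := by linarith
        exact_mod_cast this)
    simp only [Finset.mem_filter] at hu
    simp only [Finset.mem_insert, Finset.mem_singleton, not_or] at huS huF
    have hK : IsTrail c y [(p y, z), (p y', y'), (A.α y', u)] u :=
      ⟨cy.symm, cy', hu.2.symm, rfl⟩
    have hzy := hDy
    have hyz : y ≠ z := cy.ne.symm
    have hyz' : z ≠ y' := cy'.ne
    by_cases hl4 : l = 4
    · refine hr ⟨y, [(p y, z), (p y', y'), (A.α y', u)] ++ [(A.α y, y)],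
        isTrail_append.2 ⟨u, hK, hu.1.2, rfl⟩, by simp [hl4], ?_, ?_⟩
      · grind
      · grind
    · refine hr (A.hasRainbowCycle_of_path hn hya _ hK ?_ ?_ (A.card_out_next' hu.1.1 rfl)
        ?_ ?_)
      · grind
      · grind
      · simp; omega
      · simp; rw [hmod]; ring_nf; decide
  · have hK : IsTrail c y [(p y, z), (p y', y')] y' := ⟨cy.symm, cy', rfl⟩
    have hyz : y ≠ z := cy.ne.symm
    have hyz' : z ≠ y' := cy'.ne
    refine hr (A.hasRainbowCycle_of_path hn hya _ hK ?_ ?_ (A.card_out_next' hya' rfl) ?_ ?_)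
    · grind
    · grind
    · simp; omega
    · simp; rw [hmod]

lemma out_large (hD : IsAssociated D c) (hn : 100000 * (l + 10) ≤ Fintype.card V) (hl : 4 ≤ l)
    (h3 : ¬ 3 ∣ l) (hr : ¬ HasRainbowCycle c l)
    (hd : ∀ x, Fintype.card V + 4 ≤ 3 * colorDegree c x) (z : V) :
    (1 / 3 - 4 / 10000) * (Fintype.card V : ℝ) ≤
      (A.out z 0).card + (A.out z 1).card + (A.out z 2).card := by
  have hn' : 100000 * ((l : ℝ) + 10) ≤ Fintype.card V := by exact_mod_cast hn
  have h1 : (Finset.univ.filter fun y => D.Adj z y) ⊆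
      ((Finset.univ.filter fun x => ∀ i, x ∉ A.U i) ∪
      (A.out z 0 ∪ A.out z 1 ∪ A.out z 2)) ∪
      (((A.U 0).filter fun y => D.Adj z y ∧ ¬ Col c z y (A.α y)) ∪
      ((A.U 1).filter fun y => D.Adj z y ∧ ¬ Col c z y (A.α y)) ∪
      ((A.U 2).filter fun y => D.Adj z y ∧ ¬ Col c z y (A.α y))) := by
    intro y hy
    simp only [Finset.mem_filter, Finset.mem_univ, true_and] at hy
    simp only [Finset.mem_union, Finset.mem_filter, Finset.mem_univ, true_and, A.mem_out, hy]
    by_cases hU : ∀ i, y ∉ A.U i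
    · exact Or.inl (Or.inl hU)
    · push Not at hU
      obtain ⟨i, hi⟩ := hU
      obtain rfl | rfl | rfl : i = 0 ∨ i = 1 ∨ i = 2 := by clear hi; revert i; decide
      all_goals by_cases hc : Col c z y (A.α y) <;> simp [hi, hc]
  have h2 := (hD.colorDegree_le z).trans (Finset.card_le_card h1)
  have e0 := A.card_off_le hD hn hl h3 hr z 0
  have e1 := A.card_off_le hD hn hl h3 hr z 1
  have e2 := A.card_off_le hD hn hl h3 hr z 2
  have f1 := Finset.card_union_le ((Finset.univ.filter fun x => ∀ i, x ∉ A.U i) ∪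
      (A.out z 0 ∪ A.out z 1 ∪ A.out z 2))
      (((A.U 0).filter fun y => D.Adj z y ∧ ¬ Col c z y (A.α y)) ∪
      ((A.U 1).filter fun y => D.Adj z y ∧ ¬ Col c z y (A.α y)) ∪
      ((A.U 2).filter fun y => D.Adj z y ∧ ¬ Col c z y (A.α y)))
  have f2 := Finset.card_union_le (Finset.univ.filter fun x => ∀ i, x ∉ A.U i)
      (A.out z 0 ∪ A.out z 1 ∪ A.out z 2)
  have f3 := Finset.card_union_le (A.out z 0 ∪ A.out z 1) (A.out z 2)
  have f4 := Finset.card_union_le (A.out z 0) (A.out z 1)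
  have f5 := Finset.card_union_le (((A.U 0).filter fun y => D.Adj z y ∧ ¬ Col c z y (A.α y)) ∪
      ((A.U 1).filter fun y => D.Adj z y ∧ ¬ Col c z y (A.α y)))
      ((A.U 2).filter fun y => D.Adj z y ∧ ¬ Col c z y (A.α y))
  have f6 := Finset.card_union_le ((A.U 0).filter fun y => D.Adj z y ∧ ¬ Col c z y (A.α y))
      ((A.U 1).filter fun y => D.Adj z y ∧ ¬ Col c z y (A.α y))
  have g1 := A.card_rest_le
  have hdz := hd z
  have g2 : Fintype.card V + 4 ≤ 3 * ((Finset.univ.filter fun x => ∀ i, x ∉ A.U i).card +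
    ((A.out z 0).card + (A.out z 1).card + (A.out z 2).card) + 9) := by omega
  have g3 : (Fintype.card V : ℝ) + 4 ≤ 3 * ((Finset.univ.filter fun x => ∀ i, x ∉ A.U i).card +
    ((A.out z 0).card + (A.out z 1).card + (A.out z 2).card) + 9) := by exact_mod_cast g2
  have : (0 : ℝ) ≤ l := by positivity
  linarith

end Frame

end OutLarge

section Setups

lemma zmod_three_eq_of_forall_ne : ∀ {b b' a a' t : ZMod 3}, b ≠ b' → t ≠ 2 + (b - a) →
    t ≠ 2 + (b' - a) → t ≠ 2 + (b - a') → t ≠ 2 + (b' - a') → t = 1 ∨ t = 2 → a' = a := by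
  decide

set_option synthInstance.maxHeartbeats 400000 in
set_option synthInstance.maxSize 1000 in
lemma zmod_three_eq_or_eq : ∀ {b b' a t : ZMod 3}, b ≠ b' → t ≠ 2 + (b - a) → t ≠ 2 + (b' - a) →
    t = 1 ∨ t = 2 → (a = b + (t - 1) ∧ b' = b + 1 + (t - 1)) ∨
      (a = b' + (t - 1) ∧ b = b' + 1 + (t - 1)) := by
  decide

open scoped Classical

variable {V : Type*} [Fintype V] {P : Type*} {G : SimpleGraph V} {D : Digraph V} {l : ℕ}

/-- An edge-colored graph of large minimum color degree with a frame and no rainbow cycle of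
length `l`. -/
structure Setup (c : G.EdgeLabeling P) (D : Digraph V) (l : ℕ) extends Frame c where
  assoc : IsAssociated D c
  large : 100000 * (l + 10) ≤ Fintype.card V
  four_le : 4 ≤ l
  not_dvd : ¬ 3 ∣ l
  no_rainbow : ¬ HasRainbowCycle c l
  degree : ∀ x, Fintype.card V + 4 ≤ 3 * colorDegree c x

variable {c : G.EdgeLabeling P}

namespace Setup

variable (A : Setup c D l)

include A in
lemma large_real : (1400000 : ℝ) ≤ Fintype.card V := by
  have h1 := A.large
  have h2 := A.four_le
  exact_mod_cast (by omega)

/-- All but few of the edges from `v` along the frame lead to the class `a`. -/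
def IsFull (v : V) (a : ZMod 3) : Prop :=
  ∀ b ≠ a, ((A.out v b).card : ℝ) < (Fintype.card V : ℝ) / 1000

lemma out_sum_ge (z : V) (a : ZMod 3) : (1 / 3 - 4 / 10000) * (Fintype.card V : ℝ) ≤
    (A.out z a).card + (A.out z (a + 1)).card + (A.out z (a + 2)).card := by
  have h := A.out_large A.assoc A.large A.four_le A.not_dvd A.no_rainbow A.degree z
  obtain rfl | rfl | rfl : a = 0 ∨ a = 1 ∨ a = 2 := by clear h; revert a; decide
  · simpa using h
  · have e1 : (1 : ZMod 3) + 1 = 2 := rfl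
    have e2 : (1 : ZMod 3) + 2 = 0 := rfl
    rw [e1, e2]; linarith
  · have e1 : (2 : ZMod 3) + 1 = 0 := rfl
    have e2 : (2 : ZMod 3) + 2 = 1 := rfl
    rw [e1, e2]; linarith

variable {A}

lemma IsFull.card_ge {v : V} {a : ZMod 3} (h : A.IsFull v a) :
    (1 / 3 - 24 / 10000) * (Fintype.card V : ℝ) ≤ (A.out v a).card := by
  have h0 := A.out_sum_ge v a
  have h1 := h (a + 1) (by simp)
  have h2 := h (a + 2) (by clear h h0 h1; revert a; decide)
  linarith

lemma IsFull.linear {v : V} {a : ZMod 3} (h : A.IsFull v a) :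
    (Fintype.card V : ℝ) / 1000 ≤ (A.out v a).card := by
  have := h.card_ge
  have := A.large_real
  linarith

lemma IsFull.card_miss_le {v : V} {a : ZMod 3} (h : A.IsFull v a) :
    (((A.U a).filter fun y => ¬ Col c v y (A.α y)).card : ℝ) ≤ (Fintype.card V : ℝ) / 300 := by
  have h0 := h.card_ge
  have h1 := A.card_out_add v a
  have h2 := A.card_le a
  have := A.large_real
  linarith

lemma IsFull.unique {v : V} {a b : ZMod 3} (h : A.IsFull v a) (h' : A.IsFull v b) : a = b := by
  by_contra hab
  exact absurd (h b (Ne.symm hab)) (not_lt.2 h'.linear)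

variable (A)

lemma card_U_ge (a : ZMod 3) : (33 / 100 : ℝ) * Fintype.card V ≤ (A.U a).card := by
  have h1 := A.card_ge a
  have := A.large_real
  linarith

lemma card_U_le (a : ZMod 3) : ((A.U a).card : ℝ) ≤ (34 / 100 : ℝ) * Fintype.card V := by
  have h1 := A.card_le a
  have := A.large_real
  linarith

/-- A member of a class that is full points to the next class. -/
lemma eq_of_isFull_mem {v : V} {a k : ZMod 3} (h : A.IsFull v a) (hv : v ∈ A.U k) :
    a = k + 1 := by
  by_contra hne
  exact absurd (h (k + 1) (Ne.symm hne)) (not_lt.2 (A.card_out_next' hv rfl))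

include A in
lemma mod_cases : (l : ZMod 3) = 1 ∨ (l : ZMod 3) = 2 := Frame.length_mod A.not_dvd

/-- An edge that leaves its class in an unusual way cannot be continued so as to close up a cycle
of length `l`. -/
lemma mod_ne {x v : V} {a b : ZMod 3} {p : P} (hx : x ∈ A.U b) (h : Col c x v p) (hp : p ≠ A.α x)
    (hv : (Fintype.card V : ℝ) / 1000 ≤ (A.out v a).card) : (l : ZMod 3) ≠ 2 + (b - a) := by
  intro hl
  have := A.four_le
  refine A.no_rainbow (A.hasRainbowCycle_of_path A.large hx [(p, v)] ⟨h, rfl⟩ ?_ ?_ hv ?_ ?_)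
  · simpa using h.ne
  · simpa using hp.symm
  · simp; omega
  · rw [hl]; simp; ring_nf

/-- The out-neighbors of a vertex along edges not following the color of the vertex. -/
noncomputable def heads (x : V) : Finset V := outNe c D x (A.α x)

lemma mem_heads {x y : V} : y ∈ A.heads x ↔ D.Adj x y ∧ ¬ Col c x y (A.α x) := mem_outNe

lemma exists_col_of_mem_heads {x y : V} (h : y ∈ A.heads x) : ∃ p, Col c x y p ∧ p ≠ A.α x := by
  rw [mem_heads] at h
  obtain ⟨p, hp⟩ := A.assoc.exists_col h.1
  exact ⟨p, hp, fun e => h.2 (e ▸ hp)⟩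

lemma isFull_of_mem_heads {x x' v : V} {b b' : ZMod 3} (hx : x ∈ A.U b) (hx' : x' ∈ A.U b')
    (hb : b ≠ b') (h : v ∈ A.heads x) (h' : v ∈ A.heads x') :
    (A.IsFull v (b + (l - 1)) ∧ b' = b + 1 + (l - 1)) ∨
    (A.IsFull v (b' + (l - 1)) ∧ b = b' + 1 + (l - 1)) := by
  obtain ⟨p, hp, hpx⟩ := A.exists_col_of_mem_heads h
  obtain ⟨p', hp', hpx'⟩ := A.exists_col_of_mem_heads h'
  have key : ∀ a, (Fintype.card V : ℝ) / 1000 ≤ (A.out v a).card →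
      (l : ZMod 3) ≠ 2 + (b - a) ∧ (l : ZMod 3) ≠ 2 + (b' - a) := fun a ha =>
    ⟨A.mod_ne hx hp hpx ha, A.mod_ne hx' hp' hpx' ha⟩
  obtain ⟨a, ha⟩ : ∃ a, (Fintype.card V : ℝ) / 1000 ≤ (A.out v a).card := by
    by_contra hcon
    push Not at hcon
    have h0 := A.out_sum_ge v 0
    have h1 := hcon 0
    have h2 := hcon (0 + 1)
    have h3 := hcon (0 + 2)
    have := A.large_real
    linarith
  have hfull : A.IsFull v a := by
    intro a' ha'
    by_contra hcon
    have k1 := key a ha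
    have k2 := key a' (not_lt.1 hcon)
    exact ha' (zmod_three_eq_of_forall_ne hb k1.1 k1.2 k2.1 k2.2 A.mod_cases)
  have k1 := key a ha
  have := zmod_three_eq_or_eq hb k1.1 k1.2 A.mod_cases
  rcases this with ⟨rfl, h2⟩ | ⟨rfl, h2⟩
  · exact Or.inl ⟨hfull, h2⟩
  · exact Or.inr ⟨hfull, h2⟩

/-- The heads of the unusual edges at a vertex of the class `b`. -/
noncomputable def extra (b : ZMod 3) (x : V) : Finset V :=
  (A.heads x).filter fun v => A.IsFull v (b + (l - 1))

lemma mem_extra {b : ZMod 3} {x v : V} :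
    v ∈ A.extra b x ↔ v ∈ A.heads x ∧ A.IsFull v (b + (l - 1)) := by
  simp [extra]

lemma card_heads_add_le {k : ℕ} (hk : ∀ x, Fintype.card V + k ≤ 3 * colorDegree c x)
    {x : ZMod 3 → V} (hx : ∀ i, x i ∈ A.U i) (X : ZMod 3 → Finset V)
    (hX : ∀ i, ∀ v ∈ A.extra i (x i), v ∈ A.heads (x (i + 1 + (l - 1))) → v ∈ X i) (Z : Finset V)
    (hZ : ∀ v ∈ Z, ∀ i, v ∈ A.heads (x i) → v ∈ X i) :
    k + Z.card ≤ 3 + ∑ i, (X i).card := by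
  have hdisj : ∀ i j, i ≠ j → ∀ v ∈ A.heads (x i), v ∈ A.heads (x j) → v ∈ X i ∨ v ∈ X j := by
    intro i j hij v hi hj
    rcases A.isFull_of_mem_heads (hx i) (hx j) hij hi hj with ⟨h1, h2⟩ | ⟨h1, h2⟩
    · exact Or.inl (hX i v (A.mem_extra.2 ⟨hi, h1⟩) (h2 ▸ hj))
    · exact Or.inr (hX j v (A.mem_extra.2 ⟨hj, h1⟩) (h2 ▸ hi))
  have h1 : (Finset.univ.biUnion (fun i => A.heads (x i) \ X i) ∪ Z).card ≤ Fintype.card V :=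
    Finset.card_le_univ _
  rw [Finset.card_union_of_disjoint, Finset.card_biUnion] at h1
  · have h2 : ∀ i, colorDegree c (x i) ≤ (A.heads (x i) \ X i).card + (X i).card + 1 := by
      intro i
      have e1 := A.assoc.colorDegree_le_outNe (x i) (A.α (x i))
      have e2 : (A.heads (x i)).card ≤ (A.heads (x i) \ X i).card + (X i).card :=
        Finset.card_le_card_sdiff_add_card
      rw [heads] at *
      omega
    have h3 : ∑ i, colorDegree c (x i) ≤
        ∑ i, ((A.heads (x i) \ X i).card + (X i).card + 1) := Finset.sum_le_sum fun i _ => h2 i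
    rw [Finset.sum_add_distrib, Finset.sum_add_distrib] at h3
    have h4 : ∑ i : ZMod 3, (Fintype.card V + k) ≤ ∑ i, 3 * colorDegree c (x i) :=
      Finset.sum_le_sum fun i _ => hk (x i)
    rw [← Finset.mul_sum] at h4
    simp only [Finset.sum_const, Finset.card_univ, ZMod.card, smul_eq_mul, mul_one] at h3 h4
    omega
  · intro i _ j _ hij
    rw [Function.onFun, Finset.disjoint_left]
    intro v hv hv'
    rw [Finset.mem_sdiff] at hv hv'
    rcases hdisj i j hij v hv.1 hv'.1 with h | h
    · exact hv.2 h
    · exact hv'.2 h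
  · rw [Finset.disjoint_left]
    intro v hv hv'
    rw [Finset.mem_biUnion] at hv
    obtain ⟨i, -, hi⟩ := hv
    rw [Finset.mem_sdiff] at hi
    exact hi.2 (hZ v hv' i hi.1)

lemma le_sum_card_extra {k : ℕ} (hk : ∀ x, Fintype.card V + k ≤ 3 * colorDegree c x)
    {x : ZMod 3 → V} (hx : ∀ i, x i ∈ A.U i) :
    k ≤ 3 + ∑ i, (A.extra i (x i)).card := by
  have := A.card_heads_add_le hk hx (fun i => A.extra i (x i)) (fun i v hv _ => hv) ∅ (by simp)
  simpa using this

/-- In some class, every vertex has an unusual edge. -/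
lemma exists_class_extra : ∃ a, ∀ x ∈ A.U a, (A.extra a x).Nonempty := by
  by_contra hcon
  push Not at hcon
  choose x hx hx' using hcon
  have := A.le_sum_card_extra A.degree hx
  simp [hx'] at this

end Setup

end Setups

section Proper

open scoped Classical

variable {V : Type*} [Fintype V] {P : Type*} {G : SimpleGraph V} {D : Digraph V} {l : ℕ}
  {c : G.EdgeLabeling P}

namespace Setup

variable (A : Setup c D l)

lemma exists_mem_U (a : ZMod 3) : ∃ x, x ∈ A.U a := by
  have h1 := A.card_U_ge a
  have h2 := A.large_real
  have h3 : (0 : ℝ) < (A.U a).card := by linarith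
  exact Finset.card_pos.1 (by exact_mod_cast h3)

/-- Elements of a linear out-neighborhood can be chosen outside small sets. -/
lemma exists_mem_out {v : V} {a : ZMod 3} (hv : (Fintype.card V : ℝ) / 1000 ≤ (A.out v a).card)
    (S : Finset V) (F : Finset P) (h : S.card + F.card ≤ 100) :
    ∃ u ∈ A.U a, Col c v u (A.α u) ∧ u ∉ S ∧ A.α u ∉ F := by
  have h2 := A.large_real
  obtain ⟨u, hu, h3, h4⟩ := A.exists_mem_avoid (X := A.out v a) (a := a)
    (fun u hu => (A.mem_out.1 hu).1) S F (by
      have : ((S.card : ℝ) + F.card) ≤ 100 := by exact_mod_cast h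
      have : ((S.card : ℝ) + F.card) < (A.out v a).card := by linarith
      exact_mod_cast this)
  rw [A.mem_out] at hu
  exact ⟨u, hu.1, hu.2, h3, h4⟩

lemma exists_mem_in {x : V} {b : ZMod 3} (hx : x ∈ A.U b)
    (S : Finset V) (F : Finset P) (h : S.card + F.card ≤ 100) :
    ∃ u ∈ A.U (b - 1), Col c u x (A.α x) ∧ u ∉ S ∧ A.α u ∉ F := by
  have h2 := A.large_real
  have h1 := A.card_inter_in_ge hx (subset_refl (A.U (b - 1)))
  have h0 := A.card_U_ge (b - 1)
  obtain ⟨u, hu, h3, h4⟩ := A.exists_mem_avoid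
    (X := (A.U (b - 1)).filter fun u => Col c u x (A.α x)) (a := b - 1)
    (Finset.filter_subset _ _) S F (by
      have : ((S.card : ℝ) + F.card) ≤ 100 := by exact_mod_cast h
      have : ((S.card : ℝ) + F.card) <
        ((A.U (b - 1)).filter fun u => Col c u x (A.α x)).card := by linarith
      exact_mod_cast this)
  rw [Finset.mem_filter] at hu
  exact ⟨u, hu.1, hu.2, h3, h4⟩

lemma proper_of_back_pair (hl : (l : ZMod 3) = 1) {a : ZMod 3} {x x' v v' : V} {p p' : P}
    (hx : x ∈ A.U a) (hv : Col c x v p) (hp : p ≠ A.α x)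
    (hv' : Col c x' v' p') (hp' : p' ≠ A.α x') (h1 : Col c v x' (A.α x'))
    (h2 : Col c v' x (A.α x)) (hfull : A.IsFull v' a) (h3 : p ≠ A.α x') (h4 : p' ≠ A.α x) :
    HasProperCycle c l := by
  have hxx : x ≠ x' := by
    rintro rfl
    exact hp (hv.unique h1.symm)
  have hvv : v ≠ v' := by
    rintro rfl
    exact hp (hv.unique h2.symm)
  have e1 := hv.ne
  have e2 := hv'.ne
  have e3 := h1.ne
  have e4 := h2.ne
  have hK : IsTrail c x ((p, v) :: [(A.α x', x'), (p', v')]) v' := ⟨hv, h1, hv', rfl⟩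
  have hl4 := A.four_le
  by_cases hl4' : l = 4
  · refine ⟨x, (p, v), [(A.α x', x'), (p', v')] ++ [(A.α x, x)], ?_, by simp [hl4'], ?_, ?_⟩
    · exact ⟨hv, h1, hv', h2, rfl⟩
    · simp; grind
    · grind
  · refine A.hasProperCycle_of_path A.large hx _ _ hK ?_ ?_ hp.symm hfull.linear ?_ ?_
    · grind
    · simp; grind
    · simp; omega
    · rw [hl]; simp; decide

lemma eq_of_back_pair (hl : (l : ZMod 3) = 1) {a : ZMod 3} {x x' v v' : V} {p p' : P}
    (hx : x ∈ A.U a) (hx' : x' ∈ A.U a) (hv : Col c x v p) (hp : p ≠ A.α x)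
    (hv' : Col c x' v' p') (hp' : p' ≠ A.α x') (h1 : Col c v x' (A.α x'))
    (h2 : Col c v' x (A.α x)) (hfull : A.IsFull v' a) (h3 : p ≠ A.α x') (h4 : p' ≠ A.α x) :
    p = p' := by
  by_contra hpp
  have hxx : x ≠ x' := by
    rintro rfl
    exact hp (hv.unique h1.symm)
  have hvv : v ≠ v' := by
    rintro rfl
    exact hp (hv.unique h2.symm)
  have hαα : A.α x ≠ A.α x' := fun h => hxx (A.inj hx hx' h)
  have e1 := hv.ne
  have e2 := hv'.ne
  have e3 := h1.ne
  have e4 := h2.ne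
  have hK : IsTrail c x [(p, v), (A.α x', x'), (p', v')] v' := ⟨hv, h1, hv', rfl⟩
  have hl4 := A.four_le
  by_cases hl4' : l = 4
  · refine A.no_rainbow ⟨x, [(p, v), (A.α x', x'), (p', v')] ++ [(A.α x, x)], ?_, by simp [hl4'],
      ?_, ?_⟩
    · exact ⟨hv, h1, hv', h2, rfl⟩
    · grind
    · grind
  · refine A.no_rainbow (A.hasRainbowCycle_of_path A.large hx _ hK ?_ ?_ hfull.linear ?_ ?_)
    · grind
    · grind
    · simp; omega
    · rw [hl]; simp; decide

/-- Two large families of unusual edges in the same class contain two edges that fit together. -/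
lemma exists_back_pair {a : ZMod 3} {X Y : Finset V} (hX : X ⊆ A.U a) (hY : Y ⊆ A.U a)
    (hXc : 2 * ((Fintype.card V : ℝ) / 300 + 1) < X.card)
    (hYc : 2 * ((Fintype.card V : ℝ) / 300 + 1) < Y.card)
    (f g : V → V) (p q : V → P) (hf : ∀ x ∈ X, A.IsFull (f x) a) (hg : ∀ x ∈ Y, A.IsFull (g x) a) :
    ∃ x ∈ X, ∃ y ∈ Y, Col c (f x) y (A.α y) ∧ Col c (g y) x (A.α x) ∧ p x ≠ A.α y ∧
      q y ≠ A.α x := by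
  have key : ∀ (Z : Finset V), Z ⊆ A.U a → ∀ (v : V) (r : P), A.IsFull v a →
      ((Z.filter fun y => ¬ Col c v y (A.α y) ∨ r = A.α y).card : ℝ) ≤
        (Fintype.card V : ℝ) / 300 + 1 := by
    intro Z hZ v r hv
    refine card_filter_le_add (fun _ _ h => h) ?_ (card_filter_le_one ?_)
    · refine le_trans ?_ hv.card_miss_le
      exact_mod_cast Finset.card_le_card (Finset.filter_subset_filter _ hZ)
    · intro u hu w hw h1 h2
      exact A.inj (hZ hu) (hZ hw) (h1.symm.trans h2)
  obtain ⟨x, hx, y, hy, h1, h2⟩ := exists_pair_avoid X Y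
    (fun x y => ¬ Col c (f x) y (A.α y) ∨ p x = A.α y)
    (fun x y => ¬ Col c (g y) x (A.α x) ∨ q y = A.α x)
    (fun x hx => key Y hY _ _ (hf x hx)) (fun y hy => key X hX _ _ (hg y hy)) (by
      have h0 : (0 : ℝ) ≤ Fintype.card V := by positivity
      nlinarith)
  push Not at h1 h2
  exact ⟨x, hx, y, hy, h1.1, h2.1, h1.2, h2.2⟩

include A in
lemma proper_of_mod_one (hl : (l : ZMod 3) = 1) : HasProperCycle c l := by
  obtain ⟨a, ha⟩ := A.exists_class_extra
  have hex : ∀ x ∈ A.U a, ∃ v p, Col c x v p ∧ p ≠ A.α x ∧ A.IsFull v a := by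
    intro x hx
    obtain ⟨v, hv⟩ := ha x hx
    rw [A.mem_extra, hl] at hv
    obtain ⟨p, hp, hpx⟩ := A.exists_col_of_mem_heads hv.1
    exact ⟨v, p, hp, hpx, by simpa using hv.2⟩
  have h0 := A.large_real
  obtain ⟨x0, hx0⟩ := A.exists_mem_U a
  have : Nonempty V := ⟨x0⟩
  have : Nonempty P := ⟨A.α x0⟩
  choose! f p hc hp hf using hex
  have hcard := A.card_U_ge a
  obtain ⟨x, hx, y, hy, h1, h2, h3, h4⟩ := A.exists_back_pair (subset_refl (A.U a))
    (subset_refl (A.U a)) (by linarith) (by linarith) f f p p hf hf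
  exact A.proper_of_back_pair hl hx (hc x hx) (hp x hx) (hc y hy) (hp y hy) h1 h2 (hf y hy) h3 h4

lemma proper_of_inner_pair (hl : (l : ZMod 3) = 2) {i i' : ZMod 3} (hi : i' = i + 1)
    {x x' v v' : V} {p p' : P} (hx : x ∈ A.U i) (hx' : x' ∈ A.U i') (hv : Col c x v p)
    (hp : p ≠ A.α x) (hv' : Col c x' v' p') (hp' : p' ≠ A.α x') (h1 : Col c v x' (A.α x'))
    (hfull : A.IsFull v' (i' + 1)) (h3 : p ≠ A.α x') : HasProperCycle c l := by
  subst hi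
  have hxx : x ≠ x' := by
    rintro rfl
    have := A.disj hx hx'
    simp at this
  have hvv : v ≠ v' := by
    rintro rfl
    exact hp' (hv'.unique h1.symm)
  have hvx : v' ≠ x := by
    rintro rfl
    have := A.eq_of_isFull_mem hfull hx
    simp at this
  have e1 := hv.ne
  have e2 := hv'.ne
  have e3 := h1.ne
  have hK : IsTrail c x ((p, v) :: [(A.α x', x'), (p', v')]) v' := ⟨hv, h1, hv', rfl⟩
  have hl4 := A.four_le
  have hl4' : l ≠ 4 := by rintro rfl; revert hl; decide
  refine A.hasProperCycle_of_path A.large hx _ _ hK ?_ ?_ hp.symm hfull.linear ?_ ?_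
  · grind
  · simp; grind
  · simp; omega
  · rw [hl]
    clear hx hx' hfull
    simp; revert i; decide

include A in
lemma proper_of_mod_two (hl : (l : ZMod 3) = 2) : HasProperCycle c l := by
  by_contra hP
  have hl4 := A.four_le
  have hl4' : l ≠ 4 := by rintro rfl; revert hl; decide
  have hl1 : (l : ZMod 3) - 1 = 1 := by rw [hl]; decide
  obtain ⟨j, hj⟩ := A.exists_class_extra
  have hprev : ∀ x ∈ A.U (j + 2), A.extra (j + 2) x = ∅ := by
    intro x hx
    by_contra hne
    obtain ⟨v, hv⟩ := Finset.nonempty_iff_ne_empty.2 hne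
    rw [A.mem_extra, hl1] at hv
    obtain ⟨p, hp, hpx⟩ := A.exists_col_of_mem_heads hv.1
    have e : j + 2 + 1 = j := by clear hj hx hv hne; revert j; decide
    rw [e] at hv
    obtain ⟨x', hx', h1, -, h2⟩ := A.exists_mem_out hv.2.linear ∅ {p} (by simp)
    obtain ⟨v', hv'⟩ := hj x' hx'
    rw [A.mem_extra, hl1] at hv'
    obtain ⟨p', hp', hpx'⟩ := A.exists_col_of_mem_heads hv'.1
    exact hP (A.proper_of_inner_pair hl e.symm hx hx' hp hpx hp' hpx' h1 hv'.2
      (by simpa [eq_comm] using h2))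
  obtain ⟨y, hy, hyE⟩ : ∃ y ∈ A.U (j + 1), A.extra (j + 1) y = ∅ := by
    by_contra hcon
    push Not at hcon
    obtain ⟨x, hx⟩ := A.exists_mem_U j
    obtain ⟨v, hv⟩ := hj x hx
    rw [A.mem_extra, hl1] at hv
    obtain ⟨p, hp, hpx⟩ := A.exists_col_of_mem_heads hv.1
    obtain ⟨x', hx', h1, -, h2⟩ := A.exists_mem_out hv.2.linear ∅ {p} (by simp)
    obtain ⟨v', hv'⟩ := hcon x' hx'
    rw [A.mem_extra, hl1] at hv'
    obtain ⟨p', hp', hpx'⟩ := A.exists_col_of_mem_heads hv'.1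
    exact hP (A.proper_of_inner_pair hl rfl hx hx' hp hpx hp' hpx' h1 hv'.2
      (by simpa [eq_comm] using h2))
  obtain ⟨x, hx⟩ := A.exists_mem_U j
  obtain ⟨w, hw⟩ := A.exists_mem_U (j + 2)
  have j1 : j + 1 ≠ j := by simp
  have j2 : j + 2 ≠ j := by clear hj hprev hy hyE hx hw; revert j; decide
  have j3 : j + 2 ≠ j + 1 := by clear hj hprev hy hyE hx hw j2; revert j; decide
  have hxw : x ≠ w := fun h => j2 (A.disj hw (h ▸ hx))
  have hcover : ∀ i, i = j ∨ i = j + 1 ∨ i = j + 2 := by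
    clear hj hprev hy hyE hx hw j1 j2 j3; revert j; decide
  obtain ⟨v, hv, hvw⟩ : ∃ v ∈ A.extra j x, v ∈ A.heads w := by
    by_contra hcon
    push Not at hcon
    set T : ZMod 3 → V := fun i => if i = j then x else if i = j + 1 then y else w with hT
    have T0 : T j = x := by simp [hT]
    have T1 : T (j + 1) = y := by simp [hT]
    have T2 : T (j + 2) = w := by simp [hT, j2, j3]
    have hTU : ∀ i, T i ∈ A.U i := by
      intro i
      rcases hcover i with rfl | rfl | rfl
      · rwa [T0]
      · rwa [T1]
      · rwa [T2]
    have := A.card_heads_add_le A.degree hTU (fun _ => ∅) (by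
      intro i v hv hv'
      exfalso
      rw [hl1] at hv'
      rcases hcover i with rfl | rfl | rfl
      · rw [T0] at hv
        have e : i + 1 + 1 = i + 2 := by ring
        rw [e, T2] at hv'
        exact hcon v hv hv'
      · rw [T1, hyE] at hv
        simp at hv
      · rw [T2, hprev w hw] at hv
        simp at hv) ∅ (by simp)
    simp at this
  rw [A.mem_extra, hl1] at hv
  obtain ⟨p, hp, hpx⟩ := A.exists_col_of_mem_heads hv.1
  obtain ⟨q, hq, hqw⟩ := A.exists_col_of_mem_heads hvw
  have hpq : p = q := by
    by_contra hpq
    have e : j + 2 - 1 = j + 1 := by ring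
    obtain ⟨u, hu, huw, huS, huF⟩ := A.exists_mem_in hw {x, w, v} ∅ (by
      have : ({x, w, v} : Finset V).card ≤ 3 := Finset.card_le_three
      simp; omega)
    rw [e] at hu
    simp only [Finset.mem_insert, Finset.mem_singleton, not_or] at huS
    have e1 := hp.ne
    have e2 := hq.ne
    have hK : IsTrail c x ((p, v) :: [(q, w), (A.α w, u)]) u := ⟨hp, hq.symm, huw.symm, rfl⟩
    refine hP (A.hasProperCycle_of_path A.large hx _ _ hK ?_ ?_ hpx.symm
      (A.card_out_next' hu rfl) ?_ ?_)
    · grind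
    · simp; grind
    · simp; omega
    · rw [hl]
      simp only [List.length_cons, List.length_nil]
      ring_nf
  subst hpq
  obtain ⟨z, hz, hz'⟩ : ∃ z, (z ∈ A.heads y ∧ z ∈ A.heads w) ∨
      (z ∈ outNe c D v p ∧ (z ∈ A.heads y ∨ z ∈ A.heads w)) := by
    by_contra hcon
    push Not at hcon
    have d1 : Disjoint (A.heads y) (A.heads w) := by
      rw [Finset.disjoint_left]
      exact fun z h1 h2 => (hcon z).1 h1 h2
    have d2 : Disjoint (A.heads y ∪ A.heads w) (outNe c D v p) := by
      rw [Finset.disjoint_left]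
      intro z h1 h2
      rw [Finset.mem_union] at h1
      rcases h1 with h1 | h1
      · exact ((hcon z).2 h2).1 h1
      · exact ((hcon z).2 h2).2 h1
    have h1 : (A.heads y ∪ A.heads w ∪ outNe c D v p).card ≤ Fintype.card V :=
      Finset.card_le_univ _
    rw [Finset.card_union_of_disjoint d2, Finset.card_union_of_disjoint d1] at h1
    have f1 := A.assoc.colorDegree_le_outNe v p
    have f2 := A.assoc.colorDegree_le_outNe y (A.α y)
    have f3 := A.assoc.colorDegree_le_outNe w (A.α w)
    have g1 := A.degree v
    have g2 := A.degree y
    have g3 := A.degree w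
    rw [heads, heads] at h1
    omega
  · rcases A.isFull_of_mem_heads hy hw j3.symm hz hz' with ⟨h1, h2⟩ | ⟨h1, h2⟩
    · rw [hl1] at h2
      clear hj hprev hy hyE hx hw j1 j2 j3 hcover hv h1
      revert j; decide
    · have : z ∈ A.extra (j + 2) w := A.mem_extra.2 ⟨hz', h1⟩
      rw [hprev w hw] at this
      simp at this
  · rename_i hz
    obtain ⟨hz, hz'⟩ := hz
    rw [mem_outNe] at hz
    obtain ⟨r, hr⟩ := A.assoc.exists_col hz.1
    have hrp : p ≠ r := fun h => hz.2 (h ▸ hr)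
    have key : ∀ (s : V) (b a : ZMod 3), s ∈ A.U b → Col c s v p → p ≠ A.α s →
        (Fintype.card V : ℝ) / 1000 ≤ (A.out z a).card → (l : ZMod 3) ≠ 3 + (b - a) := by
      intro s b a hs hsv hps hza hmod
      have hsz : s ≠ z := by
        rintro rfl
        exact hrp (hsv.symm.unique hr)
      have e1 := hsv.ne
      have e2 := hr.ne
      have hK : IsTrail c s ((p, v) :: [(r, z)]) z := ⟨hsv, hr, rfl⟩
      refine hP (A.hasProperCycle_of_path A.large hs _ _ hK ?_ ?_ hps.symm hza ?_ ?_)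
      · grind
      · simpa using hrp
      · simp; omega
      · rw [hmod]; simp; decide
    have hfull : A.IsFull z (j + 2) := by
      intro b hb
      by_contra hcon
      rw [not_lt] at hcon
      have k1 := key x j b hx hp hpx hcon
      have k2 := key w (j + 2) b hw hq hqw hcon
      rw [hl] at k1 k2
      clear hj hprev hy hyE hx hw j1 j2 j3 hcover hv key hcon
      revert j b
      decide
    rcases hz' with hz' | hz'
    · have e : j + 2 = j + 1 + 1 := by ring
      have : z ∈ A.extra (j + 1) y := A.mem_extra.2 ⟨hz', by rw [hl1, ← e]; exact hfull⟩
      rw [hyE] at this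
      simp at this
    · obtain ⟨p', hp', hpw'⟩ := A.exists_col_of_mem_heads hz'
      exact A.mod_ne hw hp' hpw' hfull.linear (by rw [hl]; simp)

include A in
lemma hasProperCycle : HasProperCycle c l := by
  rcases A.mod_cases with h | h
  · exact A.proper_of_mod_one h
  · exact A.proper_of_mod_two h

end Setup

end Proper

section Selection

open scoped Classical

/-- Double counting: some element has few relatives if every element has few on the other side. -/
lemma exists_card_mul_le {V W : Type*} {X : Finset V} (hX : X.Nonempty) (Y : Finset W)
    (R : V → W → Prop) [∀ x, DecidablePred (R x)] [∀ y, DecidablePred fun x => R x y] {r : ℝ}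
    (h : ∀ y ∈ Y, ((X.filter fun x => R x y).card : ℝ) ≤ r) :
    ∃ x ∈ X, ((Y.filter fun y => R x y).card : ℝ) * X.card ≤ r * Y.card := by
  by_contra hcon
  push Not at hcon
  have h1 : ∑ x ∈ X, ((Y.filter fun y => R x y).card : ℝ) =
      ∑ y ∈ Y, ((X.filter fun x => R x y).card : ℝ) := by
    exact_mod_cast Finset.sum_card_bipartiteAbove_eq_sum_card_bipartiteBelow (s := X) (t := Y) R
  have h2 : ∑ y ∈ Y, ((X.filter fun x => R x y).card : ℝ) ≤ r * Y.card := by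
    refine (Finset.sum_le_sum h).trans_eq ?_
    rw [Finset.sum_const, nsmul_eq_mul]; ring
  have h3 : ∑ x ∈ X, (r * Y.card) < ∑ x ∈ X, ((Y.filter fun y => R x y).card : ℝ) * X.card :=
    Finset.sum_lt_sum_of_nonempty hX hcon
  rw [Finset.sum_const, ← Finset.sum_mul, h1, nsmul_eq_mul] at h3
  have h4 : (0 : ℝ) ≤ X.card := by positivity
  nlinarith

/-- A triple avoiding three relations that are sparse in a cyclic way. -/
lemma exists_triple_avoid {V : Type*} (X Y Z : Finset V) (R S T : V → V → Prop)
    [∀ x, DecidablePred (R x)] [∀ x, DecidablePred (S x)] [∀ x, DecidablePred (T x)]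
    [∀ y, DecidablePred fun x => T x y] {r w : ℝ}
    (hR : ∀ x ∈ X, ((Y.filter fun y => R x y).card : ℝ) ≤ r)
    (hS : ∀ y ∈ Y, ((Z.filter fun z => S y z).card : ℝ) ≤ r)
    (hT : ∀ z ∈ Z, ((X.filter fun x => T z x).card : ℝ) ≤ r)
    (hX : w ≤ X.card) (hY : w ≤ Y.card) (hZ : w ≤ Z.card) (hZ' : Z.card ≤ 4 * w) (hr : 5 * r < w)
    (hr0 : 0 ≤ r) :
    ∃ x ∈ X, ∃ y ∈ Y, ∃ z ∈ Z, ¬ R x y ∧ ¬ S y z ∧ ¬ T z x := by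
  have hX0 : X.Nonempty := by
    rw [← Finset.card_pos]
    have : (0 : ℝ) < X.card := by linarith
    exact_mod_cast this
  obtain ⟨x, hx, hxT⟩ := exists_card_mul_le hX0 Z (fun x z => T z x) (r := r) hT
  have hxT' : ((Z.filter fun z => T z x).card : ℝ) ≤ 4 * r := by
    by_contra hcon
    push Not at hcon
    nlinarith
  obtain ⟨y, hy, hRy⟩ : ∃ y ∈ Y, ¬ R x y := by
    by_contra hcon
    push Not at hcon
    have := hR x hx
    rw [Finset.filter_true_of_mem hcon] at this
    linarith
  obtain ⟨z, hz, hSz, hTz⟩ : ∃ z ∈ Z, ¬ S y z ∧ ¬ T z x := by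
    by_contra hcon
    push Not at hcon
    have := card_filter_le_add (Y := Z) (Q := fun _ => True) (R := S y) (S := fun z => T z x)
      (fun z hz _ => by
        by_cases h : S y z
        · exact Or.inl h
        · exact Or.inr (hcon z hz h)) (hS y hy) hxT'
    rw [Finset.filter_true] at this
    linarith
  exact ⟨x, hx, y, hy, z, hz, hRy, hSz, hTz⟩

lemma sum_zmod_three {M : Type*} [AddCommMonoid M] (f : ZMod 3 → M) :
    ∑ i, f i = f 0 + f 1 + f 2 := Fin.sum_univ_three f

lemma zmod_three_eq_add : ∀ {i j : ZMod 3}, i ≠ j → j = i + 2 ∨ i = j + 2 := by decide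

lemma zmod_three_cases : ∀ i j : ZMod 3, i = j ∨ i = j + 1 ∨ i = j + 2 := by decide

/-- Three numbers of sum at least two. -/
lemma two_le_or_of_two_le_sum {f : ZMod 3 → ℕ} (h : 2 ≤ ∑ i, f i) :
    (∃ i, 2 ≤ f i) ∨ ∃ i j, i ≠ j ∧ 1 ≤ f i ∧ 1 ≤ f j := by
  rw [sum_zmod_three] at h
  by_contra hcon
  push Not at hcon
  have h0 := hcon.1 0
  have h1 := hcon.1 1
  have h2 := hcon.1 2
  have h01 := hcon.2 0 1 (by decide)
  have h02 := hcon.2 0 2 (by decide)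
  have h12 := hcon.2 1 2 (by decide)
  omega

end Selection

section RainbowTwo

open scoped Classical

variable {V : Type*} [Fintype V] {P : Type*} {G : SimpleGraph V} {D : Digraph V} {l : ℕ}
  {c : G.EdgeLabeling P}

namespace Setup

variable (A : Setup c D l)

/-- Either every vertex of some class has two unusual edges, or every vertex of two classes has
one. -/
lemma exists_class_card_extra (hk : ∀ x, Fintype.card V + 5 ≤ 3 * colorDegree c x) :
    (∃ j, ∀ x ∈ A.U j, 2 ≤ (A.extra j x).card) ∨
      ∃ i j, i ≠ j ∧ (∀ x ∈ A.U i, (A.extra i x).Nonempty) ∧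
        ∀ x ∈ A.U j, (A.extra j x).Nonempty := by
  have h1 : ∀ i, ∃ x ∈ A.U i, ∀ y ∈ A.U i, (A.extra i x).card ≤ (A.extra i y).card := fun i =>
    Finset.exists_min_image _ _ (A.exists_mem_U i)
  choose x hx hmin using h1
  have h2 := A.le_sum_card_extra hk hx
  rcases two_le_or_of_two_le_sum (f := fun i => (A.extra i (x i)).card) (by omega) with
    ⟨j, hj⟩ | ⟨i, j, hij, hi, hj⟩
  · exact Or.inl ⟨j, fun y hy => hj.trans (hmin j y hy)⟩
  · exact Or.inr ⟨i, j, hij, fun y hy => Finset.card_pos.1 (hi.trans (hmin i y hy)),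
      fun y hy => Finset.card_pos.1 (hj.trans (hmin j y hy))⟩

/-- Two disjoint unusual edges of different colors can be combined if `l ≡ 2`. -/
lemma eq_of_inner_pair (hl : (l : ZMod 3) = 2) (hl5 : l ≠ 5) {j j' : ZMod 3} {x x' v v' : V}
    {p p' : P} (hx : x ∈ A.U j) (hx' : x' ∈ A.U j') (hv : Col c x v p) (hp : p ≠ A.α x)
    (hv' : Col c x' v' p') (hp' : p' ≠ A.α x') (hf : A.IsFull v (j + 1))
    (hf' : A.IsFull v' (j' + 1)) (hvv : v ≠ v') (hvx : v ≠ x') (hvx' : v' ≠ x)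
    (h1 : p ≠ A.α x') (h2 : p' ≠ A.α x) (hα : A.α x ≠ A.α x') : p = p' := by
  by_contra hpp
  have hxx : x ≠ x' := fun h => hα (by rw [h])
  have e1 := hv.ne
  have e2 := hv'.ne
  have hl4 := A.four_le
  have hl8 : 8 ≤ l := by
    by_contra hcon
    have : l = 4 ∨ l = 5 ∨ l = 6 ∨ l = 7 := by omega
    rcases this with rfl | rfl | rfl | rfl
    · revert hl; decide
    · exact hl5 rfl
    · revert hl; decide
    · revert hl; decide
  obtain ⟨s, hs, hs'⟩ : ∃ s : ℕ, s ≤ 2 ∧ (s : ZMod 3) + 1 = j' - (j + 1) := by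
    have : ∀ j j' : ZMod 3, ∃ s : ℕ, s ≤ 2 ∧ (s : ZMod 3) + 1 = j' - (j + 1) := fun j j' =>
      ⟨(j' - (j + 1) - 1).val, Nat.lt_succ_iff.1 (ZMod.val_lt (j' - (j + 1) - 1)), by simp⟩
    exact this j j'
  obtain ⟨M, m1, m2, m3, m4, m5⟩ := A.exists_link hx' 100 (by have := A.large; omega) s v (j + 1)
    {x, x', v, v'} {A.α x, A.α x', p, p'} hf.linear hs' (by
      have e4 : ({x, x', v, v'} : Finset V).card ≤ 4 := Finset.card_le_four
      have e5 : ({A.α x, A.α x', p, p'} : Finset P).card ≤ 4 := Finset.card_le_four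
      omega)
  have hK : IsTrail c x ((p, v) :: ((A.steps M ++ [(A.α x', x')]) ++ [(p', v')])) v' :=
    ⟨hv, isTrail_append.2 ⟨x', m2, hv', rfl⟩⟩
  simp only [Finset.mem_insert, Finset.mem_singleton, not_or] at m5
  refine A.no_rainbow (A.hasRainbowCycle_of_path A.large hx _ hK ?_ ?_ hf'.linear ?_ ?_)
  · obtain rfl | rfl | rfl : s = 0 ∨ s = 1 ∨ s = 2 := by omega
    · obtain ⟨u, rfl⟩ := List.length_eq_one_iff.1 m1
      simp [Frame.steps] at *; grind
    · obtain ⟨u, u', rfl⟩ := List.length_eq_two.1 m1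
      simp [Frame.steps] at *; grind
    · obtain ⟨u, u', u'', rfl⟩ := List.length_eq_three.1 m1
      simp [Frame.steps] at *; grind
  · obtain rfl | rfl | rfl : s = 0 ∨ s = 1 ∨ s = 2 := by omega
    · obtain ⟨u, rfl⟩ := List.length_eq_one_iff.1 m1
      simp [Frame.steps] at *; grind
    · obtain ⟨u, u', rfl⟩ := List.length_eq_two.1 m1
      simp [Frame.steps] at *; grind
    · obtain ⟨u, u', u'', rfl⟩ := List.length_eq_three.1 m1
      simp [Frame.steps] at *; grind
  · simp [m1]; omega
  · rw [hl]
    simp only [List.length_cons, List.length_append, Frame.steps_length, m1, List.length_nil]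
    push_cast
    linear_combination (-1 : ZMod 3) * hs'

lemma card_conflict_le {j : ZMod 3} {Y : Finset V} (hY : Y ⊆ A.U j) (v : V) (p : P) :
    ((Y.filter fun y => v = y ∨ p = A.α y).card : ℝ) ≤ 2 := by
  have h : (2 : ℝ) = 1 + 1 := by norm_num
  rw [h]
  exact card_filter_le_add (fun _ _ h => h)
    (card_filter_le_one fun _ _ _ _ h h' => h.symm.trans h')
    (card_filter_le_one fun u hu w hw h h' => A.inj (hY hu) (hY hw) (h.symm.trans h'))

lemma card_conflict_le_three {j : ZMod 3} {Y : Finset V} (hY : Y ⊆ A.U j) (v : V) (p q : P) :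
    ((Y.filter fun y => (v = y ∨ p = A.α y) ∨ q = A.α y).card : ℝ) ≤ 3 := by
  have h : (3 : ℝ) = 2 + 1 := by norm_num
  rw [h]
  exact card_filter_le_add (fun _ _ h => h) (A.card_conflict_le hY v p)
    (card_filter_le_one fun u hu w hw h h' => A.inj (hY hu) (hY hw) (h.symm.trans h'))

lemma exists_col_of_extra (hl : (l : ZMod 3) = 2) {j : ZMod 3} {x v : V} (h : v ∈ A.extra j x) :
    ∃ p, Col c x v p ∧ p ≠ A.α x ∧ A.IsFull v (j + 1) := by
  rw [A.mem_extra, hl] at h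
  obtain ⟨p, hp, hpx⟩ := A.exists_col_of_mem_heads h.1
  exact ⟨p, hp, hpx, h.2⟩

lemma not_forall_two_le_card_extra (hl : (l : ZMod 3) = 2) (hl5 : l ≠ 5) (j : ZMod 3)
    (h : ∀ x ∈ A.U j, 2 ≤ (A.extra j x).card) : False := by
  have h1 : ∀ x ∈ A.U j, ∃ v w p q, v ≠ w ∧ p ≠ q ∧ Col c x v p ∧ Col c x w q ∧ p ≠ A.α x ∧
      q ≠ A.α x ∧ A.IsFull v (j + 1) ∧ A.IsFull w (j + 1) := by
    intro x hx
    obtain ⟨v, hv, w, hw, hvw⟩ := Finset.one_lt_card.1 (h x hx)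
    obtain ⟨p, hp, hpx, hf⟩ := A.exists_col_of_extra hl hv
    obtain ⟨q, hq, hqx, hf'⟩ := A.exists_col_of_extra hl hw
    refine ⟨v, w, p, q, hvw, ?_, hp, hq, hpx, hqx, hf, hf'⟩
    rintro rfl
    exact hvw (A.assoc.eq_of_col (A.mem_heads.1 (A.mem_extra.1 hv).1).1
      (A.mem_heads.1 (A.mem_extra.1 hw).1).1 hp hq)
  obtain ⟨x0, hx0⟩ := A.exists_mem_U j
  have : Nonempty V := ⟨x0⟩
  have : Nonempty P := ⟨A.α x0⟩
  choose! v w p q hvw hpq hv hw hp hq hf hf' using h1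
  have hU := A.card_U_ge j
  have hN := A.large_real
  let R : V → V → Prop := fun x y => (x = y ∨ (v x = y ∨ p x = A.α y)) ∨ (w x = y ∨ q x = A.α y)
  have hR : ∀ Y ⊆ A.U j, ∀ x, ((Y.filter fun y => R x y).card : ℝ) ≤ 1 + 2 + 2 := by
    intro Y hY x
    exact card_filter_le_add (fun _ _ h => h) (card_filter_le_add (fun _ _ h => h)
      (card_filter_le_one fun _ _ _ _ h h' => h.symm.trans h')
      (A.card_conflict_le hY (v x) (p x))) (A.card_conflict_le hY (w x) (q x))
  obtain ⟨x, hx, hxc⟩ := exists_card_mul_le ⟨x0, hx0⟩ (A.U j) (fun x y => R y x)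
    (fun y _ => hR _ (subset_refl _) y)
  have hxc' : (((A.U j).filter fun y => R y x).card : ℝ) ≤ 5 := by
    by_contra hcon
    push Not at hcon
    have : (0 : ℝ) < (A.U j).card := by linarith
    nlinarith
  set Y := (A.U j).filter fun y => ¬ R x y ∧ ¬ R y x with hY
  have hYU : Y ⊆ A.U j := Finset.filter_subset _ _
  have hYc : (11 : ℝ) ≤ Y.card := by
    have e1 : (((A.U j).filter fun y => R x y ∨ R y x).card : ℝ) ≤ 1 + 2 + 2 + 5 :=
      card_filter_le_add (fun _ _ h => h) (hR _ (subset_refl _) x) hxc'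
    have e2 := Finset.card_filter_add_card_filter_not (s := A.U j) fun y => R x y ∨ R y x
    have e3 : ((A.U j).filter fun y => ¬ (R x y ∨ R y x)) = Y := by
      rw [hY]; congr 1; ext y; simp [not_or]
    rw [e3] at e2
    have e4 : (((A.U j).filter fun y => R x y ∨ R y x).card : ℝ) + Y.card = (A.U j).card := by
      exact_mod_cast e2
    linarith
  obtain ⟨y, hy, z, hz, hyz, hzy⟩ := exists_pair_avoid Y Y R (fun y z => R z y)
    (fun y _ => hR Y hYU y) (fun y _ => hR Y hYU y) (by nlinarith)
  rw [hY, Finset.mem_filter] at hy hz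
  have key : ∀ a ∈ A.U j, ∀ b ∈ A.U j, ¬ R a b → ¬ R b a →
      (v a = v b ∧ w a = w b ∧ p a = q b ∧ q a = p b) ∨
      (v a = w b ∧ w a = v b ∧ p a = p b ∧ q a = q b) := by
    intro a ha b hb hab hba
    simp only [R, not_or] at hab hba
    have hα : A.α a ≠ A.α b := fun h => hab.1.1 (A.inj ha hb h)
    have k1 : v a ≠ v b → p a = p b := fun h => A.eq_of_inner_pair hl hl5 ha hb (hv a ha) (hp a ha)
      (hv b hb) (hp b hb) (hf a ha) (hf b hb) h hab.1.2.1 hba.1.2.1 hab.1.2.2 hba.1.2.2 hα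
    have k2 : v a ≠ w b → p a = q b := fun h => A.eq_of_inner_pair hl hl5 ha hb (hv a ha) (hp a ha)
      (hw b hb) (hq b hb) (hf a ha) (hf' b hb) h hab.1.2.1 hba.2.1 hab.1.2.2 hba.2.2 hα
    have k3 : w a ≠ v b → q a = p b := fun h => A.eq_of_inner_pair hl hl5 ha hb (hw a ha) (hq a ha)
      (hv b hb) (hp b hb) (hf' a ha) (hf b hb) h hab.2.1 hba.1.2.1 hab.2.2 hba.1.2.2 hα
    have k4 : w a ≠ w b → q a = q b := fun h => A.eq_of_inner_pair hl hl5 ha hb (hw a ha) (hq a ha)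
      (hw b hb) (hq b hb) (hf' a ha) (hf' b hb) h hab.2.1 hba.2.1 hab.2.2 hba.2.2 hα
    have := hvw a ha
    have := hvw b hb
    have := hpq a ha
    have := hpq b hb
    grind
  have f1 := key x hx y hy.1 hy.2.1 hy.2.2
  have f2 := key x hx z hz.1 hz.2.1 hz.2.2
  have f3 := key y hy.1 z hz.1 hyz hzy
  have := hvw x hx
  have := hvw y hy.1
  have := hpq x hx
  have := hpq y hy.1
  grind

end Setup

end RainbowTwo

section RainbowTwo

open scoped Classical

variable {V : Type*} [Fintype V] {P : Type*} {G : SimpleGraph V} {D : Digraph V} {l : ℕ}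
  {c : G.EdgeLabeling P}

namespace Setup

variable (A : Setup c D l)

/-- The vertices of the class `i` with an unusual edge whose color is not `κ`. -/
noncomputable def offColor (i : ZMod 3) (κ : P) : Finset V :=
  (A.U i).filter fun x => ∃ v ∈ A.extra i x, ¬ Col c x v κ

lemma mem_offColor {i : ZMod 3} {κ : P} {x : V} :
    x ∈ A.offColor i κ ↔ x ∈ A.U i ∧ ∃ v ∈ A.extra i x, ¬ Col c x v κ := by
  simp [offColor]

lemma card_offColor_le_two (hl : (l : ZMod 3) = 2) (hl5 : l ≠ 5) {i j : ZMod 3} (hij : i ≠ j)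
    {κ : P} {Y : Finset V} (hY : Y ⊆ A.U j) (hYc : 10 ≤ Y.card)
    (hκ : ∀ y ∈ Y, ∃ v ∈ A.extra j y, Col c y v κ) : (A.offColor i κ).card ≤ 2 := by
  by_contra hcon
  push Not at hcon
  have h1 : ∀ x ∈ A.offColor i κ, ∃ v p, Col c x v p ∧ p ≠ A.α x ∧ p ≠ κ ∧
      A.IsFull v (i + 1) := by
    intro x hx
    rw [mem_offColor] at hx
    obtain ⟨-, v, hv, hvκ⟩ := hx
    obtain ⟨p, hp, hpx, hf⟩ := A.exists_col_of_extra hl hv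
    exact ⟨v, p, hp, hpx, fun h => hvκ (h ▸ hp), hf⟩
  have h2 : ∀ y ∈ Y, ∃ v, Col c y v κ ∧ κ ≠ A.α y ∧ A.IsFull v (j + 1) := by
    intro y hy
    obtain ⟨v, hv, hvκ⟩ := hκ y hy
    obtain ⟨p, hp, hpx, hf⟩ := A.exists_col_of_extra hl hv
    exact ⟨v, hvκ, hp.unique hvκ ▸ hpx, hf⟩
  have : Nonempty V := ⟨(A.exists_mem_U 0).choose⟩
  have : Nonempty P := ⟨κ⟩
  choose! v p hv hp hpκ hf using h1
  choose! w hw hwκ hf' using h2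
  obtain ⟨x, hx, y, hy, hR, hS⟩ := exists_pair_avoid (A.offColor i κ) Y
    (fun x y => (v x = y ∨ p x = A.α y) ∨ A.α x = A.α y) (fun x y => w y = x ∨ κ = A.α x)
    (r := 3) (s := 2) (fun x _ => A.card_conflict_le_three hY _ _ _)
    (fun y _ => A.card_conflict_le (Finset.filter_subset _ _) _ _) (by
      have e1 : (3 : ℝ) ≤ (A.offColor i κ).card := by exact_mod_cast hcon
      have e2 : (10 : ℝ) ≤ Y.card := by exact_mod_cast hYc
      nlinarith)
  push Not at hR hS
  have hvw : v x ≠ w y := by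
    intro h
    have := (hf x hx).unique (h ▸ hf' y hy)
    exact hij (add_right_cancel this)
  exact hpκ x hx (A.eq_of_inner_pair hl hl5 (A.mem_offColor.1 hx).1 (hY hy) (hv x hx) (hp x hx)
    (hw y hy) (hwκ y hy) (hf x hx) (hf' y hy) hvw hR.1.1 hS.1 hR.1.2 hS.2 hR.2)

lemma exists_forall_card_offColor_le (hl : (l : ZMod 3) = 2) (hl5 : l ≠ 5)
    (hk : ∀ x, Fintype.card V + 5 ≤ 3 * colorDegree c x) :
    ∃ κ, ∀ i, (A.offColor i κ).card ≤ 2 := by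
  obtain ⟨j, hj⟩ | ⟨i, j, hij, hi, hj⟩ := A.exists_class_card_extra hk
  · exact (A.not_forall_two_le_card_extra hl hl5 j hj).elim
  have h1 : ∀ k, (∀ x ∈ A.U k, (A.extra k x).Nonempty) → ∀ x ∈ A.U k, ∃ v p, v ∈ A.extra k x ∧
      Col c x v p ∧ p ≠ A.α x ∧ A.IsFull v (k + 1) := by
    intro k hk x hx
    obtain ⟨v, hv⟩ := hk x hx
    obtain ⟨p, hp⟩ := A.exists_col_of_extra hl hv
    exact ⟨v, p, hv, hp⟩
  have hi' := h1 i hi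
  have hj' := h1 j hj
  obtain ⟨x0, hx0⟩ := A.exists_mem_U i
  have : Nonempty V := ⟨x0⟩
  have : Nonempty P := ⟨A.α x0⟩
  choose! v p hvE hv hp hf using hi'
  choose! w q hwE hw hq hf' using hj'
  have hUi := A.card_U_ge i
  have hUj := A.card_U_ge j
  have hUi' := A.card_U_le i
  have hUj' := A.card_U_le j
  have hN := A.large_real
  obtain ⟨x, hx, hxc⟩ := exists_card_mul_le ⟨x0, hx0⟩ (A.U j) (fun x y => w y = x ∨ q y = A.α x)
    (r := 2) (fun y _ => A.card_conflict_le (subset_refl _) (w y) (q y))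
  have hxc' : (((A.U j).filter fun y => w y = x ∨ q y = A.α x).card : ℝ) ≤ 3 := by
    by_contra hcon
    push Not at hcon
    nlinarith
  set Y := (A.U j).filter fun y => q y = p x with hY
  have hYU : Y ⊆ A.U j := Finset.filter_subset _ _
  have hYc : (20 : ℝ) ≤ Y.card := by
    have e1 : (((A.U j).filter fun y => q y ≠ p x).card : ℝ) ≤ 3 + 3 := by
      refine card_filter_le_add ?_ hxc' (A.card_conflict_le_three (subset_refl _) (v x) (p x)
        (A.α x))
      intro y hy hqp
      by_contra hcon
      push Not at hcon
      obtain ⟨⟨c1, c2⟩, ⟨c3, c4⟩, c5⟩ := hcon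
      refine hqp.symm (A.eq_of_inner_pair hl hl5 hx hy (hv x hx) (hp x hx) (hw y hy) (hq y hy)
        (hf x hx) (hf' y hy) ?_ c3 c1 c4 c2 c5)
      intro h
      exact hij (add_right_cancel ((hf x hx).unique (h ▸ hf' y hy)))
    have e2 := Finset.card_filter_add_card_filter_not (s := A.U j) fun y => q y = p x
    have e3 : (Y.card : ℝ) + ((A.U j).filter fun y => q y ≠ p x).card = (A.U j).card := by
      exact_mod_cast e2
    linarith
  have hYκ : ∀ y ∈ Y, ∃ v ∈ A.extra j y, Col c y v (p x) := by
    intro y hy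
    rw [hY, Finset.mem_filter] at hy
    exact ⟨w y, hwE y hy.1, hy.2 ▸ hw y hy.1⟩
  have hYc' : 20 ≤ Y.card := by exact_mod_cast hYc
  have hother : ∀ k, k ≠ j → (A.offColor k (p x)).card ≤ 2 := fun k hkj =>
    A.card_offColor_le_two hl hl5 hkj hYU (by omega) hYκ
  refine ⟨p x, fun k => ?_⟩
  by_cases hkj : k = j
  · subst hkj
    refine A.card_offColor_le_two hl hl5 hij.symm (Y := A.U i \ A.offColor i (p x))
      Finset.sdiff_subset ?_ ?_
    · have e1 := Finset.le_card_sdiff (A.offColor i (p x)) (A.U i)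
      have e2 := hother i hij
      have e3 : (12 : ℝ) ≤ (A.U i).card := by linarith
      have e4 : 12 ≤ (A.U i).card := by exact_mod_cast e3
      omega
    · intro y hy
      rw [Finset.mem_sdiff, mem_offColor] at hy
      push Not at hy
      exact ⟨v y, hvE y hy.1, hy.2 hy.1 _ (hvE y hy.1)⟩
  · exact hother k hkj

lemma color_of_double (hl : (l : ZMod 3) = 2) {i k : ZMod 3} {x y v : V} {κ : P} (hki : k = i + 2)
    (hx : x ∈ A.U i) (hy : y ∈ A.U k) (hα : A.α x ≠ A.α y) (hκy : κ ≠ A.α y)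
    (hv : v ∈ A.extra i x) (hvκ : Col c x v κ) (hvy : v ∈ A.heads y) (hvyκ : ¬ Col c y v κ) :
    Col c y v (A.α x) ∧ ∀ j, v ∉ A.U j := by
  have e1 : k - 1 = i + 1 := by rw [hki]; ring
  have e2 : i = k + 1 := by
    have e3 : (3 : ZMod 3) = 0 := rfl
    rw [hki]; linear_combination - e3
  have hxy : x ≠ y := fun h => hα (by rw [h])
  have hl4 := A.four_le
  have hl4' : l ≠ 4 := by rintro rfl; revert hl; decide
  obtain ⟨p, hp, hpx, hf⟩ := A.exists_col_of_extra hl hv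
  obtain rfl := hp.unique hvκ
  obtain ⟨q, hq, hqy⟩ := A.exists_col_of_mem_heads hvy
  have hpq : p ≠ q := fun h => hvyκ (h ▸ hq)
  have hqx : q = A.α x := by
    by_contra hqx
    obtain ⟨u, hu, huy, huS, huF⟩ := A.exists_mem_in hy {x, y, v} {p, q, A.α x, A.α y} (by
      have : ({x, y, v} : Finset V).card ≤ 3 := Finset.card_le_three
      have : ({p, q, A.α x, A.α y} : Finset P).card ≤ 4 := Finset.card_le_four
      omega)
    rw [e1] at hu
    simp only [Finset.mem_insert, Finset.mem_singleton, not_or] at huS huF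
    have f1 := hp.ne
    have f2 := hq.ne
    have hK : IsTrail c x [(p, v), (q, y), (A.α y, u)] u := ⟨hp, hq.symm, huy.symm, rfl⟩
    refine A.no_rainbow (A.hasRainbowCycle_of_path A.large hx _ hK ?_ ?_
      (A.card_out_next' hu rfl) ?_ ?_)
    · grind
    · grind
    · simp; omega
    · rw [hl]
      simp only [List.length_cons, List.length_nil]
      push_cast
      ring
  subst hqx
  refine ⟨hq, fun j hj => ?_⟩
  obtain rfl := add_right_cancel (A.eq_of_isFull_mem hf hj)
  have hvx : A.α x ≠ A.α v := fun h => hp.ne (A.inj hx hj h)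
  exact A.mod_ne hj hq.symm hvx (A.card_out_next' hy e2) (by rw [hl]; ring)

include A in
lemma not_mod_two (hl : (l : ZMod 3) = 2) (hl5 : l ≠ 5)
    (hk : ∀ x, Fintype.card V + 5 ≤ 3 * colorDegree c x) : False := by
  obtain ⟨κ, hκ⟩ := A.exists_forall_card_offColor_le hl hl5 hk
  have hl1 : (l : ZMod 3) - 1 = 1 := by rw [hl]; decide
  have hN := A.large_real
  set X : ZMod 3 → Finset V := fun i =>
    (A.U i).filter fun x => ¬ (x ∈ A.offColor i κ ∨ κ = A.α x) with hX
  have hXm : ∀ i x, x ∈ X i → x ∈ A.U i ∧ κ ≠ A.α x ∧ ∀ v ∈ A.extra i x, Col c x v κ := by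
    intro i x hx
    simp only [hX, Finset.mem_filter, mem_offColor] at hx
    push Not at hx
    exact ⟨hx.1, hx.2.2, hx.2.1 hx.1⟩
  have hXc : ∀ i, (32 / 100 : ℝ) * Fintype.card V ≤ (X i).card := by
    intro i
    have e1 : (((A.U i).filter fun x => x ∈ A.offColor i κ ∨ κ = A.α x).card : ℝ) ≤ 2 + 1 := by
      refine card_filter_le_add (fun _ _ h => h) ?_
        (card_filter_le_one fun u hu w hw h h' => A.inj hu hw (h.symm.trans h'))
      have : ((A.U i).filter fun x => x ∈ A.offColor i κ) ⊆ A.offColor i κ := fun x hx =>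
        (Finset.mem_filter.1 hx).2
      exact_mod_cast (Finset.card_le_card this).trans (hκ i)
    have e2 := Finset.card_filter_add_card_filter_not (s := A.U i)
      fun x => x ∈ A.offColor i κ ∨ κ = A.α x
    have e3 : (((A.U i).filter fun x => x ∈ A.offColor i κ ∨ κ = A.α x).card : ℝ) + (X i).card =
      (A.U i).card := by exact_mod_cast e2
    have := A.card_U_ge i
    linarith
  have hXle : ∀ i, ((X i).card : ℝ) ≤ 4 * ((32 / 100 : ℝ) * Fintype.card V) := by
    intro i
    have e1 := A.card_U_le i
    have e2 : ((X i).card : ℝ) ≤ (A.U i).card := by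
      exact_mod_cast Finset.card_le_card (Finset.filter_subset _ _)
    linarith
  let R : ZMod 3 → V → V → Prop := fun i y x =>
    (∃ v ∈ A.extra i x, v ∈ A.heads y ∧ ¬ Col c y v κ) ∨ A.α x = A.α y
  have hR : ∀ i k, k = i + 2 → ∀ y ∈ X k, (((X i).filter fun x => R i y x).card : ℝ) ≤
      3 / 10000 * (Fintype.card V : ℝ) + 1 := by
    intro i k hki y hy
    obtain ⟨hyU, hyκ, -⟩ := hXm k y hy
    refine card_filter_le_add
      (R := fun x => (∃ v ∈ A.extra i x, v ∈ A.heads y ∧ ¬ Col c y v κ) ∧ A.α x ≠ A.α y)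
      (S := fun x => A.α x = A.α y) (fun x _ h => by
        by_cases hα : A.α x = A.α y
        · exact Or.inr hα
        · exact Or.inl ⟨h.resolve_right hα, hα⟩) ?_ (card_filter_le_one
      fun u hu w hw h h' => A.inj (hXm i u hu).1 (hXm i w hw).1 (h.trans h'.symm))
    refine le_trans ?_ A.card_rest_le
    have h1 : ∀ x ∈ (X i).filter fun x => (∃ v ∈ A.extra i x, v ∈ A.heads y ∧ ¬ Col c y v κ) ∧
        A.α x ≠ A.α y, ∃ v, (∀ j, v ∉ A.U j) ∧ Col c y v (A.α x) := by
      intro x hx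
      rw [Finset.mem_filter] at hx
      obtain ⟨hxX, ⟨v, hv, hvy, hvyκ⟩, hα⟩ := hx
      obtain ⟨hxU, hxκ, hxE⟩ := hXm i x hxX
      obtain ⟨g1, g2⟩ := A.color_of_double hl hki hxU hyU hα hyκ hv (hxE v hv) hvy hvyκ
      exact ⟨v, g2, g1⟩
    have : Nonempty V := ⟨y⟩
    choose! f hf hf' using h1
    have h2 := Finset.card_le_card_of_injOn
      (t := Finset.univ.filter fun x => ∀ i, x ∉ A.U i) f
      (fun x hx => by simpa using hf x hx) (by
        intro x hx x' hx' hxx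
        have g1 := hf' x hx
        rw [hxx] at g1
        rw [Finset.mem_coe, Finset.mem_filter] at hx hx'
        exact A.inj (hXm i x hx.1).1 (hXm i x' hx'.1).1
          (g1.unique (hf' x' (Finset.mem_filter.2 hx'))))
    exact_mod_cast h2
  obtain ⟨x0, h0, x1, h1, x2, h2, r1, r2, r0⟩ := exists_triple_avoid (X 0) (X 1) (X 2) (R 1) (R 2)
    (R 0) (hR 1 0 (by decide)) (hR 2 1 (by decide)) (hR 0 2 (by decide)) (hXc 0) (hXc 1) (hXc 2)
    (hXle 2) (by linarith) (by linarith)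
  set T : ZMod 3 → V := fun i => if i = 0 then x0 else if i = 1 then x1 else x2 with hT
  have hTX : ∀ i, T i ∈ X i := by
    intro i
    obtain rfl | rfl | rfl := zmod_three_cases i 0 <;> simpa [hT]
  have hTR : ∀ i, ¬ R i (T (i + 2)) (T i) := by
    intro i
    obtain rfl | rfl | rfl := zmod_three_cases i 0
    · exact r0
    · exact r1
    · exact r2
  have hsum := A.card_heads_add_le hk (fun i => (hXm i _ (hTX i)).1)
    (fun i => (A.extra i (T i)).filter fun v => v ∈ A.heads (T (i + 1 + (l - 1))))
    (fun i v hv hv' => Finset.mem_filter.2 ⟨hv, hv'⟩) ∅ (by simp)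
  have hone : ∀ i, (A.extra i (T i)).card ≤ 1 := by
    intro i
    refine Finset.card_le_one.2 fun v hv w hw => ?_
    have hE := (hXm i _ (hTX i)).2.2
    exact A.assoc.eq_of_col (A.mem_heads.1 (A.mem_extra.1 hv).1).1
      (A.mem_heads.1 (A.mem_extra.1 hw).1).1 (hE v hv) (hE w hw)
  have key : ∀ i j, j = i + 2 →
      1 ≤ ((A.extra i (T i)).filter fun v => v ∈ A.heads (T (i + 1 + (l - 1)))).card →
      1 ≤ ((A.extra j (T j)).filter fun v => v ∈ A.heads (T (j + 1 + (l - 1)))).card → False := by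
    rintro i j rfl h1 h2
    obtain ⟨v, hv⟩ := Finset.card_pos.1 h1
    obtain ⟨w, hw⟩ := Finset.card_pos.1 h2
    rw [Finset.mem_filter] at hv hw
    have e : i + 1 + ((l : ZMod 3) - 1) = i + 2 := by rw [hl1]; ring
    rw [e] at hv
    refine hTR i (Or.inl ⟨v, hv.1, hv.2, fun hcol => ?_⟩)
    have hvw : v = w := A.assoc.eq_of_col (A.mem_heads.1 hv.2).1
      (A.mem_heads.1 (A.mem_extra.1 hw.1).1).1 hcol ((hXm _ _ (hTX (i + 2))).2.2 w hw.1)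
    have f1 := (A.mem_extra.1 hv.1).2
    have f2 := (A.mem_extra.1 hw.1).2
    have := f1.unique (hvw ▸ f2)
    have := add_right_cancel this
    exact absurd (left_eq_add.1 this) (by decide)
  obtain ⟨i, hi⟩ | ⟨i, j, hij, hi, hj⟩ := two_le_or_of_two_le_sum (f := fun i =>
    ((A.extra i (T i)).filter fun v => v ∈ A.heads (T (i + 1 + (l - 1)))).card) (by
      simp only [Finset.card_empty] at hsum; omega)
  · have := hone i
    have := Finset.card_filter_le (A.extra i (T i)) fun v => v ∈ A.heads (T (i + 1 + (l - 1)))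
    omega
  · rcases zmod_three_eq_add hij with h | h
    · exact key i j h hi hj
    · exact key j i h hj hi

end Setup

end RainbowTwo

section RainbowOne

open scoped Classical

variable {V : Type*} [Fintype V] {P : Type*} {G : SimpleGraph V} {D : Digraph V} {l : ℕ}
  {c : G.EdgeLabeling P}

namespace Setup

variable (A : Setup c D l)

lemma exists_col_of_extra_of_mod_one (hl : (l : ZMod 3) = 1) {j : ZMod 3} {x v : V}
    (h : v ∈ A.extra j x) : ∃ p, Col c x v p ∧ p ≠ A.α x ∧ A.IsFull v j := by
  rw [A.mem_extra, hl] at h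
  obtain ⟨p, hp, hpx⟩ := A.exists_col_of_mem_heads h.1
  exact ⟨p, hp, hpx, by simpa using h.2⟩

lemma card_back_conflict_le {a : ZMod 3} {Y : Finset V} (hY : Y ⊆ A.U a) {v : V}
    (hv : A.IsFull v a) (p : P) :
    ((Y.filter fun y => ¬ Col c v y (A.α y) ∨ p = A.α y).card : ℝ) ≤
      (Fintype.card V : ℝ) / 300 + 1 := by
  refine card_filter_le_add (fun _ _ h => h) ?_ (card_filter_le_one ?_)
  · refine le_trans ?_ hv.card_miss_le
    exact_mod_cast Finset.card_le_card (Finset.filter_subset_filter _ hY)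
  · intro u hu w hw h1 h2
    exact A.inj (hY hu) (hY hw) (h1.symm.trans h2)

/-- Nearly all unusual edges at the vertices of a class have the same color if `l ≡ 1`. -/
lemma exists_card_offColor_le (hl : (l : ZMod 3) = 1) (a : ZMod 3) :
    ∃ κ, ((A.offColor a κ).card : ℝ) ≤ (Fintype.card V : ℝ) / 60 := by
  have hN := A.large_real
  obtain ⟨x0, hx0⟩ := A.exists_mem_U a
  set X := (A.U a).filter fun x => (A.extra a x).Nonempty with hX
  have hXU : X ⊆ A.U a := Finset.filter_subset _ _
  have hXe : ∀ x ∈ X, ∃ v p, Col c x v p ∧ p ≠ A.α x ∧ A.IsFull v a := by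
    intro x hx
    obtain ⟨v, hv⟩ := (Finset.mem_filter.1 hx).2
    exact ⟨v, A.exists_col_of_extra_of_mod_one hl hv⟩
  have : Nonempty V := ⟨x0⟩
  have : Nonempty P := ⟨A.α x0⟩
  choose! f p hc hp hf using hXe
  have hoff : ∀ κ, A.offColor a κ ⊆ X := by
    intro κ x hx
    rw [A.mem_offColor] at hx
    obtain ⟨hx, v, hv, -⟩ := hx
    exact Finset.mem_filter.2 ⟨hx, v, hv⟩
  by_contra hcon
  push Not at hcon
  have hXc : (Fintype.card V : ℝ) / 60 < X.card := by
    refine (hcon (A.α x0)).trans_le ?_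
    exact_mod_cast Finset.card_le_card (hoff _)
  obtain ⟨x, hx, hK⟩ : ∃ x ∈ X, 2 * ((Fintype.card V : ℝ) / 300 + 1) <
      (X.filter fun y => p x = p y).card := by
    by_contra hK
    push Not at hK
    obtain ⟨x, hx, y, hy, h1, h2⟩ := exists_pair_avoid X X
      (fun x y => (¬ Col c (f x) y (A.α y) ∨ p x = A.α y) ∨ p x = p y)
      (fun x y => ¬ Col c (f y) x (A.α x) ∨ p y = A.α x)
      (fun x hx => card_filter_le_add (fun _ _ h => h)
        (A.card_back_conflict_le hXU (hf x hx) (p x)) (hK x hx))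
      (fun y hy => A.card_back_conflict_le hXU (hf y hy) (p y)) (by nlinarith)
    push Not at h1 h2
    exact h1.2 (A.eq_of_back_pair hl (hXU hx) (hXU hy) (hc x hx) (hp x hx) (hc y hy) (hp y hy)
      h1.1.1 h2.1 (hf y hy) h1.1.2 h2.2)
  have hQe : ∀ y ∈ A.offColor a (p x), ∃ v q, Col c y v q ∧ q ≠ A.α y ∧ A.IsFull v a ∧
      p x ≠ q := by
    intro y hy
    rw [A.mem_offColor] at hy
    obtain ⟨-, v, hv, hvp⟩ := hy
    obtain ⟨q, h1, h2, h3⟩ := A.exists_col_of_extra_of_mod_one hl hv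
    exact ⟨v, q, h1, h2, h3, fun h => hvp (h ▸ h1)⟩
  choose! g q hgc hq hg hpq using hQe
  have hKX : (X.filter fun y => p x = p y) ⊆ X := Finset.filter_subset _ _
  obtain ⟨u, hu, y, hy, h1, h2, h3, h4⟩ := A.exists_back_pair (hKX.trans hXU)
    ((hoff (p x)).trans hXU) hK (by have := hcon (p x); linarith) f g p q
    (fun u hu => hf u (hKX hu)) hg
  have huX := hKX hu
  have hup := (Finset.mem_filter.1 hu).2
  refine hpq y hy (hup.trans ?_)
  exact A.eq_of_back_pair hl (hXU huX) (hXU (hoff _ hy)) (hc u huX) (hp u huX) (hgc y hy) (hq y hy)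
    h1 h2 (hg y hy) h3 h4

/-- The vertices of the class `i` all of whose unusual edges have the color `κ`. -/
noncomputable def core (i : ZMod 3) (κ : P) : Finset V :=
  (A.U i).filter fun x => ∀ v ∈ A.extra i x, Col c x v κ

lemma mem_core {i : ZMod 3} {κ : P} {x : V} :
    x ∈ A.core i κ ↔ x ∈ A.U i ∧ ∀ v ∈ A.extra i x, Col c x v κ := by
  simp [core]

lemma card_extra_le_one {i : ZMod 3} {κ : P} {x : V} (hx : x ∈ A.core i κ) :
    (A.extra i x).card ≤ 1 := by
  refine Finset.card_le_one.2 fun v hv w hw => ?_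
  have hE := (A.mem_core.1 hx).2
  exact A.assoc.eq_of_col (A.mem_heads.1 (A.mem_extra.1 hv).1).1
    (A.mem_heads.1 (A.mem_extra.1 hw).1).1 (hE v hv) (hE w hw)

lemma ne_of_mem_core {i : ZMod 3} {κ : P} {x v : V} (hx : x ∈ A.core i κ)
    (hv : v ∈ A.extra i x) : κ ≠ A.α x := by
  rintro rfl
  exact (A.mem_heads.1 (A.mem_extra.1 hv).1).2 ((A.mem_core.1 hx).2 v hv)

lemma card_core_add (i : ZMod 3) (κ : P) :
    (A.core i κ).card + (A.offColor i κ).card = (A.U i).card := by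
  rw [core, offColor, ← Finset.card_filter_add_card_filter_not (s := A.U i)
    fun x => ∀ v ∈ A.extra i x, Col c x v κ]
  congr 2
  ext x
  simp

/-- The vertices of the class `i` with an unusual edge to a vertex of the same color in the
preceding class. -/
def IsTwin (i : ZMod 3) (x : V) : Prop := ∃ v ∈ A.extra i x, v ∈ A.U (i - 1) ∧ A.α v = A.α x

lemma card_filter_exists_le {i : ZMod 3} {X : Finset V} (hX : X ⊆ A.U i) (Q : V → Prop)
    [DecidablePred fun x => ∃ v, Q v ∧ ¬ Col c v x (A.α x)]
    (hQ : ∀ v w, Q v → Q w → v = w) (hQf : ∀ v, Q v → A.IsFull v i) :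
    ((X.filter fun x => ∃ v, Q v ∧ ¬ Col c v x (A.α x)).card : ℝ) ≤
      (Fintype.card V : ℝ) / 300 := by
  by_cases h : ∃ v, Q v
  · obtain ⟨v, hv⟩ := h
    refine le_trans ?_ (hQf v hv).card_miss_le
    have : (X.filter fun x => ∃ v, Q v ∧ ¬ Col c v x (A.α x)) ⊆
        (A.U i).filter fun y => ¬ Col c v y (A.α y) := by
      intro x hx
      rw [Finset.mem_filter] at hx
      obtain ⟨hx, w, hw, hwx⟩ := hx
      exact Finset.mem_filter.2 ⟨hX hx, hQ v w hv hw ▸ hwx⟩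
    exact_mod_cast Finset.card_le_card this
  · rw [Finset.filter_false_of_mem]
    · simp
      positivity
    · rintro x - ⟨v, hv, -⟩
      exact h ⟨v, hv⟩

/-- An unusual edge whose head is also the head of an unusual edge from the next class. -/
def IsDouble (i : ZMod 3) (x y : V) : Prop := ∃ v ∈ A.extra i x, v ∈ A.heads y

lemma cases_of_double (hl : (l : ZMod 3) = 1) {i : ZMod 3} {κ : P} {x y : V}
    (hx : x ∈ A.core i κ) (hy : y ∈ A.U (i + 1)) (h : A.IsDouble i x y) :
    A.IsTwin i x ∨
    (∃ v, (D.Adj y v ∧ Col c y v κ ∧ A.IsFull v i) ∧ ¬ Col c v x (A.α x)) ∨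
    (∃ v, (v ∈ A.U (i - 1) ∧ κ = A.α v ∧ A.IsFull v i) ∧ ¬ Col c v x (A.α x)) ∨
    ∃ v, (∀ j, v ∉ A.U j) ∧ Col c y v (A.α x) := by
  obtain ⟨v, hv, hvy⟩ := h
  have hxκ := A.ne_of_mem_core hx hv
  rw [A.mem_core] at hx
  obtain ⟨hxU, hxE⟩ := hx
  have hxv := hxE v hv
  obtain ⟨-, -, -, hf⟩ := A.exists_col_of_extra_of_mod_one hl hv
  have hvx : ¬ Col c v x (A.α x) := fun h => hxκ (hxv.unique h.symm)
  obtain ⟨q, hq, hqy⟩ := A.exists_col_of_mem_heads hvy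
  have e1 := hxv.ne
  have e2 := hq.ne
  have hxy : x ≠ y := by
    rintro rfl
    have := A.disj hxU hy
    simp at this
  have hl4 := A.four_le
  by_cases hqκ : q = κ
  · exact Or.inr (Or.inl ⟨v, ⟨(A.mem_heads.1 hvy).1, hqκ ▸ hq, hf⟩, hvx⟩)
  by_cases hqx : q = A.α x
  · subst hqx
    by_cases hU : ∀ j, v ∉ A.U j
    · exact Or.inr (Or.inr (Or.inr ⟨v, hU, hq⟩))
    push Not at hU
    obtain ⟨j, hj⟩ := hU
    have hij := A.eq_of_isFull_mem hf hj
    have hvU : v ∈ A.U (i - 1) := by rw [hij]; simpa using hj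
    by_cases hα : A.α v = A.α x
    · exact Or.inl ⟨v, hv, hvU, hα⟩
    by_cases hκv : κ = A.α v
    · exact Or.inr (Or.inr (Or.inl ⟨v, ⟨hvU, hκv, hf⟩, hvx⟩))
    exfalso
    obtain ⟨u, hu, huv, huS, huF⟩ := A.exists_mem_in hvU {x, v} ∅ (by
      have : ({x, v} : Finset V).card ≤ 2 := Finset.card_le_two
      simp; omega)
    simp only [Finset.mem_insert, Finset.mem_singleton, not_or] at huS
    refine A.no_rainbow (A.hasRainbowCycle_of_path A.large hxU [(κ, v), (A.α v, u)]
      ⟨hxv, huv.symm, rfl⟩ ?_ ?_ (A.card_out_next' hu rfl) ?_ ?_)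
    · grind
    · grind
    · simp; omega
    · rw [hl]; simp; ring_nf; decide
  · exfalso
    refine A.no_rainbow (A.hasRainbowCycle_of_path A.large hxU [(κ, v), (q, y)]
      ⟨hxv, hq.symm, rfl⟩ ?_ ?_ (A.card_out_next' hy rfl) ?_ ?_)
    · grind
    · grind
    · simp; omega
    · rw [hl]; simp; ring_nf

lemma card_double_le (hl : (l : ZMod 3) = 1) {i : ZMod 3} {κ : P} {X : Finset V}
    (hX : X ⊆ A.core i κ) {y : V} (hy : y ∈ A.U (i + 1)) :
    ((X.filter fun x => A.IsDouble i x y ∧ ¬ A.IsTwin i x).card : ℝ) ≤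
      7 / 1000 * (Fintype.card V : ℝ) := by
  have hXU : X ⊆ A.U i := fun x hx => (A.mem_core.1 (hX hx)).1
  have hrest : ((X.filter fun x => ∃ v, (∀ j, v ∉ A.U j) ∧ Col c y v (A.α x)).card : ℝ) ≤
      3 / 10000 * (Fintype.card V : ℝ) := by
    refine le_trans ?_ A.card_rest_le
    have h1 : ∀ x ∈ X.filter fun x => ∃ v, (∀ j, v ∉ A.U j) ∧ Col c y v (A.α x),
        ∃ v, (∀ j, v ∉ A.U j) ∧ Col c y v (A.α x) := fun x hx => (Finset.mem_filter.1 hx).2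
    have : Nonempty V := ⟨y⟩
    choose! f hf hf' using h1
    have h2 := Finset.card_le_card_of_injOn
      (t := Finset.univ.filter fun x => ∀ i, x ∉ A.U i) f
      (fun x hx => by simpa using hf x hx) (by
        intro x hx x' hx' hxx
        have g1 := hf' x hx
        rw [hxx] at g1
        have g2 := g1.unique (hf' x' hx')
        rw [Finset.mem_coe, Finset.mem_filter] at hx hx'
        exact A.inj (hXU hx.1) (hXU hx'.1) g2)
    exact_mod_cast h2
  have h1 : ((X.filter fun x => ∃ v, (D.Adj y v ∧ Col c y v κ ∧ A.IsFull v i) ∧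
      ¬ Col c v x (A.α x)).card : ℝ) ≤ (Fintype.card V : ℝ) / 300 :=
    A.card_filter_exists_le hXU (fun v => D.Adj y v ∧ Col c y v κ ∧ A.IsFull v i)
      (fun v w h h' => A.assoc.eq_of_col h.1 h'.1 h.2.1 h'.2.1) fun v h => h.2.2
  have h2 : ((X.filter fun x => ∃ v, (v ∈ A.U (i - 1) ∧ κ = A.α v ∧ A.IsFull v i) ∧
      ¬ Col c v x (A.α x)).card : ℝ) ≤ (Fintype.card V : ℝ) / 300 :=
    A.card_filter_exists_le hXU (fun v => v ∈ A.U (i - 1) ∧ κ = A.α v ∧ A.IsFull v i)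
      (fun v w h h' => A.inj h.1 h'.1 (h.2.1.symm.trans h'.2.1)) fun v h => h.2.2
  have h3 := card_filter_le_add (fun _ _ h => h) h2 hrest
  have h4 := card_filter_le_add (Q := fun x => A.IsDouble i x y ∧ ¬ A.IsTwin i x)
    (fun x hx h => (A.cases_of_double hl (hX hx) hy h.1).resolve_left h.2) h1 h3
  have := A.large_real
  linarith

/-- In two consecutive classes, most of the vertices are twins. -/
lemma exists_card_not_isTwin_lt (hl : (l : ZMod 3) = 1)
    (hk : ∀ x, Fintype.card V + 5 ≤ 3 * colorDegree c x) {κ : ZMod 3 → P}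
    (hκ : ∀ i, ((A.offColor i (κ i)).card : ℝ) ≤ (Fintype.card V : ℝ) / 60) :
    ∃ a, (((A.core a (κ a)).filter fun x => ¬ A.IsTwin a x).card : ℝ) <
        1 / 10 * (Fintype.card V : ℝ) ∧
      (((A.core (a + 1) (κ (a + 1))).filter fun x => ¬ A.IsTwin (a + 1) x).card : ℝ) <
        1 / 10 * (Fintype.card V : ℝ) := by
  have hN := A.large_real
  set B : ZMod 3 → Finset V := fun i => (A.core i (κ i)).filter fun x => ¬ A.IsTwin i x with hB
  suffices h : ∃ i j, i ≠ j ∧ ((B i).card : ℝ) < 1 / 10 * (Fintype.card V : ℝ) ∧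
      ((B j).card : ℝ) < 1 / 10 * (Fintype.card V : ℝ) by
    obtain ⟨i, j, hij, hi, hj⟩ := h
    have : ∀ i j : ZMod 3, i ≠ j → j = i + 1 ∨ i = j + 1 := by decide
    rcases this i j hij with rfl | rfl
    · exact ⟨i, hi, hj⟩
    · exact ⟨j, hj, hi⟩
  set Y : ZMod 3 → Finset V := fun i =>
    if 1 / 10 * (Fintype.card V : ℝ) ≤ (B i).card then B i else A.core i (κ i) with hY
  have hYc : ∀ i, Y i ⊆ A.core i (κ i) := by
    intro i
    simp only [hY]
    split_ifs
    · exact Finset.filter_subset _ _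
    · exact subset_refl _
  have hYU : ∀ i, Y i ⊆ A.U i := fun i x hx => (A.mem_core.1 (hYc i hx)).1
  have hYge : ∀ i, 1 / 10 * (Fintype.card V : ℝ) ≤ (Y i).card := by
    intro i
    simp only [hY]
    split_ifs with h
    · exact h
    · have h1 := A.card_core_add i (κ i)
      have h2 : ((A.core i (κ i)).card : ℝ) + (A.offColor i (κ i)).card = (A.U i).card := by
        exact_mod_cast h1
      have := hκ i
      have := A.card_U_ge i
      linarith
  have hYle : ∀ i, ((Y i).card : ℝ) ≤ 4 * (1 / 10 * (Fintype.card V : ℝ)) := by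
    intro i
    have e1 := A.card_U_le i
    have e2 : ((Y i).card : ℝ) ≤ (A.U i).card := by
      exact_mod_cast Finset.card_le_card (hYU i)
    linarith
  have hR : ∀ i k, k = i + 1 → ∀ y ∈ Y k,
      (((Y i).filter fun x => A.IsDouble i x y ∧ ¬ A.IsTwin i x).card : ℝ) ≤
        7 / 1000 * (Fintype.card V : ℝ) := by
    rintro i k rfl y hy
    exact A.card_double_le hl (hYc i) (hYU _ hy)
  let R : ZMod 3 → V → V → Prop := fun i y x => A.IsDouble i x y ∧ ¬ A.IsTwin i x
  obtain ⟨x0, h0, x2, h2, x1, h1, r2, r1, r0⟩ := exists_triple_avoid (Y 0) (Y 2) (Y 1) (R 2) (R 1)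
    (R 0) (hR 2 0 (by decide)) (hR 1 2 (by decide)) (hR 0 1 (by decide)) (hYge 0) (hYge 2) (hYge 1)
    (hYle 1) (by linarith) (by linarith)
  set T : ZMod 3 → V := fun i => if i = 0 then x0 else if i = 1 then x1 else x2 with hT
  have hTY : ∀ i, T i ∈ Y i := by
    intro i
    obtain rfl | rfl | rfl := zmod_three_cases i 0 <;> simpa [hT]
  have hTR : ∀ i, ¬ R i (T (i + 1)) (T i) := by
    intro i
    obtain rfl | rfl | rfl := zmod_three_cases i 0
    · exact r0
    · exact r1
    · exact r2
  have hsum := A.card_heads_add_le hk (fun i => hYU i (hTY i))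
    (fun i => (A.extra i (T i)).filter fun v => v ∈ A.heads (T (i + 1 + (l - 1))))
    (fun i v hv hv' => Finset.mem_filter.2 ⟨hv, hv'⟩) ∅ (by simp)
  have key : ∀ i, 1 ≤ ((A.extra i (T i)).filter
      fun v => v ∈ A.heads (T (i + 1 + (l - 1)))).card →
      ((B i).card : ℝ) < 1 / 10 * (Fintype.card V : ℝ) := by
    intro i hi
    obtain ⟨v, hv⟩ := Finset.card_pos.1 hi
    rw [Finset.mem_filter, hl, sub_self, add_zero] at hv
    by_contra hcon
    have h3 : T i ∈ B i := by
      have h4 := hTY i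
      simp only [hY] at h4
      rwa [if_pos (not_lt.1 hcon)] at h4
    exact hTR i ⟨⟨v, hv⟩, (Finset.mem_filter.1 h3).2⟩
  obtain ⟨i, hi⟩ | ⟨i, j, hij, hi, hj⟩ := two_le_or_of_two_le_sum (f := fun i =>
    ((A.extra i (T i)).filter fun v => v ∈ A.heads (T (i + 1 + (l - 1)))).card) (by
      simp only [Finset.card_empty] at hsum; omega)
  · have h3 := A.card_extra_le_one (hYc i (hTY i))
    have h4 := Finset.card_filter_le (A.extra i (T i)) fun v => v ∈ A.heads (T (i + 1 + (l - 1)))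
    omega
  · exact ⟨i, j, hij, key i hi, key j hj⟩

lemma isFull_of_mem (hl : (l : ZMod 3) = 1) {k : ZMod 3} {x : V} (hx : x ∈ A.U k) :
    A.IsFull x (k + 1) := by
  intro b hb
  have hN := A.large_real
  obtain rfl | rfl : b = k ∨ b = k - 1 := by
    clear hx; revert b k; decide
  · by_contra hcon
    obtain ⟨w, hw, hwx, -, hwF⟩ := A.exists_mem_in hx ∅ {A.α x} (by simp)
    rw [Finset.mem_singleton] at hwF
    refine A.mod_ne hw hwx (Ne.symm hwF) (not_lt.1 hcon) ?_
    rw [hl]; ring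
  · have h1 : (((A.U (k - 1)).filter fun u => Col c x u (A.α u)).card : ℝ) ≤
        (Fintype.card V : ℝ) / 10000 + 1 := by
      refine card_filter_le_add (R := fun u => ¬ Col c u x (A.α x)) (S := fun u => A.α u = A.α x)
        ?_ (A.miss_in hx) (card_filter_le_one fun u hu w hw h h' => A.inj hu hw (h.trans h'.symm))
      intro u hu h
      by_cases h' : Col c u x (A.α x)
      · exact Or.inr (h.unique h'.symm)
      · exact Or.inl h'
    have h2 : A.out x (k - 1) = (A.U (k - 1)).filter fun u => Col c x u (A.α u) := by
      ext u; simp [A.mem_out]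
    rw [h2]
    linarith

/-- The vertex `x` of the class `i` has an unusual edge to a vertex of the same color in `S`. -/
def HasTwinIn (i : ZMod 3) (S : Finset V) (x : V) : Prop :=
  ∃ v ∈ A.extra i x, v ∈ S ∧ A.α v = A.α x

/-- Distinct vertices of a class have distinct twins. -/
lemma card_twin_le {i : ZMod 3} {X S : Finset V} (hX : X ⊆ A.U i) :
    ((X.filter fun x => A.HasTwinIn i S x).card : ℝ) ≤ S.card := by
  by_cases hV : Nonempty V
  · have h1 : ∀ x ∈ X.filter fun x => A.HasTwinIn i S x, ∃ v, v ∈ S ∧ A.α v = A.α x := by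
      intro x hx
      obtain ⟨-, v, -, hv⟩ := Finset.mem_filter.1 hx
      exact ⟨v, hv⟩
    choose! f hf hf' using h1
    have h2 := Finset.card_le_card_of_injOn (t := S) f (fun x hx => hf x hx) (by
      intro x hx x' hx' hxx
      have g1 := hf' x hx
      rw [hxx, hf' x' hx'] at g1
      rw [Finset.mem_coe, Finset.mem_filter] at hx hx'
      exact A.inj (hX hx.1) (hX hx'.1) g1.symm)
    exact_mod_cast h2
  · have : IsEmpty V := not_nonempty_iff.1 hV
    simp [Finset.eq_empty_of_isEmpty]

end Setup

end RainbowOne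

section RainbowOne

open scoped Classical

variable {V : Type*} [Fintype V] {P : Type*} {G : SimpleGraph V} {D : Digraph V} {l : ℕ}
  {c : G.EdgeLabeling P}

namespace Setup

variable (A : Setup c D l)

/-- A chain of two twin edges in consecutive classes. -/
lemma exists_twin_chain (hl : (l : ZMod 3) = 1)
    (hk : ∀ x, Fintype.card V + 5 ≤ 3 * colorDegree c x) {κ : ZMod 3 → P}
    (hκ : ∀ i, ((A.offColor i (κ i)).card : ℝ) ≤ (Fintype.card V : ℝ) / 60) :
    ∃ a, ∃ x ∈ A.core (a + 1) (κ (a + 1)), ∃ y ∈ A.core a (κ a), ∃ z ∈ A.core (a + 2) (κ (a + 2)),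
      y ∈ A.extra (a + 1) x ∧ z ∈ A.extra a y ∧ A.α y = A.α x ∧ A.α z = A.α x := by
  have hN := A.large_real
  obtain ⟨a, h0, h1⟩ := A.exists_card_not_isTwin_lt hl hk hκ
  refine ⟨a, ?_⟩
  have hcore : ∀ i, ((A.core i (κ i)).card : ℝ) + (A.offColor i (κ i)).card = (A.U i).card :=
    fun i => by exact_mod_cast A.card_core_add i (κ i)
  have hcU : ∀ i, A.core i (κ i) ⊆ A.U i := fun i x hx => (A.mem_core.1 hx).1
  have e2 : a - 1 = a + 2 := by
    clear h0 h1; revert a; decide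
  set Y := (A.core a (κ a)).filter fun y => A.HasTwinIn a (A.core (a + 2) (κ (a + 2))) y with hY
  have hYU : Y ⊆ A.U a := (Finset.filter_subset _ _).trans (hcU a)
  have hYc : (((A.core a (κ a)).filter fun y =>
      ¬ A.HasTwinIn a (A.core (a + 2) (κ (a + 2))) y).card : ℝ) ≤
      1 / 10 * (Fintype.card V : ℝ) + (Fintype.card V : ℝ) / 60 := by
    refine card_filter_le_add (R := fun y => ¬ A.IsTwin a y)
      (S := fun y => A.HasTwinIn a (A.offColor (a + 2) (κ (a + 2))) y)
      ?_ h0.le ((A.card_twin_le (hcU a)).trans (hκ _))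
    intro y _ h
    by_cases hy : A.IsTwin a y
    · right
      obtain ⟨z, hz, hzU, hzα⟩ := hy
      rw [e2] at hzU
      refine ⟨z, hz, ?_, hzα⟩
      by_contra hcon
      refine h ⟨z, hz, A.mem_core.2 ⟨hzU, fun v hv => ?_⟩, hzα⟩
      by_contra hv'
      exact hcon (A.mem_offColor.2 ⟨hzU, v, hv, hv'⟩)
    · exact Or.inl hy
  have hYc' : (Y.card : ℝ) + ((A.core a (κ a)).filter fun y =>
      ¬ A.HasTwinIn a (A.core (a + 2) (κ (a + 2))) y).card = (A.core a (κ a)).card := by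
    exact_mod_cast Finset.card_filter_add_card_filter_not _
  obtain ⟨x, hx, hxY⟩ : ∃ x ∈ A.core (a + 1) (κ (a + 1)), ∃ y ∈ A.extra (a + 1) x, y ∈ Y ∧
      A.α y = A.α x := by
    by_contra hcon
    push Not at hcon
    have h2 : (((A.core (a + 1) (κ (a + 1))).filter fun _ => True).card : ℝ) ≤
        1 / 10 * (Fintype.card V : ℝ) + (A.U a \ Y).card := by
      refine card_filter_le_add (R := fun x => ¬ A.IsTwin (a + 1) x)
        (S := fun x => A.HasTwinIn (a + 1) (A.U a \ Y) x)
        ?_ h1.le (A.card_twin_le (hcU _))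
      intro x hx _
      by_cases hxT : A.IsTwin (a + 1) x
      · right
        obtain ⟨y, hy, hyU, hyα⟩ := hxT
        rw [add_sub_cancel_right] at hyU
        exact ⟨y, hy, Finset.mem_sdiff.2 ⟨hyU, fun h => hcon x hx y hy h hyα⟩, hyα⟩
      · exact Or.inl hxT
    rw [Finset.filter_true] at h2
    have h3 : ((A.U a \ Y).card : ℝ) + Y.card = (A.U a).card := by
      exact_mod_cast Finset.card_sdiff_add_card_eq_card hYU
    have := hcore a
    have := hcore (a + 1)
    have := hκ a
    have := hκ (a + 1)
    have := A.card_U_ge a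
    have := A.card_U_ge (a + 1)
    have := A.card_U_le a
    linarith
  obtain ⟨y, hy, hyY, hyα⟩ := hxY
  obtain ⟨hyc, z, hz, hzc, hzα⟩ := Finset.mem_filter.1 hyY
  exact ⟨x, hx, y, hyc, z, hzc, hy, hz, hyα, hzα.trans hyα⟩

include A in
lemma not_mod_one (hl : (l : ZMod 3) = 1)
    (hk : ∀ x, Fintype.card V + 5 ≤ 3 * colorDegree c x) : False := by
  have hl4 := A.four_le
  choose κ hκ using A.exists_card_offColor_le hl
  obtain ⟨a, x, hx, y, hy, z, hz, hxy, hyz, hyα, hzα⟩ := A.exists_twin_chain hl hk hκ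
  have hxU := (A.mem_core.1 hx).1
  have hyU := (A.mem_core.1 hy).1
  have hzU := (A.mem_core.1 hz).1
  have e12 : a + 1 ≠ a + 2 := by simp; decide
  have nyx : y ≠ x := fun h => absurd (left_eq_add.1 (A.disj hyU (h ▸ hxU))) (by decide)
  have nzy : z ≠ y := fun h => absurd (add_eq_left.1 (A.disj hzU (h ▸ hyU))) (by decide)
  have nzx : z ≠ x := fun h => e12 (A.disj hxU (h ▸ hzU))
  have cxy := (A.mem_core.1 hx).2 y hxy
  have cyz := (A.mem_core.1 hy).2 z hyz
  have hκx := A.ne_of_mem_core hx hxy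
  have hκy := A.ne_of_mem_core hy hyz
  obtain ⟨-, -, -, fy⟩ := A.exists_col_of_extra_of_mod_one hl hxy
  have h01 : κ (a + 1) = κ a := by
    by_contra hne
    refine A.no_rainbow (A.hasRainbowCycle_of_path A.large hxU [(κ (a + 1), y), (κ a, z)]
      ⟨cxy, cyz, rfl⟩ ?_ ?_ (A.card_out_next' hzU rfl) ?_ ?_)
    · grind
    · grind
    · simp; omega
    · rw [hl]; simp
  rw [h01] at cxy hκx
  have key : ∀ w ∈ A.core (a + 2) (κ (a + 2)), ∀ Z : Finset V,
      (∀ v ∈ Z, v = x ∨ (v = y ∧ y ∉ A.heads w)) →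
      2 + Z.card ≤ 2 + (A.extra (a + 2) w).card := by
    intro w hw Z hZ
    set T : ZMod 3 → V := fun i => if i = a then y else if i = a + 1 then x else w with hT
    have hT0 : T a = y := by simp [hT]
    have hT1 : T (a + 1) = x := by simp [hT]
    have hT2 : T (a + 2) = w := by
      have : a + 2 ≠ a := by simp; decide
      simp only [hT, if_neg this, if_neg e12.symm]
    have hi : ∀ i, i = a ∨ i = a + 1 ∨ i = a + 2 := fun i => zmod_three_cases i a
    have hsum := A.card_heads_add_le hk (x := T) ?_ (fun i => A.extra i (T i))
      (fun i v hv _ => hv) Z ?_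
    · have h3 : ∑ i, (A.extra i (T i)).card = (A.extra a (T a)).card +
          (A.extra (a + 1) (T (a + 1))).card + (A.extra (a + 2) (T (a + 2))).card := by
        rw [← Equiv.sum_comp (Equiv.addLeft a), sum_zmod_three]
        simp
      rw [h3, hT0, hT1, hT2] at hsum
      have := A.card_extra_le_one hx
      have := A.card_extra_le_one hy
      omega
    · intro i
      rcases hi i with rfl | rfl | rfl
      · rw [hT0]; exact hyU
      · rw [hT1]; exact hxU
      · rw [hT2]; exact (A.mem_core.1 hw).1
    · intro v hv i hvi
      have e : ∀ i, i + ((l : ZMod 3) - 1) = i := fun i => by rw [hl]; ring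
      rcases hZ v hv with rfl | ⟨rfl, hvw⟩
      · rcases hi i with rfl | rfl | rfl
        · rw [hT0, A.mem_heads] at hvi
          exact absurd (A.assoc.eq_of_col hvi.1
            (A.mem_heads.1 (A.mem_extra.1 hyz).1).1 cxy.symm cyz) nzx.symm
        · rw [hT1, A.mem_heads] at hvi
          obtain ⟨p, hp⟩ := A.assoc.exists_col hvi.1
          exact absurd rfl hp.ne
        · refine A.mem_extra.2 ⟨hvi, ?_⟩
          rw [e]
          have := A.isFull_of_mem hl hxU
          rwa [add_assoc, one_add_one_eq_two] at this
      · rcases hi i with rfl | rfl | rfl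
        · rw [hT0, A.mem_heads] at hvi
          obtain ⟨p, hp⟩ := A.assoc.exists_col hvi.1
          exact absurd rfl hp.ne
        · rw [hT1]; exact hxy
        · rw [hT2] at hvi
          exact absurd hvi hvw
  have h2 := key z hz {x} (by simp)
  rw [Finset.card_singleton] at h2
  obtain ⟨w, hw⟩ : (A.extra (a + 2) z).Nonempty := Finset.card_pos.1 (by omega)
  have czw := (A.mem_core.1 hz).2 w hw
  have hκz := A.ne_of_mem_core hz hw
  obtain ⟨-, -, -, fw⟩ := A.exists_col_of_extra_of_mod_one hl hw
  have nwy : w ≠ y := by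
    rintro rfl
    exact e12.symm (A.eq_of_isFull_mem fw hyU)
  have nwz := czw.ne
  have h20 : κ (a + 2) = κ a := by
    by_contra hne
    refine A.no_rainbow (A.hasRainbowCycle_of_path A.large hyU [(κ a, z), (κ (a + 2), w)]
      ⟨cyz, czw, rfl⟩ ?_ ?_ fw.linear ?_ ?_)
    · grind
    · grind
    · simp; omega
    · rw [hl]; simp
  rw [h20] at czw
  have hyz' : y ∉ A.heads z := fun h => nwy (A.assoc.eq_of_col
    (A.mem_heads.1 (A.mem_extra.1 hw).1).1 (A.mem_heads.1 h).1 czw cyz.symm)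
  have h3 := key z hz {x, y} (by
    intro v hv
    rw [Finset.mem_insert, Finset.mem_singleton] at hv
    exact hv.imp_right fun h => ⟨h, hyz'⟩)
  rw [Finset.card_pair nyx.symm] at h3
  have := A.card_extra_le_one hz
  omega

end Setup

end RainbowOne

section Blowup

open scoped Classical

variable {V : Type*} {P : Type*} {G : SimpleGraph V} {D : Digraph V} {l : ℕ}
  {c : G.EdgeLabeling P}

/-- Double counting: few elements have many relatives. -/
lemma card_filter_lt_mul_le {V W : Type*} (X : Finset V) (Y : Finset W) (R : V → W → Prop)
    [∀ x, DecidablePred (R x)] [∀ y, DecidablePred fun x => R x y] (t : ℝ) :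
    ((Y.filter fun y => t < (X.filter fun x => R x y).card).card : ℝ) * t ≤
      ∑ x ∈ X, ((Y.filter fun y => R x y).card : ℝ) := by
  have h1 : ∑ x ∈ X, ((Y.filter fun y => R x y).card : ℝ) =
      ∑ y ∈ Y, ((X.filter fun x => R x y).card : ℝ) := by
    exact_mod_cast Finset.sum_card_bipartiteAbove_eq_sum_card_bipartiteBelow (s := X) (t := Y) R
  rw [h1, ← nsmul_eq_mul]
  refine (Finset.card_nsmul_le_sum _ _ _ fun y hy => (Finset.mem_filter.1 hy).2.le).trans ?_
  exact Finset.sum_le_sum_of_subset_of_nonneg (Finset.filter_subset _ _) fun _ _ _ => by positivity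

lemma IsAssociated.card_color_le (hD : IsAssociated D c) (z : V) (X : Finset V) (F : Finset P) :
    (X.filter fun y => D.Adj z y ∧ ∃ p ∈ F, Col c z y p).card ≤ F.card := by
  have h1 : ∀ y ∈ X.filter fun y => D.Adj z y ∧ ∃ p ∈ F, Col c z y p,
      ∃ p ∈ F, Col c z y p := fun y hy => (Finset.mem_filter.1 hy).2.2
  by_cases hP : Nonempty P
  · choose! f hf hf' using h1
    refine Finset.card_le_card_of_injOn f hf ?_
    intro u hu w hw h
    have h2 := hf' u hu
    rw [h] at h2
    have h3 := hf' w hw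
    rw [Finset.mem_coe, Finset.mem_filter] at hu hw
    exact hD.eq_of_col hu.2.1 hw.2.1 h2 h3
  · rw [Finset.filter_false_of_mem]
    · simp
    · rintro y - ⟨-, p, -⟩
      exact hP ⟨p⟩

variable [Fintype V]

variable (D) in
/-- The digraph `D` looks like a blow-up of a directed triangle with classes `W i`. -/
structure Blowup where
  W : ZMod 3 → Finset V
  disj : ∀ {i j x}, x ∈ W i → x ∈ W j → i = j
  card_ge : ∀ i, (1 / 3 - 1 / 10 ^ 10) * (Fintype.card V : ℝ) ≤ ((W i).card : ℝ)
  miss_out : ∀ {i x}, x ∈ W i →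
    (((W (i + 1)).filter fun y => ¬ D.Adj x y).card : ℝ) ≤ 1 / 10 ^ 10 * (Fintype.card V : ℝ)
  miss_in : ∀ {i x}, x ∈ W i →
    (((W (i - 1)).filter fun y => ¬ D.Adj y x).card : ℝ) ≤ 1 / 10 ^ 10 * (Fintype.card V : ℝ)

namespace Blowup

variable (B : Blowup D)

lemma exists_next (hD : IsAssociated D c) {j : ZMod 3} {z : V} (hz : z ∈ B.W j) {S : Finset V}
    (hS : S ⊆ B.W (j + 1)) (F : Finset V) (Q : Finset P)
    (h : 1 / 10 ^ 10 * (Fintype.card V : ℝ) + F.card + Q.card < S.card) :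
    ∃ y ∈ S, ∃ p, Col c z y p ∧ y ∉ F ∧ p ∉ Q := by
  by_contra hcon
  push Not at hcon
  have h1 : S ⊆ ((B.W (j + 1)).filter fun y => ¬ D.Adj z y) ∪ F ∪
      (S.filter fun y => D.Adj z y ∧ ∃ p ∈ Q, Col c z y p) := by
    intro y hy
    simp only [Finset.mem_union, Finset.mem_filter, hy, hS hy, true_and]
    by_cases hzy : D.Adj z y
    · by_cases hF : y ∈ F
      · simp [hF]
      · obtain ⟨p, hp⟩ := hD.exists_col hzy
        exact Or.inr ⟨hzy, p, hcon y hy p hp hF, hp⟩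
    · simp [hzy]
  have h2 := Finset.card_le_card h1
  have h3 := Finset.card_union_le (((B.W (j + 1)).filter fun y => ¬ D.Adj z y) ∪ F)
    (S.filter fun y => D.Adj z y ∧ ∃ p ∈ Q, Col c z y p)
  have h4 := Finset.card_union_le ((B.W (j + 1)).filter fun y => ¬ D.Adj z y) F
  have h5 := hD.card_color_le z S Q
  have h6 : (S.card : ℝ) ≤ ((B.W (j + 1)).filter fun y => ¬ D.Adj z y).card + F.card + Q.card := by
    exact_mod_cast (by omega)
  have := B.miss_out hz
  linarith

/-- Rainbow paths of prescribed length from a vertex to a large set. -/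
lemma exists_path (hD : IsAssociated D c) (m : ℕ) {j : ZMod 3} {z : V} (hz : z ∈ B.W j)
    {S : Finset V} (hS : S ⊆ B.W (j + (m + 1)))
    (hSc : 2 / 10 ^ 10 * (Fintype.card V : ℝ) < S.card) (F : Finset V) (Q : Finset P)
    (h : (F.card : ℝ) + Q.card + 2 * m ≤ 1 / 10 ^ 10 * (Fintype.card V : ℝ)) :
    ∃ L w, w ∈ S ∧ IsTrail c z L w ∧ L.length = m + 1 ∧ (L.map Prod.snd).Nodup ∧
      (L.map Prod.fst).Nodup ∧ (∀ e ∈ L, e.2 ∉ F ∧ e.1 ∉ Q) := by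
  induction m generalizing j z F Q with
  | zero =>
    obtain ⟨y, hy, p, hp, hF, hQ⟩ := B.exists_next hD hz (by simpa using hS) F Q
      (by push_cast at h; linarith)
    exact ⟨[(p, y)], y, hy, ⟨hp, rfl⟩, rfl, by simp, by simp, by simp [hF, hQ]⟩
  | succ m ih =>
    push_cast at h
    have hm : (0 : ℝ) ≤ m := by positivity
    have hn : (0 : ℝ) ≤ (Fintype.card V : ℝ) := by positivity
    have hn' : (0 : ℝ) < (Fintype.card V : ℝ) := by
      have := Finset.card_pos.2 ⟨z, Finset.mem_univ z⟩
      rw [Finset.card_univ] at this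
      exact_mod_cast this
    obtain ⟨y, hy, p, hp, hF, hQ⟩ := B.exists_next hD hz (subset_refl _) F Q (by
      have := B.card_ge (j + 1)
      linarith)
    have h1 : (insert y F).card = F.card + 1 := Finset.card_insert_of_notMem hF
    have h2 : (insert p Q).card = Q.card + 1 := Finset.card_insert_of_notMem hQ
    obtain ⟨L, w, hw, g1, g2, g3, g4, g5⟩ := ih (j := j + 1) hy (by
      convert hS using 2; push_cast; ring) (insert y F) (insert p Q) (by
        rw [h1, h2]; push_cast; linarith)
    simp only [Finset.mem_insert, not_or] at g5
    refine ⟨(p, y) :: L, w, hw, ⟨hp, g1⟩, by simp [g2], ?_, ?_, ?_⟩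
    · rw [List.map_cons, List.nodup_cons, List.mem_map]
      exact ⟨fun ⟨e, he, h⟩ => (g5 e he).1.1 h, g3⟩
    · rw [List.map_cons, List.nodup_cons, List.mem_map]
      exact ⟨fun ⟨e, he, h⟩ => (g5 e he).2.1 h, g4⟩
    · intro e he
      rcases List.mem_cons.1 he with rfl | he
      · exact ⟨hF, hQ⟩
      · exact ⟨(g5 e he).1.2, (g5 e he).2.2⟩

variable (c) in
/-- The common out-neighbors of two vertices reached by edges of different colors. -/
noncomputable def cherries (i : ZMod 3) (w w' : V) : Finset V :=
  (B.W (i + 1)).filter fun x => (D.Adj w x ∧ D.Adj w' x) ∧ ¬ ∃ p, Col c w x p ∧ Col c w' x p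

lemma mem_cherries {i : ZMod 3} {w w' x : V} : x ∈ B.cherries c i w w' ↔
    x ∈ B.W (i + 1) ∧ (D.Adj w x ∧ D.Adj w' x) ∧ ¬ ∃ p, Col c w x p ∧ Col c w' x p := by
  simp [cherries]

lemma hasRainbowCycle_of_cherries (hD : IsAssociated D c)
    (hn : 10 ^ 11 * (l + 10) ≤ Fintype.card V) {i : ZMod 3} {w₀ : V} {S : Finset V}
    (hS : S ⊆ B.W i) (hSc : 2 / 10 ^ 10 * (Fintype.card V : ℝ) < S.card)
    (hch : ∀ w ∈ S, 1 / 10 ^ 10 * (Fintype.card V : ℝ) < (B.cherries c i w₀ w).card)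
    {j : ZMod 3} {z : V} (hz : z ∈ B.W j) (K : List (P × V)) (hK : IsTrail c w₀ K z)
    (hKv : (w₀ :: K.map Prod.snd).Nodup) (hKc : (K.map Prod.fst).Nodup)
    (hl : K.length + 3 ≤ l) (hmod : (l : ZMod 3) = K.length + 2 + (i - j)) :
    HasRainbowCycle c l := by
  obtain ⟨m, rfl⟩ : ∃ m, l = K.length + 3 + m := ⟨l - (K.length + 3), by omega⟩
  have hn' : (10 : ℝ) ^ 11 * (((K.length + 3 + m : ℕ) : ℝ) + 10) ≤ Fintype.card V := by
    exact_mod_cast hn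
  push_cast at hn'
  have hKF : ((w₀ :: K.map Prod.snd).toFinset.card : ℝ) ≤ K.length + 1 := by
    have := List.toFinset_card_le (w₀ :: K.map Prod.snd)
    rw [List.length_cons, List.length_map] at this
    exact_mod_cast this
  have hKQ : ((K.map Prod.fst).toFinset.card : ℝ) ≤ K.length := by
    have := List.toFinset_card_le (K.map Prod.fst)
    rw [List.length_map] at this
    exact_mod_cast this
  have hm : (0 : ℝ) ≤ m := by positivity
  have hKl : (0 : ℝ) ≤ K.length := by positivity
  obtain ⟨L, w, hw, g1, g2, g3, g4, g5⟩ := B.exists_path hD m hz (S := S) (by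
    have : j + ((m : ZMod 3) + 1) = i := by
      push_cast at hmod
      linear_combination hmod
    rwa [this]) hSc (w₀ :: K.map Prod.snd).toFinset (K.map Prod.fst).toFinset (by linarith)
  set M := K ++ L with hM
  have hMt : IsTrail c w₀ M w := isTrail_append.2 ⟨z, hK, g1⟩
  have hMl : M.length = K.length + (m + 1) := by rw [hM, List.length_append, g2]
  have hMv : (w₀ :: M.map Prod.snd).Nodup := by
    rw [hM, List.map_append, ← List.cons_append, List.nodup_append']
    refine ⟨hKv, g3, fun a ha ha' => ?_⟩
    obtain ⟨e, he, rfl⟩ := List.mem_map.1 ha'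
    exact (g5 e he).1 (List.mem_toFinset.2 ha)
  have hMc : (M.map Prod.fst).Nodup := by
    rw [hM, List.map_append, List.nodup_append']
    refine ⟨hKc, g4, fun a ha ha' => ?_⟩
    obtain ⟨e, he, rfl⟩ := List.mem_map.1 ha'
    exact (g5 e he).2 (List.mem_toFinset.2 ha)
  obtain ⟨x, hx, hxF, hx1, hx2⟩ : ∃ x ∈ B.cherries c i w₀ w, x ∉ (w₀ :: M.map Prod.snd) ∧
      (∀ p, Col c w₀ x p → p ∉ M.map Prod.fst) ∧ ∀ p, Col c w x p → p ∉ M.map Prod.fst := by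
    by_contra hcon
    push Not at hcon
    have h1 : B.cherries c i w₀ w ⊆ (w₀ :: M.map Prod.snd).toFinset ∪
        ((B.W (i + 1)).filter fun x => D.Adj w₀ x ∧ ∃ p ∈ (M.map Prod.fst).toFinset, Col c w₀ x p) ∪
        ((B.W (i + 1)).filter fun x => D.Adj w x ∧ ∃ p ∈ (M.map Prod.fst).toFinset, Col c w x p)
        := by
      intro x hx
      have hx' := B.mem_cherries.1 hx
      by_contra hcon'
      simp only [Finset.mem_union, Finset.mem_filter, List.mem_toFinset, not_or, not_and, not_exists]
        at hcon'
      obtain ⟨p, hp, hpM⟩ := hcon x hx hcon'.1.1 fun p hp hpM =>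
        hcon'.1.2 hx'.1 hx'.2.1.1 p hpM hp
      exact hcon'.2 hx'.1 hx'.2.1.2 p hpM hp
    have h2 := Finset.card_le_card h1
    have h3 := Finset.card_union_le ((w₀ :: M.map Prod.snd).toFinset ∪
        ((B.W (i + 1)).filter fun x => D.Adj w₀ x ∧ ∃ p ∈ (M.map Prod.fst).toFinset, Col c w₀ x p))
        ((B.W (i + 1)).filter fun x => D.Adj w x ∧ ∃ p ∈ (M.map Prod.fst).toFinset, Col c w x p)
    have h4 := Finset.card_union_le (w₀ :: M.map Prod.snd).toFinset
        ((B.W (i + 1)).filter fun x => D.Adj w₀ x ∧ ∃ p ∈ (M.map Prod.fst).toFinset, Col c w₀ x p)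
    have h5 := hD.card_color_le w₀ (B.W (i + 1)) (M.map Prod.fst).toFinset
    have h6 := hD.card_color_le w (B.W (i + 1)) (M.map Prod.fst).toFinset
    have h7 := List.toFinset_card_le (w₀ :: M.map Prod.snd)
    have h8 := List.toFinset_card_le (M.map Prod.fst)
    rw [List.length_cons, List.length_map] at h7
    rw [List.length_map] at h8
    have h9 : (B.cherries c i w₀ w).card ≤ 3 * (K.length + (m + 1)) + 1 := by omega
    have h10 : ((B.cherries c i w₀ w).card : ℝ) ≤ 3 * (K.length + (m + 1)) + 1 := by
      exact_mod_cast h9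
    have := hch w hw
    linarith
  rw [mem_cherries] at hx
  obtain ⟨p, hp⟩ := hD.exists_col hx.2.1.1
  obtain ⟨q, hq⟩ := hD.exists_col hx.2.1.2
  have hpq : q ≠ p := fun h => hx.2.2 ⟨p, hp, h ▸ hq⟩
  refine ⟨w₀, M ++ [(q, x), (p, w₀)], isTrail_append.2 ⟨w, hMt, hq, hp.symm, rfl⟩, ?_, ?_, ?_⟩
  · simp [hMl]; ring
  · have := hx1 p hp
    have := hx2 q hq
    simp only [List.map_append, List.map_cons, List.map_nil]
    grind
  · simp only [List.map_append, List.map_cons, List.map_nil]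
    grind

lemma exists_mem (i : ZMod 3) (hn : 1 ≤ Fintype.card V) : ∃ x, x ∈ B.W i := by
  have h1 := B.card_ge i
  have h2 : (1 : ℝ) ≤ Fintype.card V := by exact_mod_cast hn
  have h3 : (0 : ℝ) < (B.W i).card := by linarith
  exact Finset.card_pos.1 (by exact_mod_cast h3)

lemma card_cherries_le (hD : IsAssociated D c) (hn : 10 ^ 11 * (l + 10) ≤ Fintype.card V)
    (hl : 4 ≤ l) (h3 : ¬ 3 ∣ l) (hr : ¬ HasRainbowCycle c l) {i : ZMod 3} {w₀ : V}
    (hw : w₀ ∈ B.W i) :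
    (((B.W i).filter fun w => 1 / 10 ^ 10 * (Fintype.card V : ℝ) <
      (B.cherries c i w₀ w).card).card : ℝ) ≤ 2 / 10 ^ 10 * (Fintype.card V : ℝ) := by
  by_contra hcon
  push Not at hcon
  have hch : ∀ w ∈ (B.W i).filter fun w => 1 / 10 ^ 10 * (Fintype.card V : ℝ) <
      (B.cherries c i w₀ w).card, 1 / 10 ^ 10 * (Fintype.card V : ℝ) <
        (B.cherries c i w₀ w).card := fun w hw => (Finset.mem_filter.1 hw).2
  rcases Frame.length_mod h3 with hmod | hmod
  · obtain ⟨z, hz, hzw⟩ : ∃ z ∈ B.W (i - 1), D.Adj z w₀ := by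
      by_contra hno
      push Not at hno
      have h1 := B.miss_in hw
      rw [Finset.filter_true_of_mem hno] at h1
      have h2 := B.card_ge (i - 1)
      have h4 : (10 : ℝ) ^ 11 * ((l : ℝ) + 10) ≤ Fintype.card V := by exact_mod_cast hn
      have : (0 : ℝ) ≤ l := by positivity
      linarith
    obtain ⟨q, hq⟩ := hD.exists_col hzw
    refine hr (B.hasRainbowCycle_of_cherries hD hn (Finset.filter_subset _ _) hcon hch hz [(q, z)]
      ⟨hq.symm, rfl⟩ (by simpa using hq.ne.symm) (by simp) (by simpa using hl) ?_)
    rw [hmod]; simp; ring_nf; decide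
  · refine hr (B.hasRainbowCycle_of_cherries hD hn (Finset.filter_subset _ _) hcon hch hw []
      rfl (by simp) (by simp) (by simp; omega) ?_)
    rw [hmod]; simp

end Blowup

end Blowup

section Blowup

open scoped Classical

variable {V : Type*} [Fintype V] {P : Type*} {G : SimpleGraph V} {D : Digraph V} {l : ℕ}
  {c : G.EdgeLabeling P}

namespace Blowup

variable (B : Blowup D)

/-- Unless there are many cherries, the edges from `y` have the same colors as those from `w₀`. -/
lemma card_not_col_le {i : ZMod 3} {w₀ y : V} (hw : w₀ ∈ B.W i) (hy : y ∈ B.W i) {β : V → P}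
    (hβ : ∀ x, D.Adj w₀ x → Col c w₀ x (β x))
    (h : ((B.cherries c i w₀ y).card : ℝ) ≤ 1 / 10 ^ 10 * (Fintype.card V : ℝ)) :
    (((B.W (i + 1)).filter fun x => ¬ Col c y x (β x)).card : ℝ) ≤
      3 / 10 ^ 10 * (Fintype.card V : ℝ) := by
  have h1 := card_filter_le_add (Y := B.W (i + 1)) (Q := fun x => ¬ Col c y x (β x))
    (R := fun x => ¬ D.Adj w₀ x ∨ ¬ D.Adj y x)
    (S := fun x => (D.Adj w₀ x ∧ D.Adj y x) ∧ ¬ ∃ p, Col c w₀ x p ∧ Col c y x p)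
    (fun x _ hx => by
      by_cases hw : D.Adj w₀ x
      · by_cases hy : D.Adj y x
        · refine Or.inr ⟨⟨hw, hy⟩, ?_⟩
          rintro ⟨p, hp, hp'⟩
          exact hx (hp.unique (hβ x hw) ▸ hp')
        · exact Or.inl (Or.inr hy)
      · exact Or.inl (Or.inl hw))
    (card_filter_le_add (fun _ _ h => h) (B.miss_out hw) (B.miss_out hy)) h
  linarith

lemma sum_card_not_col_le (hD : IsAssociated D c) (hn : 10 ^ 11 * (l + 10) ≤ Fintype.card V)
    (hl : 4 ≤ l) (h3 : ¬ 3 ∣ l) (hr : ¬ HasRainbowCycle c l) {i : ZMod 3} {w₀ : V}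
    (hw : w₀ ∈ B.W i) {β : V → P} (hβ : ∀ x, D.Adj w₀ x → Col c w₀ x (β x)) :
    ∑ y ∈ B.W i, (((B.W (i + 1)).filter fun x => ¬ Col c y x (β x)).card : ℝ) ≤
      5 / 10 ^ 10 * (Fintype.card V : ℝ) * Fintype.card V := by
  set n : ℝ := (Fintype.card V : ℝ) with hn0
  have hn1 : 0 ≤ n := by positivity
  have hle : ∀ X : Finset V, (X.card : ℝ) ≤ n := fun X => by
    rw [hn0]; exact_mod_cast Finset.card_le_univ X
  have h1 : ∀ y ∈ B.W i, (((B.W (i + 1)).filter fun x => ¬ Col c y x (β x)).card : ℝ) ≤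
      (if 1 / 10 ^ 10 * n < (B.cherries c i w₀ y).card then n else 0) + 3 / 10 ^ 10 * n := by
    intro y hy
    split_ifs with h
    · have := hle ((B.W (i + 1)).filter fun x => ¬ Col c y x (β x))
      linarith
    · rw [zero_add]
      exact B.card_not_col_le hw hy hβ (not_lt.1 h)
  refine (Finset.sum_le_sum h1).trans ?_
  rw [Finset.sum_add_distrib, ← Finset.sum_filter, Finset.sum_const, Finset.sum_const, nsmul_eq_mul,
    nsmul_eq_mul]
  have h2 := B.card_cherries_le hD hn hl h3 hr hw
  have h4 := hle (B.W i)
  nlinarith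

include B in
lemma exists_frame (hD : IsAssociated D c) (hn : 10 ^ 11 * (l + 10) ≤ Fintype.card V)
    (hl : 4 ≤ l) (h3 : ¬ 3 ∣ l) (hr : ¬ HasRainbowCycle c l) : Nonempty (Frame c) := by
  have hn' : (10 : ℝ) ^ 11 * ((l : ℝ) + 10) ≤ Fintype.card V := by exact_mod_cast hn
  have hl0 : (0 : ℝ) ≤ l := by positivity
  choose w hw using fun i => B.exists_mem i (by omega)
  have : Nonempty P := by
    obtain ⟨-, -, p, -⟩ := B.exists_next hD (hw 0) (subset_refl _) ∅ ∅ (by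
      have := B.card_ge (0 + 1)
      simp only [Finset.card_empty, Nat.cast_zero, add_zero]
      linarith)
    exact ⟨p⟩
  have h1 : ∀ i x, ∃ p, D.Adj (w i) x → Col c (w i) x p := by
    intro i x
    by_cases h : D.Adj (w i) x
    · obtain ⟨p, hp⟩ := hD.exists_col h
      exact ⟨p, fun _ => hp⟩
    · exact ⟨Classical.arbitrary P, fun h' => absurd h' h⟩
  choose β hβ using h1
  have h2 : ∀ x, ∃ i, ∀ j, x ∈ B.W j → j = i := by
    intro x
    by_cases h : ∃ i, x ∈ B.W i
    · obtain ⟨i, hi⟩ := h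
      exact ⟨i, fun j hj => B.disj hj hi⟩
    · push Not at h
      exact ⟨0, fun j hj => absurd hj (h j)⟩
  choose ι hι using h2
  set α : V → P := fun x => β (ι x - 1) x with hα
  have hαβ : ∀ {i x}, x ∈ B.W i → α x = β (i - 1) x := fun hx => by rw [hα]; simp only [← hι _ _ hx]
  have hαβ' : ∀ {i x}, x ∈ B.W (i + 1) → α x = β i x := fun hx => by
    rw [hαβ hx, add_sub_cancel_right]
  set U : ZMod 3 → Finset V := fun i => (B.W i).filter fun x => ¬ ((¬ D.Adj (w (i - 1)) x ∨
    1 / 10 ^ 10 * (Fintype.card V : ℝ) < (B.cherries c i (w i) x).card) ∨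
    (Fintype.card V : ℝ) / 10000 < ((B.W (i - 1)).filter fun y => ¬ Col c y x (α x)).card) with hU
  have hUm : ∀ {i x}, x ∈ U i → x ∈ B.W i ∧ D.Adj (w (i - 1)) x ∧
      ((B.cherries c i (w i) x).card : ℝ) ≤ 1 / 10 ^ 10 * (Fintype.card V : ℝ) ∧
      (((B.W (i - 1)).filter fun y => ¬ Col c y x (α x)).card : ℝ) ≤
        (Fintype.card V : ℝ) / 10000 := by
    intro i x hx
    simp only [hU, Finset.mem_filter, not_or, not_not, not_lt] at hx
    exact ⟨hx.1, hx.2.1.1, hx.2.1.2, hx.2.2⟩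
  have hUW : ∀ i, U i ⊆ B.W i := fun i => Finset.filter_subset _ _
  refine ⟨U, α, fun hx hy => B.disj (hUW _ hx) (hUW _ hy), ?_, ?_, ?_, ?_⟩
  · intro i x y hx hy hxy
    have hx' := hUm hx
    have hy' := hUm hy
    rw [hαβ hx'.1, hαβ hy'.1] at hxy
    exact hD.eq_of_col hx'.2.1 hy'.2.1 (hβ _ _ hx'.2.1) (hxy ▸ hβ _ _ hy'.2.1)
  · intro i
    have e : i - 1 + 1 = i := sub_add_cancel i 1
    have k1 := B.sum_card_not_col_le hD hn hl h3 hr (hw (i - 1)) (hβ (i - 1))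
    rw [e] at k1
    have k2 : ∑ y ∈ B.W (i - 1), (((B.W i).filter fun x => ¬ Col c y x (α x)).card : ℝ) ≤
        5 / 10 ^ 10 * (Fintype.card V : ℝ) * Fintype.card V := by
      refine le_trans (le_of_eq ?_) k1
      refine Finset.sum_congr rfl fun y _ => ?_
      rw [Finset.filter_congr fun x hx => by rw [hαβ hx]]
    have k3 := (card_filter_lt_mul_le (B.W (i - 1)) (B.W i) (fun y x => ¬ Col c y x (α x))
      ((Fintype.card V : ℝ) / 10000)).trans k2
    have k4 : (((B.W i).filter fun x => (Fintype.card V : ℝ) / 10000 <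
        ((B.W (i - 1)).filter fun y => ¬ Col c y x (α x)).card).card : ℝ) ≤
        50000 / 10 ^ 10 * (Fintype.card V : ℝ) := by
      by_contra hcon
      push Not at hcon
      nlinarith
    have k5 := B.miss_out (hw (i - 1))
    rw [e] at k5
    have k6 := card_filter_le_add (fun _ _ h => h) (card_filter_le_add (fun _ _ h => h) k5
      (B.card_cherries_le hD hn hl h3 hr (hw i))) k4
    have k7 : ((B.W i).filter fun x => (¬ D.Adj (w (i - 1)) x ∨
        1 / 10 ^ 10 * (Fintype.card V : ℝ) < (B.cherries c i (w i) x).card) ∨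
        (Fintype.card V : ℝ) / 10000 <
          ((B.W (i - 1)).filter fun y => ¬ Col c y x (α x)).card).card + (U i).card =
        (B.W i).card := Finset.card_filter_add_card_filter_not _
    have k8 := B.card_ge i
    rw [← k7] at k8
    push_cast at k8
    linarith
  · intro i x hx
    obtain ⟨hxW, -, hxc, -⟩ := hUm hx
    have k1 := B.card_not_col_le (hw i) hxW (hβ i) hxc
    have k2 : ((U (i + 1)).filter fun y => ¬ Col c x y (α y)) ⊆
        (B.W (i + 1)).filter fun y => ¬ Col c x y (β i y) := by
      intro y hy
      rw [Finset.mem_filter] at hy ⊢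
      exact ⟨hUW _ hy.1, hαβ' (hUW _ hy.1) ▸ hy.2⟩
    have k3 : (((U (i + 1)).filter fun y => ¬ Col c x y (α y)).card : ℝ) ≤
        ((B.W (i + 1)).filter fun y => ¬ Col c x y (β i y)).card := by
      exact_mod_cast Finset.card_le_card k2
    linarith
  · intro i x hx
    refine le_trans ?_ (hUm hx).2.2.2
    exact_mod_cast Finset.card_le_card (Finset.filter_subset_filter _ (hUW _))

end Blowup

end Blowup

section Extremal

open scoped Classical

variable {V : Type*} {D : Digraph V}

lemma edgesBetween_eq_sum (A B : Finset V) :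
    edgesBetween D (A : Set V) B = ∑ x ∈ A, (B.filter fun y => D.Adj x y).card := by
  have h : {e : V × V | e.1 ∈ (A : Set V) ∧ e.2 ∈ (B : Set V) ∧ D.Adj e.1 e.2} =
      ((A ×ˢ B).filter fun e => D.Adj e.1 e.2 : Finset (V × V)) := by
    ext e
    simp [and_assoc]
  rw [edgesBetween, h, Set.ncard_coe_finset, Finset.card_filter, Finset.sum_product]
  exact Finset.sum_congr rfl fun x _ => (Finset.card_filter _ _).symm

lemma abs_sub_third_le {a₀ a₁ a₂ n δ : ℝ} (h : a₀ + a₁ + a₂ = n) (hn : 0 ≤ n) (hδ : 0 ≤ δ)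
    (h01 : (1 / 9 - δ ^ 2 / 6) * n ^ 2 ≤ a₀ * a₁) (h12 : (1 / 9 - δ ^ 2 / 6) * n ^ 2 ≤ a₁ * a₂)
    (h20 : (1 / 9 - δ ^ 2 / 6) * n ^ 2 ≤ a₂ * a₀) : |a₀ - n / 3| ≤ δ * n := by
  refine abs_le_of_sq_le_sq ?_ (by positivity)
  subst h
  nlinarith [sq_nonneg (a₁ - (a₀ + a₁ + a₂) / 3), sq_nonneg (a₂ - (a₀ + a₁ + a₂) / 3)]

lemma missing_le {a b s m n δ : ℝ} (hδ : 0 ≤ δ) (hδ' : δ ≤ 1 / 4) (hn : 0 ≤ n)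
    (hb : 0 ≤ b) (han : |a - n / 3| ≤ δ * n) (hbn : |b - n / 3| ≤ δ * n) (h : s + m = a * b)
    (hs : (1 / 9 - δ ^ 2 / 6) * n ^ 2 ≤ s) : m ≤ δ * n ^ 2 := by
  have h1 : a ≤ (1 / 3 + δ) * n := by linarith [(abs_le.1 han).2]
  have h2 : b ≤ (1 / 3 + δ) * n := by linarith [(abs_le.1 hbn).2]
  have h3 : a * b ≤ ((1 / 3 + δ) * n) * ((1 / 3 + δ) * n) :=
    mul_le_mul h1 h2 hb (by positivity)
  have h4 : 0 ≤ δ * (1 / 4 - δ) * n ^ 2 :=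
    mul_nonneg (mul_nonneg hδ (by linarith)) (by positivity)
  have h5 : 0 ≤ δ * n ^ 2 := by positivity
  nlinarith

variable [Fintype V]

/-- In an extremal partition, nearly all vertices are incident to nearly all possible arcs. -/
lemma exists_blowup {part : V → ZMod 3} (hn : 1 ≤ Fintype.card V)
    (h : IsExtremalPartition ((1 / 10 ^ 22) ^ 2 / 6) D part) : Nonempty (Blowup D) := by
  set n : ℝ := (Fintype.card V : ℝ) with hn0
  have hn1 : (1 : ℝ) ≤ n := by rw [hn0]; exact_mod_cast hn
  set X : ZMod 3 → Finset V := fun i => Finset.univ.filter fun x => part x = i with hX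
  have hXm : ∀ {i x}, x ∈ X i ↔ part x = i := by simp [hX]
  have h1 : ∀ i, (1 / 9 - (1 / 10 ^ 22) ^ 2 / 6) * n ^ 2 ≤
      ∑ x ∈ X i, (((X (i + 1)).filter fun y => D.Adj x y).card : ℝ) := by
    intro i
    have e : ∀ i, part ⁻¹' {i} = (X i : Set V) := fun i => by ext x; simp [hX]
    have := h i
    rw [e, e, edgesBetween_eq_sum] at this
    rw [hn0]
    exact_mod_cast this
  have h2 : ∀ i, ∑ x ∈ X i, (((X (i + 1)).filter fun y => D.Adj x y).card : ℝ) +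
      ∑ x ∈ X i, (((X (i + 1)).filter fun y => ¬ D.Adj x y).card : ℝ) =
        (X i).card * (X (i + 1)).card := by
    intro i
    rw [← Finset.sum_add_distrib, ← nsmul_eq_mul, ← Finset.sum_const]
    refine Finset.sum_congr rfl fun x _ => ?_
    exact_mod_cast Finset.card_filter_add_card_filter_not _
  have h3 : ((X 0).card : ℝ) + (X 1).card + (X 2).card = n := by
    have := Finset.card_eq_sum_card_fiberwise (f := part) (s := Finset.univ) (t := Finset.univ)
      (fun _ _ => Finset.mem_coe.2 (Finset.mem_univ _))
    rw [sum_zmod_three, Finset.card_univ] at this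
    rw [hn0]
    exact_mod_cast this.symm
  have h4 : ∀ i, (1 / 9 - (1 / 10 ^ 22) ^ 2 / 6) * n ^ 2 ≤ (X i).card * (X (i + 1)).card := by
    intro i
    rw [← h2 i]
    exact le_add_of_le_of_nonneg (h1 i) (Finset.sum_nonneg fun _ _ => Nat.cast_nonneg _)
  have h5 : ∀ i, |((X i).card : ℝ) - n / 3| ≤ 1 / 10 ^ 22 * n := by
    have g0 := h4 0
    have g1 := h4 1
    have g2 := h4 2
    rw [show (0 : ZMod 3) + 1 = 1 from rfl] at g0
    rw [show (1 : ZMod 3) + 1 = 2 from rfl] at g1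
    rw [show (2 : ZMod 3) + 1 = 0 from rfl] at g2
    have g3 : (0 : ℝ) ≤ 1 / 10 ^ 22 := by positivity
    have g4 : ((X 1).card : ℝ) + (X 2).card + (X 0).card = n := by rw [← h3]; ring
    have g5 : ((X 2).card : ℝ) + (X 0).card + (X 1).card = n := by rw [← h3]; ring
    have k0 := abs_sub_third_le h3 (zero_le_one.trans hn1) g3 g0 g1 g2
    have k1 := abs_sub_third_le g4 (zero_le_one.trans hn1) g3 g1 g2 g0
    have k2 := abs_sub_third_le g5 (zero_le_one.trans hn1) g3 g2 g0 g1
    intro i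
    obtain rfl | rfl | rfl := zmod_three_cases i 0
    exacts [k0, k1, k2]
  have h6 : ∀ i, ∑ x ∈ X i, (((X (i + 1)).filter fun y => ¬ D.Adj x y).card : ℝ) ≤
      1 / 10 ^ 22 * n ^ 2 := by
    intro i
    have e1 := h2 i
    have e2 := h1 i
    exact missing_le (by positivity) (by norm_num) (zero_le_one.trans hn1)
      (Nat.cast_nonneg _) (h5 i) (h5 (i + 1)) (h2 i) (h1 i)
  set Y : ZMod 3 → Finset V := fun i => (X i).filter fun x =>
    ¬ (1 / 10 ^ 10 * n < ((X (i + 1)).filter fun y => ¬ D.Adj x y).card ∨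
      1 / 10 ^ 10 * n < ((X (i - 1)).filter fun y => ¬ D.Adj y x).card) with hY
  have hYX : ∀ i, Y i ⊆ X i := fun i => Finset.filter_subset _ _
  refine ⟨Y, fun hx hy => (hXm.1 (hYX _ hx)).symm.trans (hXm.1 (hYX _ hy)), ?_, ?_, ?_⟩
  · intro i
    have e : i - 1 + 1 = i := sub_add_cancel i 1
    have h6' := h6 (i - 1)
    rw [e] at h6'
    have k1 := (card_filter_lt_mul_le (X (i - 1)) (X i) (fun y x => ¬ D.Adj y x)
      (1 / 10 ^ 10 * n)).trans h6'
    have k2 : (((X i).filter fun x => 1 / 10 ^ 10 * n <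
        ((X (i + 1)).filter fun y => ¬ D.Adj x y).card).card : ℝ) * (1 / 10 ^ 10 * n) ≤
        1 / 10 ^ 22 * n ^ 2 := by
      refine le_trans ?_ (h6 i)
      rw [← nsmul_eq_mul]
      refine (Finset.card_nsmul_le_sum _ _ _ fun y hy => (Finset.mem_filter.1 hy).2.le).trans ?_
      exact Finset.sum_le_sum_of_subset_of_nonneg (Finset.filter_subset _ _)
        fun _ _ _ => Nat.cast_nonneg _
    have k3 : (((X i).filter fun x => 1 / 10 ^ 10 * n <
        ((X (i + 1)).filter fun y => ¬ D.Adj x y).card).card : ℝ) ≤ 1 / 10 ^ 12 * n := by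
      by_contra hcon
      push Not at hcon
      nlinarith
    have k4 : (((X i).filter fun x => 1 / 10 ^ 10 * n <
        ((X (i - 1)).filter fun y => ¬ D.Adj y x).card).card : ℝ) ≤ 1 / 10 ^ 12 * n := by
      by_contra hcon
      push Not at hcon
      nlinarith
    have k5 := card_filter_le_add (fun _ _ h => h) k3 k4
    have k6 : ((X i).filter fun x =>
        1 / 10 ^ 10 * n < ((X (i + 1)).filter fun y => ¬ D.Adj x y).card ∨
        1 / 10 ^ 10 * n < ((X (i - 1)).filter fun y => ¬ D.Adj y x).card).card + (Y i).card =
        (X i).card := Finset.card_filter_add_card_filter_not _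
    have k7 := abs_le.1 (h5 i)
    rw [← k6] at k7
    push_cast at k7
    linarith
  · intro i x hx
    simp only [hY, Finset.mem_filter, not_or, not_lt] at hx
    refine le_trans ?_ hx.2.1
    exact_mod_cast Finset.card_le_card (Finset.filter_subset_filter _ (hYX _))
  · intro i x hx
    simp only [hY, Finset.mem_filter, not_or, not_lt] at hx
    refine le_trans ?_ hx.2.2
    exact_mod_cast Finset.card_le_card (Finset.filter_subset_filter _ (hYX _))

end Extremal

section Main

variable {V : Type*} [Fintype V] {P : Type*} {G : SimpleGraph V}

lemma le_colorDegree {c : G.EdgeLabeling P} {k : ℕ}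
    (h : ((Fintype.card V : ℝ) + k) / 3 ≤ (minColorDegree c : ℝ)) (x : V) :
    Fintype.card V + k ≤ 3 * colorDegree c x := by
  have h1 : minColorDegree c ≤ colorDegree c x := ciInf_le (OrderBot.bddBelow _) x
  have h2 : (minColorDegree c : ℝ) ≤ colorDegree c x := by exact_mod_cast h1
  have h3 : (Fintype.card V : ℝ) + k ≤ 3 * colorDegree c x := by linarith
  exact_mod_cast h3

lemma IsExtremalPartition.mono {lam lam' : ℝ} (h : lam ≤ lam') {D : Digraph V}
    {part : V → ZMod 3} (hp : IsExtremalPartition lam D part) :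
    IsExtremalPartition lam' D part := fun i => by
  refine le_trans ?_ (hp i)
  gcongr

/-- Extremal graphs of large color degree without rainbow cycles have a frame. -/
lemma IsExtremal.exists_setup {c : G.EdgeLabeling P} {lam : ℝ} {l : ℕ}
    (hlam : lam ≤ (1 / 10 ^ 22) ^ 2 / 6) (hc : IsExtremal lam c) (hl : 4 ≤ l) (h3 : ¬ 3 ∣ l)
    (hn : 10 ^ 11 * (l + 10) ≤ Fintype.card V) (hr : ¬ HasRainbowCycle c l)
    (hd : ∀ x, Fintype.card V + 4 ≤ 3 * colorDegree c x) :
    ∃ D, Nonempty (Setup c D l) := by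
  obtain ⟨D, hD, part, hpart⟩ := hc
  obtain ⟨B⟩ := exists_blowup (by omega) (hpart.mono hlam)
  obtain ⟨A⟩ := B.exists_frame hD hn hl h3 hr
  exact ⟨D, ⟨{ A with
    assoc := hD
    large := by omega
    four_le := hl
    not_dvd := h3
    no_rainbow := hr
    degree := hd }⟩⟩

end Main

end ColoredCycles

theorem lemma2p7 :
    ∃ lam₀ : ℝ, 0 < lam₀ ∧
      ∀ lam : ℝ, 0 < lam → lam ≤ lam₀ →
      ∀ l : ℕ, 4 ≤ l → ¬ 3 ∣ l →
      ∃ n₀ : ℕ, 1 ≤ n₀ ∧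
        ∀ (V : Type*) [Fintype V] (P : Type*) (G : SimpleGraph V) (c : G.EdgeLabeling P),
          n₀ ≤ Fintype.card V →
          ColoredCycles.IsExtremal lam c →
          (l ≠ 5 → ((Fintype.card V : ℝ) + 5) / 3 ≤ (ColoredCycles.minColorDegree c : ℝ) →
            ∃ H : G.Subgraph,
              ColoredCycles.IsCycleOfLength H l ∧ ColoredCycles.IsRainbow c H) ∧
          (((Fintype.card V : ℝ) + 4) / 3 ≤ (ColoredCycles.minColorDegree c : ℝ) →
            ∃ H : G.Subgraph,
              ColoredCycles.IsCycleOfLength H l ∧ ColoredCycles.IsProperlyColored c H) := by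
  refine ⟨(1 / 10 ^ 22) ^ 2 / 6, by positivity, fun lam _ hlam l hl h3 =>
    ⟨10 ^ 11 * (l + 10), by omega, fun V _ P G c hn hc => ⟨fun hl5 hd => ?_, fun hd => ?_⟩⟩⟩
  · refine ColoredCycles.HasRainbowCycle.exists_subgraph (by omega) ?_
    by_contra hr
    have hk := ColoredCycles.le_colorDegree (c := c) (k := 5) (by exact_mod_cast hd)
    obtain ⟨D, ⟨A⟩⟩ := hc.exists_setup hlam hl h3 hn hr fun x => by have := hk x; omega
    rcases A.mod_cases with hmod | hmod
    · exact A.not_mod_one hmod hk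
    · exact A.not_mod_two hmod hl5 hk
  · refine ColoredCycles.HasProperCycle.exists_subgraph (by omega) ?_
    by_cases hr : ColoredCycles.HasRainbowCycle c l
    · exact hr.hasProperCycle (by omega)
    · obtain ⟨D, ⟨A⟩⟩ := hc.exists_setup hlam hl h3 hn hr
        (ColoredCycles.le_colorDegree (c := c) (k := 4) (by exact_mod_cast hd))
      exact A.hasProperCycle
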